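/- All algebras are associative, unital and over $\mathbb{C}$. A differential calculus $(\Omega A,d)$ over an algebra $A$ is a differential graded algebra $\Omega A=\bigoplus_{n\ge 0}\Omega^nA$ (degree-one $d$, graded Leibniz rule, $d\circ d=0$) with $\Omega^0A=A$ and $\Omega^nA=A\,dA\wedge\cdots\wedge dA$ ($n$ factors $dA$). It is connected if $\ker d|_A=\mathbb{C}\cdot 1$, and has dimension $n$ if $\Omega^nA\neq 0$ and $\Omega^mA=0$ for all $m>n$. For a subalgebra $B\subseteq A$, the restriction of $\Omega A$ to $B$ is the calculus with $\Omega^nB=B\,dB\wedge\cdots\wedge dB\subseteq\Omega^nA$. Let $\mathcal{I}_kA$ be the space of right $A$-linear maps $\Omega^kA\to A$, with $(a\cdot\phi\cdot b)(\omega)=a\phi(b\omega)$ and, for $\phi\in\mathcal{I}_{n+m}A$, $\omega\in\Omega^nA$, $\omega'\in\Omega^mA$, $(\phi\cdot\omega)(\omega')=\phi(\omega\wedge\omega')$. A divergence is a linear map $\nabla:\mathcal{I}_1A\to A$ with $\nabla(\phi\cdot a)=\nabla(\phi)a+\phi(da)$; it extends to $\nabla_n:\mathcal{I}_{n+1}A\to\mathcal{I}_nA$,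 $\nabla_n(\phi)(\omega)=\nabla(\phi\cdot\omega)+(-1)^{n+1}\phi(d\omega)$ (with $\nabla_0=\nabla$ under $\mathcal{I}_0A\cong A$), and is flat if $\nabla\circ\nabla_1=0$. An $n$-dimensional calculus is integrable if there are a flat divergence $\nabla$, an algebra automorphism $\nu$ of $A$ and linear isomorphisms $\Theta_k:\Omega^kA\to\mathcal{I}_{n-k}A$, $0\le k\le n$, with $\Theta_k(a\omega b)=\nu(a)\cdot\Theta_k(\omega)\cdot b$ for all $a,b\in A$, and $\Theta_{k+1}\circ d=\nabla_{n-k-1}\circ\Theta_k$ for $0\le k<n$. For an algebra $A$ generated by a finite set, let $\mathcal{V}(n)$ be the span of all words of length at most $n$ in the generators; the Gelfand-Kirillov dimension of $A$ is $\inf\{\nu\mid \dim\mathcal{V}(n)\le n^\nu \text{ for } n\gg 0\}$ (independent of the generating set). A finitely generated algebra of integer Gelfand-Kirillov dimension $n$ is differentially smooth if it admits an $n$-dimensional connected integrable differential calculus. Let $N\ge 1$ be an integer, $q>0$ and $\kappa\in\mathbb{R}$, and put $[n]_q=\frac{1-q^n}{1-q}$ for $n\in\mathbb{Z}$ (read as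 $n$ if $q=1$). The quantum disc algebra $\mathcal{O}(D_{q,\kappa})$ is the $*$-algebra generated by $z,z^*$ with $z^*z-qzz^*=\kappa$. Its calculus $\Omega(D_{q,\kappa})$ is generated by $z,z^*$ and the one-forms $dz,dz^*$ subject to this relation, the relations $$z\,dz=q^{-1}dz\,z,\quad z^*dz=q\,dz\,z^*,\quad dz\wedge dz^*=-q^{-1}dz^*\wedge dz,\quad dz\wedge dz=0,$$ and their $*$-conjugates. The quantum cone algebra $\mathcal{O}(C^N_{q,\kappa})$ is the $*$-algebra generated by $a=a^*$, $b$, $b^*$ with relations $$ab=q^Nba+\kappa[N]_qb,\quad bb^*=\prod_{l=0}^{N-1}(q^{-l}a+\kappa[-l]_q),\quad b^*b=\prod_{l=1}^{N}(q^la+\kappa[l]_q),$$ embedded in $\mathcal{O}(D_{q,\kappa})$ by $a\mapsto zz^*$, $b\mapsto z^N$, and $\Omega(C^N_{q,\kappa})$ denotes the restriction of $\Omega(D_{q,\kappa})$ to $\mathcal{O}(C^N_{q,\kappa})$. **Theorem.** For all integers $N\ge 1$, all real $q>0$ and all real $\kappa\neq 0$, $\Omega(C^N_{q,\kappa})$ is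 a $2$-dimensional connected integrable differential calculus over $\mathcal{O}(C^N_{q,\kappa})$. Moreover $\mathcal{O}(C^N_{q,\kappa})$ is finitely generated of Gelfand-Kirillov dimension $2$, and hence it is differentially smooth. -/

import Mathlib

open scoped NNReal ENNReal

noncomputable section

namespace QuantumCone

/-! ### Differential calculi over an algebra -/

/-- Raw data of a differential calculus over `A`: an ambient algebra `E`, an algebra map
`ι : A → E` and a linear map `d`. The calculus itself is the graded subalgebra `⨁ Ωⁿ` of `E`,
where `Ωⁿ = A dA ∧ ⋯ ∧ dA` is `CalculusData.forms n`. -/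
structure CalculusData (A : Type) [Ring A] [Algebra ℂ A] where
  E : Type
  [ring : Ring E]
  [algebra : Algebra ℂ E]
  ι : A →ₐ[ℂ] E
  d : E →ₗ[ℂ] E

attribute [instance] CalculusData.ring CalculusData.algebra

namespace CalculusData

variable {A : Type} [Ring A] [Algebra ℂ A]

/-- `Ωⁿ = A dA ∧ ⋯ ∧ dA` (`n` factors `dA`): the span of all `a₀ da₁ ∧ ⋯ ∧ daₙ`. -/
def forms (Γ : CalculusData A) (n : ℕ) : Submodule ℂ Γ.E :=
  Submodule.span ℂ {x | ∃ (a : A) (l : List A), l.length = n ∧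
    x = Γ.ι a * (l.map fun b => Γ.d (Γ.ι b)).prod}

/-- Restriction along an algebra map `j : B → A` (an inclusion): `Ωⁿ B = B dB ∧ ⋯ ∧ dB ⊆ Ωⁿ A`. -/
def restrict (Γ : CalculusData A) {B : Type} [Ring B] [Algebra ℂ B] (j : B →ₐ[ℂ] A) :
    CalculusData B where
  E := Γ.E
  ι := Γ.ι.comp j
  d := Γ.d

end CalculusData

/-- A differential calculus over `A`: `Ω⁰ = A` (via the injective map `ι`), the sum of the `Ωⁿ` is
direct, `d` satisfies the graded Leibniz rule and `d ∘ d = 0`. That the product and `d`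
have degrees `0` and `1` is automatic, see `mul_mem_forms` and `d_mem_forms`. -/
structure DifferentialCalculus (A : Type) [Ring A] [Algebra ℂ A] extends CalculusData A where
  ι_injective : Function.Injective ι
  independent : iSupIndep toCalculusData.forms
  leibniz : ∀ m n : ℕ, ∀ x ∈ toCalculusData.forms m, ∀ y ∈ toCalculusData.forms n,
    d (x * y) = d x * y + (-1 : ℂ) ^ m • (x * d y)
  d_d : ∀ n : ℕ, ∀ x ∈ toCalculusData.forms n, d (d x) = 0

namespace DifferentialCalculus

variable {A : Type} [Ring A] [Algebra ℂ A] (Γ : DifferentialCalculus A)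

lemma ι_mem_forms (a : A) : Γ.ι a ∈ Γ.forms 0 :=
  Submodule.subset_span ⟨a, [], rfl, by simp⟩

lemma leibniz_ι (a b : A) :
    Γ.d (Γ.ι (a * b)) = Γ.d (Γ.ι a) * Γ.ι b + Γ.ι a * Γ.d (Γ.ι b) := by
  have := Γ.leibniz 0 0 _ (Γ.ι_mem_forms a) _ (Γ.ι_mem_forms b)
  simpa using this

lemma forms_ι_mul {n : ℕ} (a : A) {x : Γ.E} (hx : x ∈ Γ.forms n) :
    Γ.ι a * x ∈ Γ.forms n := by
  induction hx using Submodule.span_induction with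
  | mem x hx =>
    obtain ⟨b, l, hl, rfl⟩ := hx
    exact Submodule.subset_span ⟨a * b, l, hl, by rw [map_mul, mul_assoc]⟩
  | zero => simp
  | add x y _ _ hx hy => rw [mul_add]; exact add_mem hx hy
  | smul c x _ hx => rw [mul_smul_comm]; exact Submodule.smul_mem _ _ hx

lemma forms_mul_d {n : ℕ} (b : A) {x : Γ.E} (hx : x ∈ Γ.forms n) :
    x * Γ.d (Γ.ι b) ∈ Γ.forms (n + 1) := by
  induction hx using Submodule.span_induction with
  | mem x hx =>
    obtain ⟨a, l, hl, rfl⟩ := hx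
    exact Submodule.subset_span ⟨a, l ++ [b], by simp [hl], by simp [mul_assoc]⟩
  | zero => simp
  | add x y _ _ hx hy => rw [add_mul]; exact add_mem hx hy
  | smul c x _ hx => rw [smul_mul_assoc]; exact Submodule.smul_mem _ _ hx

lemma forms_mul_ι {n : ℕ} (b : A) {x : Γ.E} (hx : x ∈ Γ.forms n) :
    x * Γ.ι b ∈ Γ.forms n := by
  induction hx using Submodule.span_induction with
  | mem x hx =>
    obtain ⟨a, l, hl, rfl⟩ := hx
    induction l using List.reverseRecOn generalizing n b with
    | nil =>
      simp only [List.length_nil] at hl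
      subst hl
      simpa using Γ.ι_mem_forms (a * b)
    | append_singleton l c ih =>
      have h1 : Γ.d (Γ.ι c) * Γ.ι b = Γ.d (Γ.ι (c * b)) - Γ.ι c * Γ.d (Γ.ι b) := by
        rw [Γ.leibniz_ι]; abel
      have hn : n = l.length + 1 := by simpa using hl.symm
      subst hn
      simp only [List.map_append, List.map_cons, List.map_nil, List.prod_append,
        List.prod_cons, List.prod_nil, mul_one, mul_assoc]
      rw [h1, mul_sub, mul_sub]
      refine sub_mem ?_ ?_
      · rw [← mul_assoc]
        exact Γ.forms_mul_d _ (Submodule.subset_span ⟨a, l, rfl, rfl⟩)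
      · rw [← mul_assoc, ← mul_assoc]
        have := Γ.forms_mul_d b (ih (n := l.length) c rfl)
        simpa only [mul_assoc] using this
  | zero => simp
  | add x y _ _ hx hy => rw [add_mul]; exact add_mem hx hy
  | smul c x _ hx => rw [smul_mul_assoc]; exact Submodule.smul_mem _ _ hx

lemma mul_mem_forms {m n : ℕ} {x y : Γ.E} (hx : x ∈ Γ.forms m) (hy : y ∈ Γ.forms n) :
    x * y ∈ Γ.forms (m + n) := by
  induction hy using Submodule.span_induction with
  | mem y hy =>
    obtain ⟨a, l, hl, rfl⟩ := hy
    induction l using List.reverseRecOn generalizing n with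
    | nil =>
      simp only [List.length_nil] at hl
      subst hl
      simpa using Γ.forms_mul_ι a hx
    | append_singleton l c ih =>
      have hn : n = l.length + 1 := by simpa using hl.symm
      subst hn
      have := Γ.forms_mul_d c (ih (n := l.length) rfl)
      simpa [mul_assoc, add_assoc] using this
  | zero => simp
  | add y z _ _ hy hz => rw [mul_add]; exact add_mem hy hz
  | smul c y _ hy => rw [mul_smul_comm]; exact Submodule.smul_mem _ _ hy

lemma d_ι_one : Γ.d (Γ.ι 1) = 0 := by
  have := Γ.leibniz_ι 1 1
  simpa using this

lemma prod_d_mem_forms (l : List A) :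
    (l.map fun b => Γ.d (Γ.ι b)).prod ∈ Γ.forms l.length :=
  Submodule.subset_span ⟨1, l, rfl, by simp⟩

lemma d_ι_mem_forms (a : A) : Γ.d (Γ.ι a) ∈ Γ.forms 1 := by
  simpa using Γ.prod_d_mem_forms [a]

lemma d_prod_d (l : List A) : Γ.d (l.map fun b => Γ.d (Γ.ι b)).prod = 0 := by
  induction l with
  | nil => simpa using Γ.d_ι_one
  | cons a l ih =>
    simp only [List.map_cons, List.prod_cons]
    rw [Γ.leibniz 1 l.length _ (Γ.d_ι_mem_forms a) _ (Γ.prod_d_mem_forms l), ih,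
      Γ.d_d 0 _ (Γ.ι_mem_forms a)]
    simp

lemma d_mem_forms {n : ℕ} {x : Γ.E} (hx : x ∈ Γ.forms n) : Γ.d x ∈ Γ.forms (n + 1) := by
  induction hx using Submodule.span_induction with
  | mem x hx =>
    obtain ⟨a, l, hl, rfl⟩ := hx
    rw [Γ.leibniz 0 l.length _ (Γ.ι_mem_forms a) _ (Γ.prod_d_mem_forms l), Γ.d_prod_d]
    exact Submodule.subset_span ⟨1, a :: l, by simp [hl], by simp⟩
  | zero => simp
  | add x y _ _ hx hy => rw [map_add]; exact add_mem hx hy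
  | smul c x _ hx => rw [map_smul]; exact Submodule.smul_mem _ _ hx

variable {Γ}

/-- The left action `a ω` of `A` on `Ωⁿ`. -/
def lsmul {n : ℕ} (a : A) (ω : Γ.forms n) : Γ.forms n :=
  ⟨Γ.ι a * ω, Γ.forms_ι_mul a ω.2⟩

/-- The right action `ω a` of `A` on `Ωⁿ`. -/
def rsmul {n : ℕ} (ω : Γ.forms n) (a : A) : Γ.forms n :=
  ⟨ω * Γ.ι a, Γ.forms_mul_ι a ω.2⟩

/-- The product `ω ∧ η` of forms. -/
def wedge {m n : ℕ} (ω : Γ.forms m) (η : Γ.forms n) : Γ.forms (m + n) :=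
  ⟨ω * η, Γ.mul_mem_forms ω.2 η.2⟩

/-- The differential `Ωⁿ → Ωⁿ⁺¹`. -/
def dForm {n : ℕ} (ω : Γ.forms n) : Γ.forms (n + 1) :=
  ⟨Γ.d ω, Γ.d_mem_forms ω.2⟩

variable (Γ)

/-- The differential `A → Ω¹`. -/
def dAlg (a : A) : Γ.forms 1 := ⟨Γ.d (Γ.ι a), Γ.d_ι_mem_forms a⟩

/-- A calculus has dimension `n` if `Ωⁿ ≠ 0` and `Ωᵐ = 0` for all `m > n`. -/
def HasDimension (n : ℕ) : Prop :=
  Γ.forms n ≠ ⊥ ∧ ∀ m : ℕ, n < m → Γ.forms m = ⊥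

/-- A calculus is connected if the kernel of `d` on `A` is `ℂ · 1`. -/
def IsConnected : Prop :=
  ∀ a : A, Γ.d (Γ.ι a) = 0 ↔ ∃ c : ℂ, a = c • (1 : A)

/-! ### Integral forms, divergences and integrability -/

/-- Integral `n`-forms `ℐₙ A`: the right `A`-linear maps `Ωⁿ A → A`. -/
def integralForms (n : ℕ) : Submodule ℂ (Γ.forms n →ₗ[ℂ] A) where
  carrier := {φ | ∀ (ω : Γ.forms n) (a : A), φ (rsmul ω a) = φ ω * a}
  add_mem' hφ hψ ω a := by
    simp only [Set.mem_ofPred_eq] at hφ hψ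
    simp [hφ, hψ, add_mul]
  zero_mem' ω a := by simp
  smul_mem' c φ hφ ω a := by
    simp only [Set.mem_ofPred_eq] at hφ
    simp [hφ]

variable {Γ}

/-- The bimodule structure `(a · φ · b)(ω) = a φ(b ω)` of the integral forms. -/
def integralBismul {n : ℕ} (a : A) (φ : Γ.integralForms n) (b : A) : Γ.integralForms n where
  val :=
    { toFun := fun ω => a * φ.1 (lsmul b ω)
      map_add' := fun ω η => by
        have : lsmul b (ω + η) = lsmul b ω + lsmul b η := Subtype.ext (mul_add _ _ _)
        rw [this, map_add, mul_add]
      map_smul' := fun c ω => by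
        have : lsmul b (c • ω) = c • lsmul b ω := Subtype.ext (mul_smul_comm _ _ _)
        rw [this, map_smul, mul_smul_comm]; rfl }
  property := fun ω c => by
    have : lsmul b (rsmul ω c) = rsmul (lsmul b ω) c := Subtype.ext (mul_assoc _ _ _).symm
    change a * φ.1 (lsmul b (rsmul ω c)) = a * φ.1 (lsmul b ω) * c
    rw [this, φ.2, mul_assoc]

/-- The right action of forms on integral forms, `(φ · ω)(ω') = φ(ω ∧ ω')`. -/
def integralAct {m n : ℕ} (φ : Γ.integralForms (m + n)) (ω : Γ.forms m) :
    Γ.integralForms n where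
  val :=
    { toFun := fun η => φ.1 (wedge ω η)
      map_add' := fun η ξ => by
        have : wedge ω (η + ξ) = wedge ω η + wedge ω ξ := Subtype.ext (mul_add _ _ _)
        rw [this, map_add]
      map_smul' := fun c η => by
        have : wedge ω (c • η) = c • wedge ω η := Subtype.ext (mul_smul_comm _ _ _)
        rw [this, map_smul]; rfl }
  property := fun η c => by
    have : wedge ω (rsmul η c) = rsmul (wedge ω η) c := Subtype.ext (mul_assoc _ _ _).symm
    change φ.1 (wedge ω (rsmul η c)) = φ.1 (wedge ω η) * c
    rw [this, φ.2]

variable (Γ)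

/-- A divergence: a linear map `∇ : ℐ₁ A → A` with `∇(φ · a) = ∇(φ) a + φ(da)`. -/
structure Divergence where
  toLinearMap : Γ.integralForms 1 →ₗ[ℂ] A
  leibniz : ∀ (φ : Γ.integralForms 1) (a : A),
    toLinearMap (integralBismul 1 φ a) = toLinearMap φ * a + φ.1 (Γ.dAlg a)

variable {Γ}

/-- The extension `∇ₙ : ℐₙ₊₁ A → ℐₙ A`, `∇ₙ(φ)(ω) = ∇(φ · ω) + (-1)ⁿ⁺¹ φ(dω)`. -/
def Divergence.extend (D : Γ.Divergence) (n : ℕ) (φ : Γ.integralForms (n + 1)) :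
    Γ.integralForms n where
  val :=
    { toFun := fun ω =>
        D.toLinearMap (integralAct φ ω) + (-1 : ℂ) ^ (n + 1) • φ.1 (dForm ω)
      map_add' := fun ω η => by
        have h1 : integralAct φ (ω + η) = integralAct φ ω + integralAct φ η := by
          refine Subtype.ext (LinearMap.ext fun ξ => ?_)
          have : wedge (ω + η) ξ = wedge ω ξ + wedge η ξ := Subtype.ext (add_mul _ _ _)
          change φ.1 (wedge (ω + η) ξ) = φ.1 (wedge ω ξ) + φ.1 (wedge η ξ)
          rw [this, map_add]
        have h2 : dForm (ω + η) = dForm ω + dForm η := Subtype.ext (map_add _ _ _)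
        rw [h1, h2, map_add, map_add, smul_add]
        abel
      map_smul' := fun c ω => by
        have h1 : integralAct φ (c • ω) = c • integralAct φ ω := by
          refine Subtype.ext (LinearMap.ext fun ξ => ?_)
          have : wedge (c • ω) ξ = c • wedge ω ξ := Subtype.ext (smul_mul_assoc _ _ _)
          change φ.1 (wedge (c • ω) ξ) = c • φ.1 (wedge ω ξ)
          rw [this, map_smul]
        have h2 : dForm (c • ω) = c • dForm ω := Subtype.ext (map_smul _ _ _)
        rw [h1, h2, map_smul, map_smul, smul_comm, ← smul_add]; rfl }
  property := fun ω a => by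
    have h1 : integralAct φ (rsmul ω a) = integralBismul 1 (integralAct φ ω) a := by
      refine Subtype.ext (LinearMap.ext fun ξ => ?_)
      have : wedge (rsmul ω a) ξ = wedge ω (lsmul a ξ) := Subtype.ext (mul_assoc _ _ _)
      change φ.1 (wedge (rsmul ω a) ξ) = 1 * φ.1 (wedge ω (lsmul a ξ))
      rw [this, one_mul]
    have h2 : dForm (rsmul ω a) =
        rsmul (dForm ω) a + (-1 : ℂ) ^ n • wedge ω (Γ.dAlg a) :=
      Subtype.ext (Γ.leibniz n 0 _ ω.2 _ (Γ.ι_mem_forms a))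
    have h3 : (integralAct φ ω).1 (Γ.dAlg a) = φ.1 (wedge ω (Γ.dAlg a)) := rfl
    have h4 : (-1 : ℂ) ^ (n + 1) * (-1 : ℂ) ^ n = -1 := by
      rw [← pow_add, Odd.neg_one_pow ⟨n, by ring⟩]
    change D.toLinearMap (integralAct φ (rsmul ω a)) +
        (-1 : ℂ) ^ (n + 1) • φ.1 (dForm (rsmul ω a)) =
      (D.toLinearMap (integralAct φ ω) + (-1 : ℂ) ^ (n + 1) • φ.1 (dForm ω)) * a
    rw [h1, h2, D.leibniz, h3, map_add, map_smul, φ.2, smul_add, smul_smul, h4, add_mul,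
      smul_mul_assoc, neg_one_smul]
    abel

/-- A divergence is flat if `∇ ∘ ∇₁ = 0`. -/
def Divergence.IsFlat (D : Γ.Divergence) : Prop :=
  ∀ φ : Γ.integralForms 2, D.toLinearMap (D.extend 1 φ) = 0

variable (Γ)

/-- Integrability of an `n`-dimensional calculus: there are a complex of integral forms, an
automorphism `ν` of `A` and bimodule isomorphisms `Θₖ : Ωᵏ → ^ν ℐₙ₋ₖ` (indexed here by the pairs
`(k, m)` with `k + m = n`) which intertwine `d` with the maps `∇ₘ`. The algebra `A` at the end of
the complex of integral forms is `ℐ₀`, via `φ ↦ φ(1)`, which turns `∇` into `∇₀`. -/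
def IsIntegrable (n : ℕ) : Prop :=
  Γ.HasDimension n ∧
  ∃ (D : Γ.Divergence) (ν : A ≃ₐ[ℂ] A)
    (Θ : ∀ k m : ℕ, k + m = n → (Γ.forms k ≃ₗ[ℂ] Γ.integralForms m)),
    D.IsFlat ∧
    (∀ (k m : ℕ) (h : k + m = n) (a b : A) (ω : Γ.forms k),
      Θ k m h (lsmul a (rsmul ω b)) = integralBismul (ν a) (Θ k m h ω) b) ∧
    (∀ (k m : ℕ) (h : k + 1 + m = n) (h' : k + (m + 1) = n) (ω : Γ.forms k),
      Θ (k + 1) m h (dForm ω) = D.extend m (Θ k (m + 1) h' ω))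

end DifferentialCalculus

/-! ### Gelfand-Kirillov dimension and differential smoothness -/

section Growth

variable {A : Type} [Ring A] [Algebra ℂ A]

/-- `𝒱(n)`: the span of all words of length at most `n` (including the empty word `1`) in `S`. -/
def wordSpan (S : Finset A) (n : ℕ) : Submodule ℂ A :=
  Submodule.span ℂ {x | ∃ l : List A, l.length ≤ n ∧ (∀ y ∈ l, y ∈ S) ∧ x = l.prod}

/-- `inf {ν | dim 𝒱(n) ≤ n ^ ν for n ≫ 0}`, equal to `∞` if there is no such `ν`. -/
def growthExponent (S : Finset A) : ℝ≥0∞ :=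
  sInf {r : ℝ≥0∞ | ∃ ν : ℝ≥0, r = ν ∧
    ∀ᶠ n : ℕ in Filter.atTop, (Module.finrank ℂ (wordSpan S n) : ℝ) ≤ (n : ℝ) ^ (ν : ℝ)}

variable (A)

/-- `A` is affine (finitely generated) of Gelfand-Kirillov dimension `r`, computed from any finite
generating set. -/
def IsAffineOfGKDim (r : ℝ≥0∞) : Prop :=
  Algebra.FiniteType ℂ A ∧
  ∀ S : Finset A, Algebra.adjoin ℂ (S : Set A) = ⊤ → growthExponent S = r

/-- An affine algebra of integer Gelfand-Kirillov dimension `n` is differentially smooth if it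
admits an `n`-dimensional connected integrable differential calculus. -/
def IsDifferentiallySmooth : Prop :=
  ∃ n : ℕ, IsAffineOfGKDim A n ∧
    ∃ Γ : DifferentialCalculus A, Γ.HasDimension n ∧ Γ.IsConnected ∧ Γ.IsIntegrable n

end Growth

/-! ### The quantum disc, its calculus, and the quantum cones -/

/-- The `q`-integer `[n]_q = (1 - qⁿ) / (1 - q)`, with its limit value `n` at `q = 1`. -/
def qInt (q : ℝ) (n : ℤ) : ℝ := if q = 1 then n else (1 - q ^ n) / (1 - q)

lemma qInt_zero (q : ℝ) : qInt q 0 = 0 := by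
  simp [qInt]

lemma qInt_add_one {q : ℝ} (hq : q ≠ 0) (n : ℤ) : qInt q (n + 1) = qInt q n + q ^ n := by
  unfold qInt
  split_ifs with h
  · subst h; push_cast; simp
  · have : 1 - q ≠ 0 := sub_ne_zero.mpr (Ne.symm h)
    rw [zpow_add_one₀ hq]
    field_simp
    ring

/-- Generators of the coordinate algebra of the quantum disc; `zs` stands for `z*`. -/
inductive DiscGen
  | z
  | zs

/-- The relation `z* z - q z z* = κ`. -/
inductive DiscRel (q κ : ℝ) : FreeAlgebra ℂ DiscGen → FreeAlgebra ℂ DiscGen → Prop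
  | zs_z : DiscRel q κ
      (FreeAlgebra.ι ℂ DiscGen.zs * FreeAlgebra.ι ℂ DiscGen.z)
      ((q : ℂ) • (FreeAlgebra.ι ℂ DiscGen.z * FreeAlgebra.ι ℂ DiscGen.zs) +
        algebraMap ℂ _ (κ : ℂ))

/-- The coordinate algebra `𝒪(D_{q,κ})` of the quantum disc. -/
def Disc (q κ : ℝ) : Type := RingQuot (DiscRel q κ)

instance (q κ : ℝ) : Ring (Disc q κ) := inferInstanceAs (Ring (RingQuot _))
instance (q κ : ℝ) : Algebra ℂ (Disc q κ) := inferInstanceAs (Algebra ℂ (RingQuot _))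

namespace Disc

variable (q κ : ℝ)

def z : Disc q κ := RingQuot.mkAlgHom ℂ (DiscRel q κ) (FreeAlgebra.ι ℂ DiscGen.z)
def zs : Disc q κ := RingQuot.mkAlgHom ℂ (DiscRel q κ) (FreeAlgebra.ι ℂ DiscGen.zs)

lemma zs_mul_z : zs q κ * z q κ = (q : ℂ) • (z q κ * zs q κ) + algebraMap ℂ _ (κ : ℂ) := by
  have := RingQuot.mkAlgHom_rel ℂ (DiscRel.zs_z (q := q) (κ := κ))
  rw [map_mul, map_add, map_smul, map_mul, AlgHom.commutes] at this
  exact this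

end Disc

/-- Generators of the algebra of forms on the quantum disc: `z`, `z*`, `dz`, `dz*`. -/
inductive FormGen
  | z
  | zs
  | dz
  | dzs

/-- Relations of the algebra of forms on the quantum disc: the relation of the disc and
`z dz = q⁻¹ dz z`, `z* dz = q dz z*`, `dz ∧ dz* = -q⁻¹ dz* ∧ dz`, `dz ∧ dz = 0`
together with the `*`-conjugates of these. -/
inductive FormRel (q κ : ℝ) : FreeAlgebra ℂ FormGen → FreeAlgebra ℂ FormGen → Prop
  | zs_z : FormRel q κ
      (FreeAlgebra.ι ℂ FormGen.zs * FreeAlgebra.ι ℂ FormGen.z)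
      ((q : ℂ) • (FreeAlgebra.ι ℂ FormGen.z * FreeAlgebra.ι ℂ FormGen.zs) +
        algebraMap ℂ _ (κ : ℂ))
  | z_dz : FormRel q κ
      (FreeAlgebra.ι ℂ FormGen.z * FreeAlgebra.ι ℂ FormGen.dz)
      ((q : ℂ)⁻¹ • (FreeAlgebra.ι ℂ FormGen.dz * FreeAlgebra.ι ℂ FormGen.z))
  | dzs_zs : FormRel q κ
      (FreeAlgebra.ι ℂ FormGen.dzs * FreeAlgebra.ι ℂ FormGen.zs)
      ((q : ℂ)⁻¹ • (FreeAlgebra.ι ℂ FormGen.zs * FreeAlgebra.ι ℂ FormGen.dzs))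
  | zs_dz : FormRel q κ
      (FreeAlgebra.ι ℂ FormGen.zs * FreeAlgebra.ι ℂ FormGen.dz)
      ((q : ℂ) • (FreeAlgebra.ι ℂ FormGen.dz * FreeAlgebra.ι ℂ FormGen.zs))
  | dzs_z : FormRel q κ
      (FreeAlgebra.ι ℂ FormGen.dzs * FreeAlgebra.ι ℂ FormGen.z)
      ((q : ℂ) • (FreeAlgebra.ι ℂ FormGen.z * FreeAlgebra.ι ℂ FormGen.dzs))
  | dz_dzs : FormRel q κ
      (FreeAlgebra.ι ℂ FormGen.dz * FreeAlgebra.ι ℂ FormGen.dzs)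
      (-(q : ℂ)⁻¹ • (FreeAlgebra.ι ℂ FormGen.dzs * FreeAlgebra.ι ℂ FormGen.dz))
  | dz_dz : FormRel q κ
      (FreeAlgebra.ι ℂ FormGen.dz * FreeAlgebra.ι ℂ FormGen.dz) 0
  | dzs_dzs : FormRel q κ
      (FreeAlgebra.ι ℂ FormGen.dzs * FreeAlgebra.ι ℂ FormGen.dzs) 0

/-- The algebra underlying the differential calculus `Ω(D_{q,κ})` on the quantum disc. -/
def DiscForms (q κ : ℝ) : Type := RingQuot (FormRel q κ)

instance (q κ : ℝ) : Ring (DiscForms q κ) := inferInstanceAs (Ring (RingQuot _))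
instance (q κ : ℝ) : Algebra ℂ (DiscForms q κ) := inferInstanceAs (Algebra ℂ (RingQuot _))

namespace DiscForms

variable (q κ : ℝ)

/-- The quotient map, sending each generator to its class. -/
def gen (x : FormGen) : DiscForms q κ :=
  RingQuot.mkAlgHom ℂ (FormRel q κ) (FreeAlgebra.ι ℂ x)

abbrev z : DiscForms q κ := gen q κ FormGen.z
abbrev zs : DiscForms q κ := gen q κ FormGen.zs
abbrev dz : DiscForms q κ := gen q κ FormGen.dz
abbrev dzs : DiscForms q κ := gen q κ FormGen.dzs

lemma zs_mul_z : zs q κ * z q κ = (q : ℂ) • (z q κ * zs q κ) + algebraMap ℂ _ (κ : ℂ) := by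
  have := RingQuot.mkAlgHom_rel ℂ (FormRel.zs_z (q := q) (κ := κ))
  rw [map_mul, map_add, map_smul, map_mul, AlgHom.commutes] at this
  exact this

lemma z_mul_dz : z q κ * dz q κ = (q : ℂ)⁻¹ • (dz q κ * z q κ) := by
  have := RingQuot.mkAlgHom_rel ℂ (FormRel.z_dz (q := q) (κ := κ))
  rw [map_mul, map_smul, map_mul] at this
  exact this

lemma dzs_mul_zs : dzs q κ * zs q κ = (q : ℂ)⁻¹ • (zs q κ * dzs q κ) := by
  have := RingQuot.mkAlgHom_rel ℂ (FormRel.dzs_zs (q := q) (κ := κ))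
  rw [map_mul, map_smul, map_mul] at this
  exact this

lemma zs_mul_dz : zs q κ * dz q κ = (q : ℂ) • (dz q κ * zs q κ) := by
  have := RingQuot.mkAlgHom_rel ℂ (FormRel.zs_dz (q := q) (κ := κ))
  rw [map_mul, map_smul, map_mul] at this
  exact this

lemma dzs_mul_z : dzs q κ * z q κ = (q : ℂ) • (z q κ * dzs q κ) := by
  have := RingQuot.mkAlgHom_rel ℂ (FormRel.dzs_z (q := q) (κ := κ))
  rw [map_mul, map_smul, map_mul] at this
  exact this

lemma dz_mul_dzs : dz q κ * dzs q κ = -(q : ℂ)⁻¹ • (dzs q κ * dz q κ) := by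
  have := RingQuot.mkAlgHom_rel ℂ (FormRel.dz_dzs (q := q) (κ := κ))
  rw [map_mul, map_smul, map_mul] at this
  exact this

lemma dz_mul_dz : dz q κ * dz q κ = 0 := by
  have := RingQuot.mkAlgHom_rel ℂ (FormRel.dz_dz (q := q) (κ := κ))
  rw [map_mul, map_zero] at this
  exact this

lemma dzs_mul_dzs : dzs q κ * dzs q κ = 0 := by
  have := RingQuot.mkAlgHom_rel ℂ (FormRel.dzs_dzs (q := q) (κ := κ))
  rw [map_mul, map_zero] at this
  exact this

/-- Values of `leibnizHom` on generators. -/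
def leibnizGen : FormGen → Matrix (Fin 2) (Fin 2) (DiscForms q κ)
  | FormGen.z => !![z q κ, dz q κ; 0, z q κ]
  | FormGen.zs => !![zs q κ, dzs q κ; 0, zs q κ]
  | FormGen.dz => !![-dz q κ, 0; 0, dz q κ]
  | FormGen.dzs => !![-dzs q κ, 0; 0, dzs q κ]

variable {q}

/-- The algebra map `x ↦ !![±x, dx; 0, x]` (with `±x = (-1)ⁿ x` for an `n`-form `x`). That it is
multiplicative is the graded Leibniz rule for its upper right entry. -/
def leibnizHom (hq : 0 < q) : DiscForms q κ →ₐ[ℂ] Matrix (Fin 2) (Fin 2) (DiscForms q κ) :=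
  RingQuot.liftAlgHom ℂ ⟨FreeAlgebra.lift ℂ (leibnizGen q κ), by
    have hq' : (q : ℂ) ≠ 0 := by exact_mod_cast hq.ne'
    intro x y h
    cases h <;>
    simp only [map_mul, map_add, map_smul, map_zero, FreeAlgebra.lift_ι_apply, leibnizGen,
      AlgHom.commutes] <;>
    ext i j <;> fin_cases i <;> fin_cases j <;>
    simp [Matrix.mul_apply, Fin.sum_univ_two, Matrix.algebraMap_matrix_apply, zs_mul_z, z_mul_dz,
      dzs_mul_zs, zs_mul_dz, dzs_mul_z, dz_mul_dzs, dz_mul_dz, dzs_mul_dzs, smul_smul, hq',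
      add_comm]⟩

/-- The differential on the forms of the quantum disc: `z ↦ dz`, `z* ↦ dz*`, `dz ↦ 0`, `dz* ↦ 0`,
extended by the graded Leibniz rule. -/
def d (hq : 0 < q) : DiscForms q κ →ₗ[ℂ] DiscForms q κ where
  toFun x := leibnizHom κ hq x 0 1
  map_add' x y := by simp
  map_smul' c x := by simp

lemma leibnizHom_gen (hq : 0 < q) (x : FormGen) :
    leibnizHom κ hq (gen q κ x) = leibnizGen q κ x := by
  unfold leibnizHom gen
  erw [RingQuot.liftAlgHom_mkAlgHom_apply]
  simp

lemma d_z (hq : 0 < q) : d κ hq (z q κ) = dz q κ := by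
  simp [d, leibnizHom_gen, leibnizGen]

lemma d_zs (hq : 0 < q) : d κ hq (zs q κ) = dzs q κ := by
  simp [d, leibnizHom_gen, leibnizGen]

variable (q)

/-- The map `𝒪(D_{q,κ}) → Ω(D_{q,κ})`. -/
def ofDisc : Disc q κ →ₐ[ℂ] DiscForms q κ :=
  RingQuot.liftAlgHom ℂ ⟨FreeAlgebra.lift ℂ (fun
    | DiscGen.z => z q κ
    | DiscGen.zs => zs q κ), by
    intro x y h
    cases h
    simp only [map_mul, map_add, map_smul, FreeAlgebra.lift_ι_apply, AlgHom.commutes]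
    exact zs_mul_z q κ⟩

end DiscForms

/-- The calculus `Ω(D_{q,κ})` on the quantum disc. -/
def discCalculus {q : ℝ} (κ : ℝ) (hq : 0 < q) : CalculusData (Disc q κ) where
  E := DiscForms q κ
  ι := DiscForms.ofDisc q κ
  d := DiscForms.d κ hq

/-- Generators of the coordinate algebra of the quantum cone; `bs` stands for `b*`. -/
inductive ConeGen
  | a
  | b
  | bs

/-- The relations of the quantum cone: `a b = q^N b a + κ [N]_q b` with its `*`-conjugate,
`b b* = ∏_{l=0}^{N-1} (q^{-l} a + κ [-l]_q)` and `b* b = ∏_{l=1}^{N} (q^l a + κ [l]_q)`. -/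
inductive ConeRel (N : ℕ) (q κ : ℝ) : FreeAlgebra ℂ ConeGen → FreeAlgebra ℂ ConeGen → Prop
  | a_b : ConeRel N q κ
      (FreeAlgebra.ι ℂ ConeGen.a * FreeAlgebra.ι ℂ ConeGen.b)
      ((q : ℂ) ^ N • (FreeAlgebra.ι ℂ ConeGen.b * FreeAlgebra.ι ℂ ConeGen.a) +
        ((κ * qInt q N : ℝ) : ℂ) • FreeAlgebra.ι ℂ ConeGen.b)
  | bs_a : ConeRel N q κ
      (FreeAlgebra.ι ℂ ConeGen.bs * FreeAlgebra.ι ℂ ConeGen.a)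
      ((q : ℂ) ^ N • (FreeAlgebra.ι ℂ ConeGen.a * FreeAlgebra.ι ℂ ConeGen.bs) +
        ((κ * qInt q N : ℝ) : ℂ) • FreeAlgebra.ι ℂ ConeGen.bs)
  | b_bs : ConeRel N q κ
      (FreeAlgebra.ι ℂ ConeGen.b * FreeAlgebra.ι ℂ ConeGen.bs)
      ((List.range N).map fun l : ℕ =>
        (q : ℂ) ^ (-(l : ℤ)) • FreeAlgebra.ι ℂ ConeGen.a +
          algebraMap ℂ (FreeAlgebra ℂ ConeGen) ((κ * qInt q (-(l : ℤ)) : ℝ) : ℂ)).prod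
  | bs_b : ConeRel N q κ
      (FreeAlgebra.ι ℂ ConeGen.bs * FreeAlgebra.ι ℂ ConeGen.b)
      ((List.range N).map fun l : ℕ =>
        (q : ℂ) ^ (l + 1) • FreeAlgebra.ι ℂ ConeGen.a +
          algebraMap ℂ (FreeAlgebra ℂ ConeGen) ((κ * qInt q ((l : ℤ) + 1) : ℝ) : ℂ)).prod

/-- The coordinate algebra `𝒪(C^N_{q,κ})` of the quantum cone. -/
def Cone (N : ℕ) (q κ : ℝ) : Type := RingQuot (ConeRel N q κ)

instance (N : ℕ) (q κ : ℝ) : Ring (Cone N q κ) := inferInstanceAs (Ring (RingQuot _))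
instance (N : ℕ) (q κ : ℝ) : Algebra ℂ (Cone N q κ) := inferInstanceAs (Algebra ℂ (RingQuot _))

namespace Disc

variable (q κ : ℝ)

/-- The element `q^n z z* + κ [n]_q` of the quantum disc. -/
def shift (n : ℤ) : Disc q κ :=
  (q : ℂ) ^ n • (z q κ * zs q κ) + algebraMap ℂ _ ((κ * qInt q n : ℝ) : ℂ)

variable {q}

lemma shift_zero : shift q κ 0 = z q κ * zs q κ := by
  simp [shift, qInt_zero]

lemma shift_one (hq : 0 < q) : shift q κ 1 = zs q κ * z q κ := by
  have h := qInt_add_one hq.ne' 0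
  rw [qInt_zero, zpow_zero, zero_add, zero_add] at h
  simp [shift, h, zs_mul_z]

lemma shift_mul_z (hq : 0 < q) (n : ℤ) :
    shift q κ n * z q κ = z q κ * shift q κ (n + 1) := by
  have hq' : (q : ℂ) ≠ 0 := by exact_mod_cast hq.ne'
  unfold shift
  rw [qInt_add_one hq.ne', zpow_add_one₀ hq', add_mul, mul_add, smul_mul_assoc, mul_assoc,
    zs_mul_z]
  simp only [Algebra.algebraMap_eq_smul_one, smul_mul_assoc, mul_smul_comm, one_mul, mul_one,
    mul_add]
  push_cast
  module

lemma zs_mul_shift (hq : 0 < q) (n : ℤ) :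
    zs q κ * shift q κ n = shift q κ (n + 1) * zs q κ := by
  have hq' : (q : ℂ) ≠ 0 := by exact_mod_cast hq.ne'
  unfold shift
  rw [qInt_add_one hq.ne', zpow_add_one₀ hq', add_mul, mul_add, mul_smul_comm, ← mul_assoc,
    zs_mul_z]
  simp only [Algebra.algebraMap_eq_smul_one, smul_mul_assoc, mul_smul_comm, one_mul, mul_one,
    add_mul]
  push_cast
  module

lemma shift_mul_z_pow (hq : 0 < q) (n : ℤ) (N : ℕ) :
    shift q κ n * z q κ ^ N = z q κ ^ N * shift q κ (n + N) := by
  induction N with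
  | zero => simp
  | succ N ih =>
    rw [pow_succ, ← mul_assoc, ih, mul_assoc, shift_mul_z κ hq, ← mul_assoc]
    push_cast
    rw [add_assoc]

lemma zs_pow_mul_shift (hq : 0 < q) (n : ℤ) (N : ℕ) :
    zs q κ ^ N * shift q κ n = shift q κ (n + N) * zs q κ ^ N := by
  induction N with
  | zero => simp
  | succ N ih =>
    rw [pow_succ', mul_assoc, ih, ← mul_assoc, zs_mul_shift κ hq, mul_assoc]
    push_cast
    rw [add_assoc]

lemma z_pow_mul_zs_pow (hq : 0 < q) (N : ℕ) :
    z q κ ^ N * zs q κ ^ N = ((List.range N).map fun l : ℕ => shift q κ (-(l : ℤ))).prod := by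
  induction N with
  | zero => simp
  | succ N ih =>
    have h := zs_pow_mul_shift κ hq (-(N : ℤ)) N
    rw [neg_add_cancel, shift_zero] at h
    rw [List.range_succ, List.map_append, List.prod_append, ← ih, pow_succ, pow_succ', mul_assoc,
      ← mul_assoc (z q κ), ← h]
    simp [mul_assoc]

lemma zs_pow_mul_z_pow (hq : 0 < q) (N : ℕ) :
    zs q κ ^ N * z q κ ^ N = ((List.range N).map fun l : ℕ => shift q κ ((l : ℤ) + 1)).prod := by
  induction N with
  | zero => simp
  | succ N ih =>
    have h := shift_mul_z_pow κ hq 1 N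
    rw [shift_one κ hq] at h
    rw [List.range_succ, List.map_append, List.prod_append, ← ih, pow_succ, pow_succ', mul_assoc,
      ← mul_assoc (zs q κ), h]
    simp [mul_assoc, add_comm]

end Disc

/-- The `*`-inclusion `𝒪(C^N_{q,κ}) → 𝒪(D_{q,κ})`, `a ↦ z z*`, `b ↦ z^N`, `b* ↦ z*^N`. -/
def coneToDisc (N : ℕ) {q : ℝ} (κ : ℝ) (hq : 0 < q) : Cone N q κ →ₐ[ℂ] Disc q κ :=
  RingQuot.liftAlgHom ℂ ⟨FreeAlgebra.lift ℂ (fun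
    | ConeGen.a => Disc.z q κ * Disc.zs q κ
    | ConeGen.b => Disc.z q κ ^ N
    | ConeGen.bs => Disc.zs q κ ^ N), by
    intro x y h
    cases h
    · have h := Disc.shift_mul_z_pow κ hq 0 N
      rw [Disc.shift_zero] at h
      simp only [map_mul, map_add, map_smul, FreeAlgebra.lift_ι_apply]
      rw [h]
      simp [Disc.shift, mul_add, Algebra.algebraMap_eq_smul_one]
    · have h := Disc.zs_pow_mul_shift κ hq 0 N
      rw [Disc.shift_zero] at h
      simp only [map_mul, map_add, map_smul, FreeAlgebra.lift_ι_apply]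
      rw [h]
      simp [Disc.shift, add_mul, Algebra.algebraMap_eq_smul_one, mul_assoc]
    · rw [map_mul, FreeAlgebra.lift_ι_apply, FreeAlgebra.lift_ι_apply,
        Disc.z_pow_mul_zs_pow κ hq, map_list_prod, List.map_map]
      congr 2
      funext l
      simp only [Function.comp_apply, map_add, map_smul, AlgHom.commutes,
        FreeAlgebra.lift_ι_apply, Disc.shift]
    · rw [map_mul, FreeAlgebra.lift_ι_apply, FreeAlgebra.lift_ι_apply,
        Disc.zs_pow_mul_z_pow κ hq, map_list_prod, List.map_map]
      congr 2
      funext l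
      simp only [Function.comp_apply, map_add, map_smul, AlgHom.commutes,
        FreeAlgebra.lift_ι_apply, Disc.shift]
      norm_cast⟩

/-- The calculus `Ω(C^N_{q,κ})`: the restriction of `Ω(D_{q,κ})` to the quantum cone algebra. -/
def coneCalculus (N : ℕ) {q : ℝ} (κ : ℝ) (hq : 0 < q) : CalculusData (Cone N q κ) :=
  (discCalculus κ hq).restrict (coneToDisc N κ hq)

end QuantumCone

end

noncomputable section

namespace QuantumCone

section

open Polynomial

/-! ### `q`-integers -/

/-! The cone is the invariant algebra of the cyclic group of order `N` acting on the quantum disc by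
`z ↦ u z`, `z* ↦ u⁻¹ z*`, where `u` is a primitive `N`-th root of unity
(`Cone.exists_coneToDisc_eq`). The forms on the disc are a free right module on `1`, `dz`, `dz*`,
`dz ∧ dz*`. The invariant one-forms are therefore the `dz f + dz* g` with `f` of weight `-1` and `g`
of weight `1`, and the invariant two-forms are the `dz ∧ dz* f` with `f` in the cone. The heart of
the proof is that the restricted calculus, built only from differentials of invariants, contains all
of these (`Cone.mem_forms_one_iff`, `Cone.mem_forms_two_iff`).

This is where `κ ≠ 0` is decisive. With `x = z z*`, the elements `z^i z*^i` and `z*^i z^i` are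
products of linear polynomials `q^n x + κ [n]_q`. These are pairwise coprime when `κ ≠ 0`, while at
`κ = 0` they are all multiples of `x`. Bézout identities give partitions of unity `1 ∈ D₁ D₋₁` and
`1 ∈ D₋₁ D₁` between weight spaces, which say that the action is algebraically free. Commuting `dx`
with `x` separates its `dz` part from its `dz*` part up to the normal element `(q - 1) x + κ`, and a
further Bézout identity with `db` and `db*` removes that factor. A combination of products of the
resulting one-forms is `q κ dz ∧ dz*`.

Two-forms are thus free of rank one over the cone. By the partitions of unity the wedge product of
one-forms is a perfect pairing into them, and any such calculus is integrable: the divergence is `d`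
transported along the pairing (`isIntegrable_two_of_perfect_pairing`).

For connectedness, the normal element times a partial derivative is a commutator with `z*` or `z`.
So `df = 0` makes `f` central in the disc, and a faithful weighted-shift representation shows that
the centre is `ℂ`. The same representation yields unique normal forms `∑ pₖ(x) zₖ`, hence the
injectivity of the embedding of the cone. Quadratic growth is bounded above by the monomials `z^i
z*^j` of the disc and below by the independent elements `a^i b^k`. -/

lemma qInt_add_one_left {q : ℝ} (hq : q ≠ 0) (n : ℤ) : qInt q (n + 1) = q * qInt q n + 1 := by
  unfold qInt
  split_ifs with h
  · subst h; push_cast; ring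
  · have : 1 - q ≠ 0 := sub_ne_zero.mpr (Ne.symm h)
    rw [zpow_add_one₀ hq]
    field_simp
    ring

lemma qInt_injective {q : ℝ} (hq : 0 < q) : Function.Injective (qInt q) := by
  intro m n h
  unfold qInt at h
  split_ifs at h with h1
  · exact_mod_cast h
  · have : 1 - q ≠ 0 := sub_ne_zero.mpr (Ne.symm h1)
    rw [div_left_inj' this] at h
    exact zpow_right_injective₀ hq h1 (by linarith)

/-- This is the determinant of the coefficients of two linear polynomials `q^n X + [n]_q`; it drives
their coprimality. -/
lemma mul_qInt_sub {q : ℝ} (m n : ℤ) :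
    q ^ n * qInt q m - q ^ m * qInt q n = qInt q m - qInt q n := by
  unfold qInt
  split_ifs with h
  · subst h; simp
  · have : 1 - q ≠ 0 := sub_ne_zero.mpr (Ne.symm h)
    field_simp
    ring

lemma zpow_sub_one_eq_mul_qInt {q : ℝ} (n : ℤ) : q ^ n - 1 = (q - 1) * qInt q n := by
  unfold qInt
  split_ifs with h
  · subst h; simp
  · have : 1 - q ≠ 0 := sub_ne_zero.mpr (Ne.symm h)
    field_simp
    ring

/-! ### Normal forms in algebras with a weight decomposition -/

section SignedPow

variable {A : Type} [Monoid A]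

/-- `b ^ k` for `k ≥ 0` and `b' ^ (-k)` for `k < 0`. -/
def signedPow (b b' : A) : ℤ → A
  | Int.ofNat n => b ^ n
  | Int.negSucc n => b' ^ (n + 1)

@[simp] lemma signedPow_natCast (b b' : A) (n : ℕ) : signedPow b b' (n : ℤ) = b ^ n := rfl

@[simp] lemma signedPow_zero (b b' : A) : signedPow b b' 0 = 1 := pow_zero b

@[simp] lemma signedPow_negSucc (b b' : A) (n : ℕ) :
    signedPow b b' (Int.negSucc n) = b' ^ (n + 1) := rfl

end SignedPow

section NormalForm

variable {A : Type} [Ring A] [Algebra ℂ A]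

/-- The linear map sending a family `(pₖ)` of polynomials to `∑ₖ pₖ(a) bₖ`, where `bₖ` is the
signed power. -/
def normalForm (a b b' : A) : (ℤ →₀ ℂ[X]) →ₗ[ℂ] A :=
  Finsupp.lsum ℂ fun k => (LinearMap.mulRight ℂ (signedPow b b' k)) ∘ₗ (aeval a).toLinearMap

@[simp] lemma normalForm_single (a b b' : A) (k : ℤ) (p : ℂ[X]) :
    normalForm a b b' (Finsupp.single k p) = aeval a p * signedPow b b' k := by
  simp [normalForm]

lemma mul_aeval_of_mul_eq {a b : A} {u : ℂ[X]} (h : b * a = aeval a u * b) (p : ℂ[X]) :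
    b * aeval a p = aeval a (p.comp u) * b := by
  induction p using Polynomial.induction_on' with
  | add p r hp hr => simp only [map_add, add_comp, mul_add, add_mul, hp, hr]
  | monomial n c =>
    have hn : b * a ^ n = aeval a u ^ n * b := by
      induction n with
      | zero => simp
      | succ n ih => rw [pow_succ, ← mul_assoc, ih, mul_assoc, h, ← mul_assoc, ← pow_succ]
    simp [aeval_monomial, monomial_comp, Algebra.algebraMap_eq_smul_one, hn]

/-- The range contains `1` and is stable under left multiplication by the generators: `b` and `b'`
move past polynomials in `a`, and `b b'`, `b' b` are again such polynomials. The abstract setting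
serves both the disc and the cone. -/
lemma normalForm_surjective {a b b' : A} {u v r s : ℂ[X]} (hu : b * a = aeval a u * b)
    (hv : b' * a = aeval a v * b') (hr : b * b' = aeval a r) (hs : b' * b = aeval a s)
    (hgen : Algebra.adjoin ℂ {a, b, b'} = ⊤) :
    Function.Surjective (normalForm a b b') := by
  set R := LinearMap.range (normalForm a b b') with hR
  have mem (k : ℤ) (p : ℂ[X]) : aeval a p * signedPow b b' k ∈ R :=
    ⟨Finsupp.single k p, by simp⟩
  have key (x : A) (hx : ∀ (k : ℤ) (p : ℂ[X]), x * (aeval a p * signedPow b b' k) ∈ R) :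
      ∀ y ∈ R, x * y ∈ R := by
    rintro _ ⟨t, rfl⟩
    induction t using Finsupp.induction_linear with
    | zero => simp
    | add f g hf hg => rw [map_add, mul_add]; exact add_mem hf hg
    | single k p => rw [normalForm_single]; exact hx k p
  have hall : ∀ x : A, ∀ y ∈ R, x * y ∈ R := by
    intro x
    have hx : x ∈ Algebra.adjoin ℂ {a, b, b'} := hgen ▸ Algebra.mem_top
    induction hx using Algebra.adjoin_induction with
    | mem x hx =>
      simp only [Set.mem_insert_iff, Set.mem_singleton_iff] at hx
      rcases hx with rfl | rfl | rfl
      · refine key _ fun k p => ?_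
        have := mem k (X * p)
        simpa [mul_assoc] using this
      · refine key _ fun k p => ?_
        rw [← mul_assoc, mul_aeval_of_mul_eq hu, mul_assoc]
        rcases k with n | n
        · have := mem ((n + 1 : ℕ) : ℤ) (p.comp u)
          rw [signedPow_natCast, pow_succ'] at this
          exact this
        · rw [signedPow_negSucc, pow_succ', ← mul_assoc x, hr, ← mul_assoc, ← map_mul]
          -- Cancelling one factor `b'` from exponent `-1` lands in exponent `0`, which belongs to
          -- the other constructor of `ℤ`.
          rcases n with - | n
          · simpa using mem 0 (p.comp u * r)
          · exact mem (Int.negSucc n) (p.comp u * r)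
      · refine key _ fun k p => ?_
        rw [← mul_assoc, mul_aeval_of_mul_eq hv, mul_assoc]
        rcases k with n | n
        · rcases n with - | n
          · have := mem (Int.negSucc 0) (p.comp v)
            rw [signedPow_negSucc] at this
            simpa using this
          · simp only [Int.ofNat_eq_natCast, signedPow_natCast]
            rw [pow_succ', ← mul_assoc x, hs, ← mul_assoc, ← map_mul]
            exact mem (n : ℤ) (p.comp v * s)
        · have := mem (Int.negSucc (n + 1)) (p.comp v)
          simpa [pow_succ'] using this
    | algebraMap c =>
      intro y hy
      rw [← Algebra.smul_def]
      exact R.smul_mem _ hy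
    | add x y _ _ hx hy => intro w hw; rw [add_mul]; exact add_mem (hx w hw) (hy w hw)
    | mul x y _ _ hx hy => intro w hw; rw [mul_assoc]; exact hx _ (hy w hw)
  intro x
  have h1 : (1 : A) ∈ R := by simpa using mem 0 1
  simpa [hR] using hall x 1 h1

end NormalForm

/-! ### The quantum disc algebra -/

namespace Disc

variable {q κ : ℝ}

section Lift

variable {C : Type} [Ring C] [Algebra ℂ C]

/-- The universal property of the quantum disc algebra. -/
def lift (u v : C) (h : v * u = (q : ℂ) • (u * v) + algebraMap ℂ C (κ : ℂ)) :
    Disc q κ →ₐ[ℂ] C :=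
  RingQuot.liftAlgHom ℂ ⟨FreeAlgebra.lift ℂ (fun
    | DiscGen.z => u
    | DiscGen.zs => v), by
    intro x y hxy
    cases hxy
    simp only [map_mul, map_add, map_smul, FreeAlgebra.lift_ι_apply, AlgHom.commutes]
    exact h⟩

@[simp] lemma lift_z (u v : C) (h : v * u = (q : ℂ) • (u * v) + algebraMap ℂ C (κ : ℂ)) :
    lift u v h (z q κ) = u := by
  unfold lift z
  erw [RingQuot.liftAlgHom_mkAlgHom_apply]
  simp

@[simp] lemma lift_zs (u v : C) (h : v * u = (q : ℂ) • (u * v) + algebraMap ℂ C (κ : ℂ)) :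
    lift u v h (zs q κ) = v := by
  unfold lift zs
  erw [RingQuot.liftAlgHom_mkAlgHom_apply]
  simp

end Lift

variable (q κ) in
lemma adjoin_eq_top : Algebra.adjoin ℂ {z q κ, zs q κ} = ⊤ := by
  have h := congrArg (Subalgebra.map (RingQuot.mkAlgHom ℂ (DiscRel q κ)))
    (FreeAlgebra.adjoin_range_ι ℂ DiscGen)
  rw [AlgHom.map_adjoin, Algebra.map_top,
    (AlgHom.range_eq_top _).2 (RingQuot.mkAlgHom_surjective ℂ _), ← Set.range_comp] at h
  refine top_le_iff.1 (le_of_eq_of_le h.symm (Algebra.adjoin_mono ?_))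
  rintro _ ⟨(_ | _), rfl⟩
  · exact Or.inl rfl
  · exact Or.inr rfl

lemma induction_on {motive : Disc q κ → Prop} (f : Disc q κ) (hz : motive (z q κ))
    (hzs : motive (zs q κ)) (hc : ∀ c : ℂ, motive (algebraMap ℂ _ c))
    (hadd : ∀ f g, motive f → motive g → motive (f + g))
    (hmul : ∀ f g, motive f → motive g → motive (f * g)) : motive f := by
  have hf : f ∈ Algebra.adjoin ℂ {z q κ, zs q κ} := adjoin_eq_top q κ ▸ Algebra.mem_top
  induction hf using Algebra.adjoin_induction with
  | mem x hx =>
    rcases hx with rfl | rfl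
    · exact hz
    · exact hzs
  | algebraMap c => exact hc c
  | add x y _ _ hx hy => exact hadd x y hx hy
  | mul x y _ _ hx hy => exact hmul x y hx hy

variable (q κ) in
/-- The element `x = z z*`. -/
def x : Disc q κ := z q κ * zs q κ

variable (q κ) in
/-- The polynomial `q^n X + κ [n]_q`. -/
def shiftPoly (n : ℤ) : ℂ[X] := C ((q : ℂ) ^ n) * X + C ((κ * qInt q n : ℝ) : ℂ)

lemma aeval_shiftPoly (n : ℤ) : aeval (x q κ) (shiftPoly q κ n) = shift q κ n := by
  simp [shiftPoly, shift, x, Algebra.smul_def]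

lemma z_mul_x (hq : 0 < q) : z q κ * x q κ = aeval (x q κ) (shiftPoly q κ (-1)) * z q κ := by
  rw [aeval_shiftPoly, shift_mul_z κ hq]
  simp [shift_zero, x]

lemma zs_mul_x (hq : 0 < q) : zs q κ * x q κ = aeval (x q κ) (shiftPoly q κ 1) * zs q κ := by
  have := zs_mul_shift κ hq 0
  rw [shift_zero] at this
  rw [aeval_shiftPoly]
  exact this

lemma zs_mul_z_eq (hq : 0 < q) : zs q κ * z q κ = aeval (x q κ) (shiftPoly q κ 1) := by
  rw [aeval_shiftPoly, shift_one κ hq]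

variable (q κ) in
/-- The normal form map `(pₖ) ↦ ∑ₖ pₖ(x) zₖ` of the quantum disc. -/
abbrev nf : (ℤ →₀ ℂ[X]) →ₗ[ℂ] Disc q κ := normalForm (x q κ) (z q κ) (zs q κ)

lemma nf_surjective (hq : 0 < q) : Function.Surjective (nf q κ) := by
  refine normalForm_surjective (z_mul_x hq) (zs_mul_x hq) (r := X) (by simp [x])
    (zs_mul_z_eq hq) (top_le_iff.1 ?_)
  rw [← adjoin_eq_top q κ]
  exact Algebra.adjoin_mono (Set.subset_insert _ _)

/-! #### A faithful representation -/

variable (q κ) in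
/-- The weights `κ [-n]_q` of the representation. -/
def wt (n : ℤ) : ℂ := ((κ * qInt q (-n) : ℝ) : ℂ)

lemma wt_eq (hq : 0 < q) (n : ℤ) : wt q κ n = q * wt q κ (n + 1) + κ := by
  have h := qInt_add_one_left hq.ne' (-(n + 1))
  rw [show -(n + 1) + 1 = -n by ring] at h
  simp only [wt, h]
  push_cast
  ring

lemma wt_injective (hq : 0 < q) (hκ : κ ≠ 0) : Function.Injective (wt q κ) := by
  intro m n h
  have h1 : κ * qInt q (-m) = κ * qInt q (-n) := by
    unfold wt at h
    exact_mod_cast h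
  exact neg_injective (qInt_injective hq (mul_left_cancel₀ hκ h1))

lemma wt_ne_zero (hq : 0 < q) (hκ : κ ≠ 0) {n : ℤ} (hn : n ≠ 0) : wt q κ n ≠ 0 := by
  have h0 : wt q κ 0 = 0 := by simp [wt, qInt_zero]
  exact fun h => hn (wt_injective hq hκ (h.trans h0.symm))

lemma eq_zero_of_eval_wt (hq : 0 < q) (hκ : κ ≠ 0) {p : ℂ[X]} {m : ℤ}
    (h : ∀ n < m, p.eval (wt q κ n) = 0) : p = 0 := by
  refine p.eq_zero_of_infinite_isRoot (Set.Infinite.mono ?_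
    ((Set.Iio_infinite m).image (wt_injective hq hκ).injOn))
  rintro _ ⟨n, hn, rfl⟩
  exact h n hn

variable (q κ) in
/-- The weighted shift `(f n) ↦ (κ [-n]_q f (n - 1))`. -/
def lowering : Module.End ℂ (ℤ → ℂ) where
  toFun f n := wt q κ n * f (n - 1)
  map_add' f g := by ext n; simp [mul_add]
  map_smul' c f := by ext n; simp [mul_left_comm]

/-- The shift `(f n) ↦ (f (n + 1))`. -/
def raising : Module.End ℂ (ℤ → ℂ) where
  toFun f n := f (n + 1)
  map_add' _ _ := rfl
  map_smul' _ _ := rfl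

/-- The representation of the quantum disc by weighted shifts. -/
def rep (κ : ℝ) (hq : 0 < q) : Disc q κ →ₐ[ℂ] Module.End ℂ (ℤ → ℂ) :=
  lift raising (lowering q κ) (by
    refine LinearMap.ext fun f => funext fun n => ?_
    have h := wt_eq (κ := κ) hq n
    simp [lowering, raising, Module.algebraMap_end_apply]
    rw [h]
    ring)

lemma rep_z_apply (hq : 0 < q) (f : ℤ → ℂ) (n : ℤ) : rep κ hq (z q κ) f n = f (n + 1) := by
  rw [rep, lift_z]; rfl

lemma rep_zs_apply (hq : 0 < q) (f : ℤ → ℂ) (n : ℤ) :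
    rep κ hq (zs q κ) f n = wt q κ n * f (n - 1) := by
  rw [rep, lift_zs]; rfl

lemma rep_x_apply (hq : 0 < q) (f : ℤ → ℂ) (n : ℤ) :
    rep κ hq (x q κ) f n = wt q κ (n + 1) * f n := by
  rw [x, map_mul, Module.End.mul_apply, rep_z_apply, rep_zs_apply]
  simp

lemma rep_aeval_apply (hq : 0 < q) (p : ℂ[X]) (f : ℤ → ℂ) (n : ℤ) :
    rep κ hq (aeval (x q κ) p) f n = p.eval (wt q κ (n + 1)) * f n := by
  induction p using Polynomial.induction_on' with
  | add p r hp hr => simp [hp, hr, add_mul]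
  | monomial m c =>
    have hm : ∀ f : ℤ → ℂ, rep κ hq (x q κ ^ m) f n = wt q κ (n + 1) ^ m * f n := by
      induction m with
      | zero => simp
      | succ m ih =>
        intro f
        rw [pow_succ, map_mul, Module.End.mul_apply, ih, rep_x_apply]
        ring
    rw [aeval_monomial, ← Algebra.smul_def, map_smul, LinearMap.smul_apply, Pi.smul_apply, hm]
    simp [mul_assoc]

/-- Powers of `z*` contribute products of weights at sites `≤ n`. The only vanishing weight is at
`0`, so these products are nonzero on the negative half-line. -/
lemma exists_rep_signedPow_apply (hq : 0 < q) (hκ : κ ≠ 0) (k n : ℤ) (hn : n < 0) :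
    ∃ w : ℂ, w ≠ 0 ∧
      ∀ f : ℤ → ℂ, rep κ hq (signedPow (z q κ) (zs q κ) k) f n = w * f (n + k) := by
  have hz : ∀ (m : ℕ) (f : ℤ → ℂ) (n : ℤ), rep κ hq (z q κ ^ m) f n = f (n + m) := by
    intro m
    induction m with
    | zero => simp
    | succ m ih =>
      intro f n
      rw [pow_succ, map_mul, Module.End.mul_apply, ih, rep_z_apply]
      congr 1
      push_cast
      ring
  have hzs : ∀ (m : ℕ), ∃ w : ℂ, w ≠ 0 ∧
      ∀ f : ℤ → ℂ, rep κ hq (zs q κ ^ m) f n = w * f (n - m) := by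
    intro m
    induction m with
    | zero => exact ⟨1, one_ne_zero, by simp⟩
    | succ m ih =>
      obtain ⟨w, hw, h⟩ := ih
      refine ⟨w * wt q κ (n - m), mul_ne_zero hw (wt_ne_zero hq hκ (by omega)), fun f => ?_⟩
      rw [pow_succ, map_mul, Module.End.mul_apply, h, rep_zs_apply, mul_assoc]
      congr 3
      push_cast
      ring
  rcases k with m | m
  · exact ⟨1, one_ne_zero, fun f => by rw [one_mul]; exact hz m f n⟩
  · obtain ⟨w, hw, h⟩ := hzs (m + 1)
    refine ⟨w, hw, fun f => ?_⟩
    rw [signedPow_negSucc, h, Int.negSucc_eq]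
    congr 2

/-- The `l`-th term of a normal form shifts by `l`, so the matrix entry between sites `n` and `n +
k` sees only the `k`-th coefficient. -/
lemma exists_rep_nf_single (hq : 0 < q) (hκ : κ ≠ 0) (k n : ℤ) (hn : n < 0) :
    ∃ w : ℂ, w ≠ 0 ∧ ∀ t : ℤ →₀ ℂ[X],
      rep κ hq (nf q κ t) (Pi.single (n + k) 1) n = w * (t k).eval (wt q κ (n + 1)) := by
  obtain ⟨w, hw, h⟩ := exists_rep_signedPow_apply (κ := κ) hq hκ k n hn
  refine ⟨w, hw, fun t => ?_⟩
  induction t using Finsupp.induction_linear with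
  | zero => simp
  | add f g hf hg => simp [hf, hg, mul_add]
  | single l p =>
    obtain ⟨w', -, h'⟩ := exists_rep_signedPow_apply (κ := κ) hq hκ l n hn
    rw [normalForm_single, map_mul, Module.End.mul_apply, rep_aeval_apply]
    by_cases hl : l = k
    · subst hl
      rw [h]
      simp [mul_comm]
    · rw [h', Finsupp.single_eq_of_ne (Ne.symm hl),
        Pi.single_eq_of_ne (by simpa using hl)]
      simp

lemma eq_zero_of_rep_single (hq : 0 < q) (hκ : κ ≠ 0) (t : ℤ →₀ ℂ[X]) (k : ℤ)
    (h : ∀ n < 0, rep κ hq (nf q κ t) (Pi.single (n + k) 1) n = 0) : t k = 0 := by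
  -- At site `n` the element `x` acts by the weight of `n + 1`, so the sites `n < 0` give the
  -- weights with index below `1`.
  refine eq_zero_of_eval_wt hq hκ (m := 1) fun n hn => ?_
  obtain ⟨w, hw, h'⟩ := exists_rep_nf_single (κ := κ) hq hκ k (n - 1) (by omega)
  have := h (n - 1) (by omega)
  rw [h'] at this
  simpa [hw] using this

lemma nf_injective (hq : 0 < q) (hκ : κ ≠ 0) : Function.Injective (nf q κ) := by
  rw [← LinearMap.ker_eq_bot, LinearMap.ker_eq_bot']
  intro t ht
  ext1 k
  exact eq_zero_of_rep_single hq hκ t k fun n _ => by simp [ht]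

/-- The centre of the quantum disc is trivial. -/
lemma exists_eq_algebraMap_of_commute (hq : 0 < q) (hκ : κ ≠ 0) {f : Disc q κ}
    (hz : Commute (z q κ) f) (hzs : Commute (zs q κ) f) : ∃ c : ℂ, f = algebraMap ℂ _ c := by
  obtain ⟨t, rfl⟩ := nf_surjective hq f
  have hx : Commute (x q κ) (nf q κ t) := hz.mul_left hzs
  -- `x` is diagonal with distinct eigenvalues, so whatever commutes with it has no off-diagonal
  -- entries.
  have ht (k : ℤ) (hk : k ≠ 0) : t k = 0 := by
    refine eq_zero_of_rep_single hq hκ t k fun n hn => ?_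
    have h1 := congrArg (fun g => rep κ hq g (Pi.single (n + k) 1) n) hx.eq
    have h2 : rep κ hq (x q κ) (Pi.single (n + k) 1) =
        wt q κ (n + k + 1) • (Pi.single (n + k) 1 : ℤ → ℂ) := by
      ext m
      rw [rep_x_apply]
      by_cases hm : m = n + k
      · subst hm; simp
      · simp [Pi.single_eq_of_ne hm]
    simp only [map_mul, Module.End.mul_apply, rep_x_apply, h2, map_smul, Pi.smul_apply,
      smul_eq_mul] at h1
    have h3 : wt q κ (n + 1) - wt q κ (n + k + 1) ≠ 0 := by
      refine sub_ne_zero.2 fun h => hk ?_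
      have := wt_injective hq hκ h
      omega
    refine (mul_eq_zero.1 ?_).resolve_left h3
    rw [sub_mul, h1, sub_self]
  have hf : nf q κ t = aeval (x q κ) (t 0) := by
    have : t = Finsupp.single 0 (t 0) := by
      ext1 k
      by_cases hk : k = 0
      · subst hk; simp
      · rw [ht k hk, Finsupp.single_eq_of_ne hk]
    rw [this, normalForm_single]
    simp [signedPow]
  rw [hf] at hz ⊢
  -- Commuting with `z` makes the remaining polynomial take equal values at consecutive weights. It
  -- is then constant on an infinite set, hence constant.
  have hp (n : ℤ) : (t 0).eval (wt q κ (n + 1)) = (t 0).eval (wt q κ n) := by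
    have h1 := congrArg (fun g => rep κ hq g (fun _ => 1) (n - 1)) hz.eq
    simp only [map_mul, Module.End.mul_apply, rep_aeval_apply, rep_z_apply] at h1
    simpa using h1
  have hc : t 0 = C ((t 0).eval (wt q κ 0)) := by
    rw [← sub_eq_zero]
    refine eq_zero_of_eval_wt hq hκ (m := 0) fun n _ => ?_
    have : (t 0).eval (wt q κ n) = (t 0).eval (wt q κ 0) := by
      induction n using Int.induction_on with
      | zero => rfl
      | succ n ih => rw [hp, ih (by omega)]
      | pred n ih =>
        rw [← hp, sub_add_cancel]
        -- For `n = 0` the induction hypothesis requires a negative index and says nothing; the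
        -- value there is the base point itself.
        by_cases hn : n = 0
        · simp [hn]
        · exact ih (by omega)
    simp [this]
  exact ⟨_, by rw [hc, aeval_C]⟩

end Disc

end

section

open Polynomial

/-! ### Compatibility of signed powers with `N`-th powers and algebra maps -/

section SignedPow

variable {A : Type} [Monoid A]

lemma signedPow_neg_natCast (b b' : A) (n : ℕ) : signedPow b b' (-(n : ℤ)) = b' ^ n := by
  cases n with
  | zero => simp
  | succ n => exact signedPow_negSucc b b' n

lemma signedPow_pow (b b' : A) (N : ℕ) (k : ℤ) :
    signedPow (b ^ N) (b' ^ N) k = signedPow b b' (N * k) := by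
  obtain ⟨n, rfl | rfl⟩ := k.eq_nat_or_neg
  · rw [signedPow_natCast, ← pow_mul]
    exact_mod_cast (signedPow_natCast b b' (N * n)).symm
  · rw [signedPow_neg_natCast, ← pow_mul, mul_neg]
    exact_mod_cast (signedPow_neg_natCast b b' (N * n)).symm

end SignedPow

lemma map_signedPow {A C : Type} [Ring A] [Algebra ℂ A] [Ring C] [Algebra ℂ C] (F : A →ₐ[ℂ] C)
    (b b' : A) (k : ℤ) : F (signedPow b b' k) = signedPow (F b) (F b') k := by
  cases k <;> simp [signedPow]

lemma isCoprime_list_prod_map {R ι : Type} [CommSemiring R] {p : R} {f : ι → R} {L : List ι}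
    (h : ∀ i ∈ L, IsCoprime p (f i)) : IsCoprime p (L.map f).prod := by
  induction L with
  | nil => simpa using isCoprime_one_right
  | cons i L ih =>
    rw [List.map_cons, List.prod_cons]
    exact (h i (by simp)).mul_right (ih fun j hj => h j (by simp [hj]))

namespace Disc

variable {q κ : ℝ}

/-! #### Coprimality of the shift polynomials -/

/-- Eliminating `X` between the two linear polynomials leaves the constant `κ ([m]_q - [n]_q)`,
which is nonzero because `q`-integers are distinct for `q > 0`. -/
lemma isCoprime_shiftPoly (hq : 0 < q) (hκ : κ ≠ 0) {m n : ℤ} (h : m ≠ n) :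
    IsCoprime (shiftPoly q κ m) (shiftPoly q κ n) := by
  have h1 : ((κ * (qInt q m - qInt q n) : ℝ) : ℂ) ≠ 0 := by
    exact_mod_cast mul_ne_zero hκ (sub_ne_zero.2 fun h' => h (qInt_injective hq h'))
  set c := ((κ * (qInt q m - qInt q n) : ℝ) : ℂ) with hc
  refine ⟨C (c⁻¹ * (q : ℂ) ^ n), C (-(c⁻¹ * (q : ℂ) ^ m)), ?_⟩
  have h2 : C (c⁻¹ * (q : ℂ) ^ n) * shiftPoly q κ m + C (-(c⁻¹ * (q : ℂ) ^ m)) * shiftPoly q κ n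
      = C (c⁻¹ * ((κ * (q ^ n * qInt q m - q ^ m * qInt q n) : ℝ) : ℂ)) := by
    simp only [shiftPoly]
    push_cast
    simp only [C_mul, C_neg, C_sub]
    ring
  rw [h2, mul_qInt_sub, ← hc, inv_mul_cancel₀ h1, C_1]

variable (q κ) in
/-- The polynomial `(q - 1) X + κ`. -/
def normalPoly : ℂ[X] := C ((q : ℂ) - 1) * X + C (κ : ℂ)

/-- The shift polynomial equals `X + [n]_q ((q - 1) X + κ)`, so the claim reduces to coprimality
with `X`, where the constant term `κ` is invertible. -/
lemma isCoprime_normalPoly (hκ : κ ≠ 0) (n : ℤ) :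
    IsCoprime (normalPoly q κ) (shiftPoly q κ n) := by
  have hκ' : (κ : ℂ) ≠ 0 := by exact_mod_cast hκ
  have h1 : shiftPoly q κ n = X + C ((qInt q n : ℝ) : ℂ) * normalPoly q κ := by
    have h2 : (q : ℂ) ^ n = 1 + ((q : ℂ) - 1) * ((qInt q n : ℝ) : ℂ) := by
      have := zpow_sub_one_eq_mul_qInt (q := q) n
      rw [sub_eq_iff_eq_add'] at this
      exact_mod_cast this
    simp only [shiftPoly, normalPoly, h2]
    push_cast
    simp only [C_mul, C_add, C_sub, C_1]
    ring
  have h3 : IsCoprime (normalPoly q κ) (X : ℂ[X]) := by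
    refine ⟨C (κ : ℂ)⁻¹, -C ((κ : ℂ)⁻¹ * ((q : ℂ) - 1)), ?_⟩
    have h4 : C (κ : ℂ)⁻¹ * C (κ : ℂ) = 1 := by rw [← C_mul, inv_mul_cancel₀ hκ', C_1]
    rw [normalPoly, C_mul, mul_add, h4]
    ring
  rw [h1]
  exact h3.add_mul_right_right _

lemma z_pow_mul_zs_pow_eq (hq : 0 < q) (n : ℕ) : z q κ ^ n * zs q κ ^ n =
    aeval (x q κ) ((List.range n).map fun l : ℕ => shiftPoly q κ (-(l : ℤ))).prod := by
  rw [z_pow_mul_zs_pow κ hq, map_list_prod, List.map_map]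
  congr 2
  funext l
  exact (aeval_shiftPoly _).symm

lemma zs_pow_mul_z_pow_eq (hq : 0 < q) (n : ℕ) : zs q κ ^ n * z q κ ^ n =
    aeval (x q κ) ((List.range n).map fun l : ℕ => shiftPoly q κ ((l : ℤ) + 1)).prod := by
  rw [zs_pow_mul_z_pow κ hq, map_list_prod, List.map_map]
  congr 2
  funext l
  exact (aeval_shiftPoly _).symm

/-- `z z*` is the shift polynomial of index `0` at `x`, while `z*^n z^n` is the product of those of
indices `1, …, n`. The index sets are disjoint, so Bézout applies. -/
lemma exists_z_zs_partition (hq : 0 < q) (hκ : κ ≠ 0) (n : ℕ) : ∃ p r : ℂ[X],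
    aeval (x q κ) p * (z q κ * zs q κ) + aeval (x q κ) r * (zs q κ ^ n * z q κ ^ n) = 1 := by
  have h : IsCoprime (shiftPoly q κ 0)
      ((List.range n).map fun l : ℕ => shiftPoly q κ ((l : ℤ) + 1)).prod :=
    isCoprime_list_prod_map fun l _ => isCoprime_shiftPoly hq hκ (by omega)
  obtain ⟨p, r, h⟩ := h
  refine ⟨p, r, ?_⟩
  rw [zs_pow_mul_z_pow_eq hq, ← shift_zero, ← aeval_shiftPoly, ← map_mul, ← map_mul, ← map_add,
    h, map_one]

/-- Here the indices are `1` for `z* z` and `0, -1, …, -(n - 1)` for `z^n z*^n`. -/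
lemma exists_zs_z_partition (hq : 0 < q) (hκ : κ ≠ 0) (n : ℕ) : ∃ p r : ℂ[X],
    aeval (x q κ) p * (zs q κ * z q κ) + aeval (x q κ) r * (z q κ ^ n * zs q κ ^ n) = 1 := by
  have h : IsCoprime (shiftPoly q κ 1)
      ((List.range n).map fun l : ℕ => shiftPoly q κ (-(l : ℤ))).prod :=
    isCoprime_list_prod_map fun l _ => isCoprime_shiftPoly hq hκ (by omega)
  obtain ⟨p, r, h⟩ := h
  refine ⟨p, r, ?_⟩
  rw [z_pow_mul_zs_pow_eq hq, zs_mul_z_eq hq, ← map_mul, ← map_mul, ← map_add, h, map_one]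

/-! #### Scaling automorphisms and weights -/

variable (q κ) in
/-- The endomorphism `z ↦ u z`, `z* ↦ u⁻¹ z*`. -/
def scaleHom (u : ℂˣ) : Disc q κ →ₐ[ℂ] Disc q κ :=
  lift ((u : ℂ) • z q κ) ((u⁻¹ : ℂˣ) • zs q κ) (by
    simp only [Units.smul_def, smul_mul_smul_comm, Units.inv_mul, Units.mul_inv, one_smul,
      zs_mul_z])

@[simp] lemma scaleHom_z (u : ℂˣ) : scaleHom q κ u (z q κ) = (u : ℂ) • z q κ := lift_z ..

@[simp] lemma scaleHom_zs (u : ℂˣ) :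
    scaleHom q κ u (zs q κ) = ((u⁻¹ : ℂˣ) : ℂ) • zs q κ := lift_zs ..

lemma scaleHom_comp_apply (u v : ℂˣ) (f : Disc q κ) :
    scaleHom q κ u (scaleHom q κ v f) = scaleHom q κ (u * v) f := by
  induction f using Disc.induction_on with
  | hz => simp [smul_smul, mul_comm]
  | hzs => simp [smul_smul]
  | hc c => simp
  | hadd f g hf hg => simp [hf, hg]
  | hmul f g hf hg => simp [hf, hg]

lemma scaleHom_one_apply (f : Disc q κ) : scaleHom q κ 1 f = f := by
  induction f using Disc.induction_on with
  | hz => simp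
  | hzs => simp
  | hc c => simp
  | hadd f g hf hg => simp [hf, hg]
  | hmul f g hf hg => simp [hf, hg]

variable (q κ) in
/-- The automorphism `z ↦ u z`, `z* ↦ u⁻¹ z*`. -/
def scale (u : ℂˣ) : Disc q κ ≃ₐ[ℂ] Disc q κ :=
  AlgEquiv.ofAlgHom (scaleHom q κ u) (scaleHom q κ u⁻¹)
    (AlgHom.ext fun f => by simp [scaleHom_comp_apply, scaleHom_one_apply])
    (AlgHom.ext fun f => by simp [scaleHom_comp_apply, scaleHom_one_apply])

@[simp] lemma scale_z (u : ℂˣ) : scale q κ u (z q κ) = (u : ℂ) • z q κ := scaleHom_z u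

@[simp] lemma scale_zs (u : ℂˣ) : scale q κ u (zs q κ) = (u : ℂ)⁻¹ • zs q κ := by
  rw [← Units.val_inv_eq_inv_val]
  exact scaleHom_zs u

lemma scale_mul_apply (u v : ℂˣ) (f : Disc q κ) :
    scale q κ u (scale q κ v f) = scale q κ (u * v) f := scaleHom_comp_apply u v f

lemma scale_comm (u v : ℂˣ) (f : Disc q κ) :
    scale q κ u (scale q κ v f) = scale q κ v (scale q κ u f) := by
  rw [scale_mul_apply, scale_mul_apply, mul_comm]

@[simp] lemma scale_one (f : Disc q κ) : scale q κ 1 f = f := scaleHom_one_apply f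

@[simp] lemma scale_x (u : ℂˣ) : scale q κ u (x q κ) = x q κ := by
  simp [x, smul_smul]

lemma scale_aeval (u : ℂˣ) (p : ℂ[X]) :
    scale q κ u (aeval (x q κ) p) = aeval (x q κ) p := by
  have := aeval_algHom_apply (scale q κ u).toAlgHom (x q κ) p
  simpa using this.symm

lemma scale_signedPow (u : ℂˣ) (k : ℤ) :
    scale q κ u (signedPow (z q κ) (zs q κ) k) =
      ((u ^ k : ℂˣ) : ℂ) • signedPow (z q κ) (zs q κ) k := by
  obtain ⟨n, rfl | rfl⟩ := k.eq_nat_or_neg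
  · simp [_root_.smul_pow]
  · simp [signedPow_neg_natCast, _root_.smul_pow]

variable (q κ) in
/-- The elements of weight `k`: the eigenspace of the automorphism `scale u` for `u ^ k`. -/
def weight (u : ℂˣ) (k : ℤ) : Submodule ℂ (Disc q κ) where
  carrier := {f | scale q κ u f = ((u ^ k : ℂˣ) : ℂ) • f}
  add_mem' hf hg := by
    simp only [Set.mem_ofPred_eq] at *
    rw [map_add, hf, hg, smul_add]
  zero_mem' := by simp
  smul_mem' c f hf := by
    simp only [Set.mem_ofPred_eq] at *
    rw [map_smul, hf, smul_comm]

variable {u : ℂˣ}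

lemma mem_weight {k : ℤ} {f : Disc q κ} :
    f ∈ weight q κ u k ↔ scale q κ u f = ((u ^ k : ℂˣ) : ℂ) • f := Iff.rfl

lemma mul_mem_weight {k l m : ℤ} {f g : Disc q κ} (hf : f ∈ weight q κ u k)
    (hg : g ∈ weight q κ u l) (h : k + l = m) : f * g ∈ weight q κ u m := by
  rw [mem_weight] at *
  rw [map_mul, hf, hg, smul_mul_smul_comm, ← h, zpow_add, Units.val_mul]

lemma scale_mem_weight {k : ℤ} {f : Disc q κ} (hf : f ∈ weight q κ u k) (v : ℂˣ) :
    scale q κ v f ∈ weight q κ u k := by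
  rw [mem_weight] at *
  rw [scale_comm, hf, map_smul]

lemma aeval_mem_weight (p : ℂ[X]) : aeval (x q κ) p ∈ weight q κ u 0 := by
  simp [mem_weight, scale_aeval]

lemma z_mem_weight : z q κ ∈ weight q κ u 1 := by simp [mem_weight]

lemma zs_mem_weight : zs q κ ∈ weight q κ u (-1) := by simp [mem_weight]

/-- Weights are indexed by `ℤ` but matter only modulo `N`. Thus `z^(N-1)` shares the weight of `z*`,
which makes it available as a second generator there. -/
lemma z_pow_mem_weight {N : ℕ} (hu : u ^ N = 1) (hN : 0 < N) :
    z q κ ^ (N - 1) ∈ weight q κ u (-1) := by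
  have h1 : u ^ (N - 1) = u⁻¹ := by
    rw [eq_inv_iff_mul_eq_one, ← pow_succ, Nat.sub_add_cancel hN, hu]
  have h2 : (u : ℂ) ^ (N - 1) = (u : ℂ)⁻¹ := by
    rw [← Units.val_pow_eq_pow_val, h1, Units.val_inv_eq_inv_val]
  simp [mem_weight, _root_.smul_pow, h2]

lemma zs_pow_mem_weight {N : ℕ} (hu : u ^ N = 1) (hN : 0 < N) :
    zs q κ ^ (N - 1) ∈ weight q κ u 1 := by
  have h1 : u ^ (N - 1) = u⁻¹ := by
    rw [eq_inv_iff_mul_eq_one, ← pow_succ, Nat.sub_add_cancel hN, hu]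
  have h2 : (u : ℂ) ^ (N - 1) = (u : ℂ)⁻¹ := by
    rw [← Units.val_pow_eq_pow_val, h1, Units.val_inv_eq_inv_val]
  simp [mem_weight, _root_.smul_pow, h2]

/-- Partitions of unity in `D₁ D₋₁`, with the right factors fixed. -/
lemma exists_right_partition_neg (hq : 0 < q) (hκ : κ ≠ 0) {N : ℕ} (hN : 0 < N) (hu : u ^ N = 1) :
    ∃ s ∈ weight q κ u 1, ∃ s' ∈ weight q κ u 1,
      s * zs q κ + s' * z q κ ^ (N - 1) = 1 := by
  obtain ⟨p, r, h⟩ := exists_z_zs_partition hq hκ (N - 1)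
  refine ⟨_, mul_mem_weight (aeval_mem_weight p) z_mem_weight (by norm_num), _,
    mul_mem_weight (aeval_mem_weight r) (zs_pow_mem_weight hu hN) (by norm_num), ?_⟩
  rw [← h]
  simp only [mul_assoc]

/-- Partitions of unity in `D₋₁ D₁`, with the right factors fixed. -/
lemma exists_right_partition_pos (hq : 0 < q) (hκ : κ ≠ 0) {N : ℕ} (hN : 0 < N) (hu : u ^ N = 1) :
    ∃ s ∈ weight q κ u (-1), ∃ s' ∈ weight q κ u (-1),
      s * z q κ + s' * zs q κ ^ (N - 1) = 1 := by
  obtain ⟨p, r, h⟩ := exists_zs_z_partition hq hκ (N - 1)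
  refine ⟨_, mul_mem_weight (aeval_mem_weight p) zs_mem_weight (by norm_num), _,
    mul_mem_weight (aeval_mem_weight r) (z_pow_mem_weight hu hN) (by norm_num), ?_⟩
  rw [← h]
  simp only [mul_assoc]

lemma commute_aeval_z_pow_mul_zs_pow (hq : 0 < q) (p : ℂ[X]) (n : ℕ) :
    Commute (aeval (x q κ) p) (z q κ ^ n * zs q κ ^ n) := by
  rw [z_pow_mul_zs_pow_eq hq, commute_iff_eq, ← map_mul, mul_comm, map_mul]

lemma commute_aeval_zs_pow_mul_z_pow (hq : 0 < q) (p : ℂ[X]) (n : ℕ) :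
    Commute (aeval (x q κ) p) (zs q κ ^ n * z q κ ^ n) := by
  rw [zs_pow_mul_z_pow_eq hq, commute_iff_eq, ← map_mul, mul_comm, map_mul]

/-- Partitions of unity in `D₁ D₋₁`, with the left factors fixed. -/
lemma exists_left_partition_pos (hq : 0 < q) (hκ : κ ≠ 0) {N : ℕ} (hN : 0 < N) (hu : u ^ N = 1) :
    ∃ t ∈ weight q κ u (-1), ∃ t' ∈ weight q κ u (-1),
      z q κ * t + zs q κ ^ (N - 1) * t' = 1 := by
  obtain ⟨p, r, h⟩ := exists_z_zs_partition hq hκ (N - 1)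
  refine ⟨_, mul_mem_weight zs_mem_weight (aeval_mem_weight p) (by norm_num), _,
    mul_mem_weight (z_pow_mem_weight hu hN) (aeval_mem_weight r) (by norm_num), ?_⟩
  -- All factors are polynomials in `x`, so the Bézout coefficients may be moved to the right-hand
  -- side of the products.
  have h1 := (commute_aeval_z_pow_mul_zs_pow (κ := κ) hq p 1).eq
  rw [pow_one, pow_one] at h1
  rw [h1, (commute_aeval_zs_pow_mul_z_pow hq r (N - 1)).eq] at h
  rw [← h]
  simp only [mul_assoc]

/-- Partitions of unity in `D₋₁ D₁`, with the left factors fixed. -/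
lemma exists_left_partition_neg (hq : 0 < q) (hκ : κ ≠ 0) {N : ℕ} (hN : 0 < N) (hu : u ^ N = 1) :
    ∃ t ∈ weight q κ u 1, ∃ t' ∈ weight q κ u 1,
      zs q κ * t + z q κ ^ (N - 1) * t' = 1 := by
  obtain ⟨p, r, h⟩ := exists_zs_z_partition hq hκ (N - 1)
  refine ⟨_, mul_mem_weight z_mem_weight (aeval_mem_weight p) (by norm_num), _,
    mul_mem_weight (zs_pow_mem_weight hu hN) (aeval_mem_weight r) (by norm_num), ?_⟩
  have h1 := (commute_aeval_zs_pow_mul_z_pow (κ := κ) hq p 1).eq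
  rw [pow_one, pow_one] at h1
  rw [h1, (commute_aeval_z_pow_mul_zs_pow hq r (N - 1)).eq] at h
  rw [← h]
  simp only [mul_assoc]

/-- An element of weight `0` only involves signed powers whose exponents are divisible by the order
of `u`. -/
lemma eq_zero_of_mem_weight_zero (hq : 0 < q) (hκ : κ ≠ 0) {t : ℤ →₀ ℂ[X]}
    (ht : nf q κ t ∈ weight q κ u 0) {k : ℤ} (hk : u ^ k ≠ 1) : t k = 0 := by
  -- `S` is the automorphism `scale` on coefficients. Uniqueness of normal forms turns invariance of
  -- the element into invariance of each coefficient.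
  let S : (ℤ →₀ ℂ[X]) →ₗ[ℂ] (ℤ →₀ ℂ[X]) :=
    Finsupp.lsum ℂ fun k => ((u ^ k : ℂˣ) : ℂ) • Finsupp.lsingle k
  have hS (t : ℤ →₀ ℂ[X]) (k : ℤ) : S t k = ((u ^ k : ℂˣ) : ℂ) • t k := by
    induction t using Finsupp.induction_linear with
    | zero => simp
    | add f g hf hg => simp only [map_add, Finsupp.add_apply, hf, hg, smul_add]
    | single l p =>
      by_cases h : l = k
      · subst h; simp [S]
      · simp [S, Finsupp.single_eq_of_ne (Ne.symm h)]
  have hnf (t : ℤ →₀ ℂ[X]) : scale q κ u (nf q κ t) = nf q κ (S t) := by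
    induction t using Finsupp.induction_linear with
    | zero => simp
    | add f g hf hg => simp only [map_add, hf, hg]
    | single l p =>
      rw [normalForm_single, map_mul, scale_aeval, scale_signedPow]
      simp only [S, Finsupp.lsum_single, LinearMap.smul_apply, map_smul, Finsupp.lsingle_apply,
        normalForm_single, mul_smul_comm]
  have h1 : nf q κ (S t) = nf q κ t := by
    rw [← hnf]
    rw [mem_weight] at ht
    simpa using ht
  have h2 := DFunLike.congr_fun (nf_injective hq hκ h1) k
  rw [hS] at h2
  have h3 : (((u ^ k : ℂˣ) : ℂ) - 1) • t k = 0 := by rw [sub_smul, h2, one_smul, sub_self]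
  refine (smul_eq_zero.1 h3).resolve_left (sub_ne_zero.2 fun h => hk ?_)
  exact Units.ext h

end Disc

/-! ### The quantum cone algebra -/

namespace Cone

variable (N : ℕ) (q κ : ℝ)

def a : Cone N q κ := RingQuot.mkAlgHom ℂ (ConeRel N q κ) (FreeAlgebra.ι ℂ ConeGen.a)
def b : Cone N q κ := RingQuot.mkAlgHom ℂ (ConeRel N q κ) (FreeAlgebra.ι ℂ ConeGen.b)
def bs : Cone N q κ := RingQuot.mkAlgHom ℂ (ConeRel N q κ) (FreeAlgebra.ι ℂ ConeGen.bs)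

lemma adjoin_eq_top : Algebra.adjoin ℂ {a N q κ, b N q κ, bs N q κ} = ⊤ := by
  have h := congrArg (Subalgebra.map (RingQuot.mkAlgHom ℂ (ConeRel N q κ)))
    (FreeAlgebra.adjoin_range_ι ℂ ConeGen)
  rw [AlgHom.map_adjoin, Algebra.map_top,
    (AlgHom.range_eq_top _).2 (RingQuot.mkAlgHom_surjective ℂ _), ← Set.range_comp] at h
  refine top_le_iff.1 (le_of_eq_of_le h.symm (Algebra.adjoin_mono ?_))
  rintro _ ⟨(_ | _ | _), rfl⟩
  · exact Or.inl rfl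
  · exact Or.inr (Or.inl rfl)
  · exact Or.inr (Or.inr rfl)

lemma a_mul_b : a N q κ * b N q κ =
    (q : ℂ) ^ N • (b N q κ * a N q κ) + ((κ * qInt q N : ℝ) : ℂ) • b N q κ := by
  have := RingQuot.mkAlgHom_rel ℂ (ConeRel.a_b (N := N) (q := q) (κ := κ))
  rw [map_mul, map_add, map_smul, map_smul, map_mul] at this
  exact this

lemma bs_mul_a : bs N q κ * a N q κ =
    (q : ℂ) ^ N • (a N q κ * bs N q κ) + ((κ * qInt q N : ℝ) : ℂ) • bs N q κ := by
  have := RingQuot.mkAlgHom_rel ℂ (ConeRel.bs_a (N := N) (q := q) (κ := κ))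
  rw [map_mul, map_add, map_smul, map_smul, map_mul] at this
  exact this

lemma b_mul_bs : b N q κ * bs N q κ = aeval (a N q κ)
    ((List.range N).map fun l : ℕ => Disc.shiftPoly q κ (-(l : ℤ))).prod := by
  have := RingQuot.mkAlgHom_rel ℂ (ConeRel.b_bs (N := N) (q := q) (κ := κ))
  rw [map_mul, map_list_prod, List.map_map] at this
  rw [map_list_prod, List.map_map]
  refine this.trans ?_
  congr 2
  funext l
  simp only [Function.comp_apply, map_add, AlgHom.commutes, Disc.shiftPoly, map_mul,
    aeval_C, aeval_X, Algebra.smul_def]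
  rfl

lemma bs_mul_b : bs N q κ * b N q κ = aeval (a N q κ)
    ((List.range N).map fun l : ℕ => Disc.shiftPoly q κ ((l : ℤ) + 1)).prod := by
  have := RingQuot.mkAlgHom_rel ℂ (ConeRel.bs_b (N := N) (q := q) (κ := κ))
  rw [map_mul, map_list_prod, List.map_map] at this
  rw [map_list_prod, List.map_map]
  refine this.trans ?_
  congr 2
  funext l
  simp only [Function.comp_apply, map_add, AlgHom.commutes, Disc.shiftPoly, map_mul,
    aeval_C, aeval_X, Algebra.smul_def]
  norm_cast

variable {q}

/-- The normal form map `(pₖ) ↦ ∑ₖ pₖ(a) bₖ` of the quantum cone. -/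
abbrev nf (N : ℕ) (q κ : ℝ) : (ℤ →₀ ℂ[X]) →ₗ[ℂ] Cone N q κ :=
  normalForm (a N q κ) (b N q κ) (bs N q κ)

lemma nf_surjective (hq : 0 < q) : Function.Surjective (nf N q κ) := by
  have hq' : (q : ℂ) ≠ 0 := by exact_mod_cast hq.ne'
  refine normalForm_surjective
    -- The relation for `a b` solved for `b a`.
    (u := C ((q : ℂ) ^ N)⁻¹ * (X - C ((κ * qInt q N : ℝ) : ℂ)))
    (v := C ((q : ℂ) ^ N) * X + C ((κ * qInt q N : ℝ) : ℂ)) ?_ ?_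
    (b_mul_bs N q κ) (bs_mul_b N q κ) (adjoin_eq_top N q κ)
  · have h := a_mul_b N q κ
    rw [← sub_eq_iff_eq_add] at h
    rw [map_mul, aeval_C, ← Algebra.smul_def, smul_mul_assoc, map_sub, aeval_X, aeval_C, sub_mul,
      ← Algebra.smul_def, h, smul_smul, inv_mul_cancel₀ (pow_ne_zero _ hq'), one_smul]
  · rw [bs_mul_a]
    simp only [map_add, map_mul, aeval_C, aeval_X, add_mul, Algebra.smul_def, mul_assoc]

@[simp] lemma coneToDisc_a (hq : 0 < q) : coneToDisc N κ hq (a N q κ) = Disc.x q κ := by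
  unfold coneToDisc a Disc.x
  erw [RingQuot.liftAlgHom_mkAlgHom_apply]
  simp

@[simp] lemma coneToDisc_b (hq : 0 < q) : coneToDisc N κ hq (b N q κ) = Disc.z q κ ^ N := by
  unfold coneToDisc b
  erw [RingQuot.liftAlgHom_mkAlgHom_apply]
  simp

@[simp] lemma coneToDisc_bs (hq : 0 < q) : coneToDisc N κ hq (bs N q κ) = Disc.zs q κ ^ N := by
  unfold coneToDisc bs
  erw [RingQuot.liftAlgHom_mkAlgHom_apply]
  simp

variable {N κ}

/-- The embedding sends exponent `k` to `N k` and keeps the polynomials. Uniqueness of normal forms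
therefore descends from the disc to the cone, and the embedding is injective. -/
lemma coneToDisc_nf (hq : 0 < q) (t : ℤ →₀ ℂ[X]) :
    coneToDisc N κ hq (nf N q κ t) = Disc.nf q κ (t.mapDomain fun k => N * k) := by
  induction t using Finsupp.induction_linear with
  | zero => simp
  | add f g hf hg => simp only [map_add, hf, hg, Finsupp.mapDomain_add]
  | single k p =>
    rw [Finsupp.mapDomain_single, normalForm_single, normalForm_single, map_mul, map_signedPow,
      coneToDisc_b, coneToDisc_bs, signedPow_pow, ← aeval_algHom_apply, coneToDisc_a]

lemma natCast_mul_injective (hN : 0 < N) : Function.Injective fun k : ℤ => (N : ℤ) * k :=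
  fun _ _ h => mul_left_cancel₀ (by exact_mod_cast hN.ne') h

lemma coneToDisc_comp_nf_injective (hN : 0 < N) (hq : 0 < q) (hκ : κ ≠ 0) :
    Function.Injective fun t => coneToDisc N κ hq (nf N q κ t) := by
  intro s t h
  simp only [coneToDisc_nf] at h
  exact Finsupp.mapDomain_injective (natCast_mul_injective hN) (Disc.nf_injective hq hκ h)

lemma coneToDisc_injective (hN : 0 < N) (hq : 0 < q) (hκ : κ ≠ 0) :
    Function.Injective (coneToDisc N κ hq) := by
  intro f g h
  obtain ⟨s, rfl⟩ := nf_surjective N κ hq f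
  obtain ⟨t, rfl⟩ := nf_surjective N κ hq g
  rw [coneToDisc_comp_nf_injective hN hq hκ h]

lemma nf_injective (hN : 0 < N) (hq : 0 < q) (hκ : κ ≠ 0) : Function.Injective (nf N q κ) :=
  fun _ _ h => coneToDisc_comp_nf_injective hN hq hκ (congrArg _ h)

variable {u : ℂˣ}

lemma coneToDisc_mem_weight (hu : u ^ N = 1) (hq : 0 < q) (f : Cone N q κ) :
    coneToDisc N κ hq f ∈ Disc.weight q κ u 0 := by
  have hu' : (u : ℂ) ^ N = 1 := by rw [← Units.val_pow_eq_pow_val, hu, Units.val_one]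
  have hf : f ∈ Algebra.adjoin ℂ {a N q κ, b N q κ, bs N q κ} :=
    adjoin_eq_top N q κ ▸ Algebra.mem_top
  induction hf using Algebra.adjoin_induction with
  | mem f hf =>
    rcases hf with rfl | rfl | rfl <;> simp [Disc.mem_weight, _root_.smul_pow, hu']
  | algebraMap c => simp [Disc.mem_weight]
  | add f g _ _ hf hg => rw [map_add]; exact add_mem hf hg
  | mul f g _ _ hf hg => rw [map_mul]; exact Disc.mul_mem_weight hf hg (by norm_num)

/-- The quantum cone is the algebra of invariants of the action of the cyclic group of order `N`
on the quantum disc. -/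
lemma exists_coneToDisc_eq (hN : 0 < N) (hu : IsPrimitiveRoot u N) (hq : 0 < q) (hκ : κ ≠ 0)
    {f : Disc q κ} (hf : f ∈ Disc.weight q κ u 0) : ∃ g, coneToDisc N κ hq g = f := by
  obtain ⟨t, rfl⟩ := Disc.nf_surjective hq f
  refine ⟨nf N q κ (t.comapDomain _ (natCast_mul_injective hN).injOn), ?_⟩
  rw [coneToDisc_nf, Finsupp.mapDomain_comapDomain _ (natCast_mul_injective hN)]
  intro k hk
  -- Exponents in the support are killed by `u`, hence divisible by `N` by primitivity, so they lie
  -- in the range of `k ↦ N k`.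
  have h1 : u ^ k = 1 := by
    by_contra h
    exact Finsupp.mem_support_iff.1 hk (Disc.eq_zero_of_mem_weight_zero hq hκ hf h)
  obtain ⟨m, rfl⟩ := (hu.zpow_eq_one_iff_dvd k).1 h1
  exact ⟨m, rfl⟩

end Cone

end

section

open Polynomial

/-! ### The twist automorphism and the normal element -/

namespace Disc

variable {q κ : ℝ}

/-- The automorphism `z ↦ q⁻¹ z`, `z* ↦ q z*`, which describes the commutation of functions with
the one-forms `dz` and `dz*`. -/
def twist (κ : ℝ) (hq : 0 < q) : Disc q κ ≃ₐ[ℂ] Disc q κ :=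
  scale q κ (Units.mk0 (q : ℂ) (by exact_mod_cast hq.ne'))⁻¹

@[simp] lemma twist_z (hq : 0 < q) : twist κ hq (z q κ) = (q : ℂ)⁻¹ • z q κ := by
  simp [twist]

@[simp] lemma twist_zs (hq : 0 < q) : twist κ hq (zs q κ) = (q : ℂ) • zs q κ := by
  simp [twist]

@[simp] lemma twist_x (hq : 0 < q) : twist κ hq (x q κ) = x q κ := scale_x _

lemma scale_twist (hq : 0 < q) (u : ℂˣ) (f : Disc q κ) :
    scale q κ u (twist κ hq f) = twist κ hq (scale q κ u f) := scale_comm _ _ _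

lemma twist_mem_weight (hq : 0 < q) {u : ℂˣ} {k : ℤ} {f : Disc q κ} (hf : f ∈ weight q κ u k) :
    twist κ hq f ∈ weight q κ u k := scale_mem_weight hf _

lemma twist_symm_mem_weight (hq : 0 < q) {u : ℂˣ} {k : ℤ} {f : Disc q κ}
    (hf : f ∈ weight q κ u k) : (twist κ hq).symm f ∈ weight q κ u k := by
  have h : (twist κ hq).symm f = scale q κ (Units.mk0 (q : ℂ) (by exact_mod_cast hq.ne')) f := by
    rw [AlgEquiv.symm_apply_eq, twist, scale_mul_apply]
    simp
  rw [h]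
  exact scale_mem_weight hf _

variable (q κ) in
/-- The normal element `(q - 1) x + κ`, which implements the inverse of `twist`. -/
def normalElt : Disc q κ := aeval (x q κ) (normalPoly q κ)

lemma normalElt_eq (hq : 0 < q) : normalElt q κ = zs q κ * z q κ - z q κ * zs q κ := by
  rw [zs_mul_z_eq hq, normalElt]
  have h : qInt q 1 = 1 := by
    have := qInt_add_one hq.ne' 0
    simpa [qInt_zero] using this
  change _ = _ - x q κ
  simp only [normalPoly, shiftPoly, h, map_add, map_mul, aeval_C, aeval_X, map_sub, map_one,
    zpow_one, mul_one, sub_mul, one_mul]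
  abel

/-- Both sides are compatible with products, so the generators suffice. This commutation rule makes
commutators divided by `normalElt` obey the same twisted Leibniz rule as the partial derivatives. -/
lemma mul_normalElt (hq : 0 < q) (f : Disc q κ) :
    f * normalElt q κ = normalElt q κ * twist κ hq f := by
  have hq' : (q : ℂ) ≠ 0 := by exact_mod_cast hq.ne'
  have h := zs_mul_z q κ
  rw [Algebra.algebraMap_eq_smul_one] at h
  induction f using Disc.induction_on with
  | hz =>
    rw [normalElt_eq hq, twist_z]
    -- Multiplying the defining relation by `z` on either side supplies the rewriting rules for the
    -- cubic words that occur.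
    have h1 := congrArg (· * z q κ) h
    have h2 := congrArg (z q κ * ·) h
    simp only [add_mul, mul_add, smul_mul_assoc, mul_smul_comm, one_mul, mul_one,
      ← mul_assoc] at h1 h2
    simp only [mul_sub, sub_mul, mul_smul_comm, ← mul_assoc, h1, h2]
    match_scalars <;> field_simp
    all_goals ring
  | hzs =>
    rw [normalElt_eq hq, twist_zs]
    have h1 := congrArg (· * zs q κ) h
    have h2 := congrArg (zs q κ * ·) h
    simp only [add_mul, mul_add, smul_mul_assoc, mul_smul_comm, one_mul, mul_one,
      ← mul_assoc] at h1 h2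
    simp only [mul_sub, sub_mul, mul_smul_comm, ← mul_assoc, h1, h2]
    match_scalars <;> field_simp
    all_goals ring
  | hc c => simp [Algebra.commutes]
  | hadd f g hf hg => simp [add_mul, mul_add, hf, hg]
  | hmul f g hf hg => rw [mul_assoc, hg, ← mul_assoc, hf, mul_assoc, map_mul]

end Disc

/-! ### The forms on the quantum disc -/

namespace DiscForms

variable {q κ : ℝ}

variable (q κ) in
lemma adjoin_eq_top : Algebra.adjoin ℂ (Set.range (gen q κ)) = ⊤ := by
  have h := congrArg (Subalgebra.map (RingQuot.mkAlgHom ℂ (FormRel q κ)))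
    (FreeAlgebra.adjoin_range_ι ℂ FormGen)
  rw [AlgHom.map_adjoin, Algebra.map_top,
    (AlgHom.range_eq_top _).2 (RingQuot.mkAlgHom_surjective ℂ _), ← Set.range_comp] at h
  exact h

lemma induction_on {motive : DiscForms q κ → Prop} (ω : DiscForms q κ)
    (hgen : ∀ i, motive (gen q κ i)) (hc : ∀ c : ℂ, motive (algebraMap ℂ _ c))
    (hadd : ∀ f g, motive f → motive g → motive (f + g))
    (hmul : ∀ f g, motive f → motive g → motive (f * g)) : motive ω := by
  have hf : ω ∈ Algebra.adjoin ℂ (Set.range (gen q κ)) := adjoin_eq_top q κ ▸ Algebra.mem_top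
  induction hf using Algebra.adjoin_induction with
  | mem x hx =>
    obtain ⟨i, rfl⟩ := hx
    exact hgen i
  | algebraMap c => exact hc c
  | add x y _ _ hx hy => exact hadd x y hx hy
  | mul x y _ _ hx hy => exact hmul x y hx hy

@[simp] lemma ofDisc_z : ofDisc q κ (Disc.z q κ) = z q κ := by
  unfold ofDisc Disc.z
  erw [RingQuot.liftAlgHom_mkAlgHom_apply]
  simp

@[simp] lemma ofDisc_zs : ofDisc q κ (Disc.zs q κ) = zs q κ := by
  unfold ofDisc Disc.zs
  erw [RingQuot.liftAlgHom_mkAlgHom_apply]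
  simp

/-! #### The graded Leibniz rule -/

/-- The map `ω ↦ (-1)ⁿ ω` for `n`-forms `ω`. -/
def parity (κ : ℝ) (hq : 0 < q) (ω : DiscForms q κ) : DiscForms q κ := leibnizHom κ hq ω 0 0

/-- The matrices are upper triangular with the form itself in the lower corner; their product
therefore encodes the graded Leibniz rule. -/
lemma leibnizHom_eq (hq : 0 < q) (ω : DiscForms q κ) :
    leibnizHom κ hq ω 1 0 = 0 ∧ leibnizHom κ hq ω 1 1 = ω := by
  induction ω using DiscForms.induction_on with
  | hgen i => cases i <;> simp [leibnizHom_gen, leibnizGen]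
  | hc c => simp [Matrix.algebraMap_matrix_apply]
  | hadd f g hf hg => simp [hf, hg]
  | hmul f g hf hg => simp [Matrix.mul_apply, Fin.sum_univ_two, hf, hg]

lemma d_mul (hq : 0 < q) (ω η : DiscForms q κ) :
    d κ hq (ω * η) = d κ hq ω * η + parity κ hq ω * d κ hq η := by
  change leibnizHom κ hq (ω * η) 0 1 = leibnizHom κ hq ω 0 1 * η +
    leibnizHom κ hq ω 0 0 * leibnizHom κ hq η 0 1
  rw [map_mul, Matrix.mul_apply, Fin.sum_univ_two, (leibnizHom_eq hq η).2, add_comm]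

lemma parity_mul (hq : 0 < q) (ω η : DiscForms q κ) :
    parity κ hq (ω * η) = parity κ hq ω * parity κ hq η := by
  unfold parity
  rw [map_mul, Matrix.mul_apply, Fin.sum_univ_two, (leibnizHom_eq hq η).1, mul_zero, add_zero]

lemma parity_add (hq : 0 < q) (ω η : DiscForms q κ) :
    parity κ hq (ω + η) = parity κ hq ω + parity κ hq η := by
  simp [parity]

lemma parity_smul (hq : 0 < q) (c : ℂ) (ω : DiscForms q κ) :
    parity κ hq (c • ω) = c • parity κ hq ω := by
  simp [parity]

lemma parity_algebraMap (hq : 0 < q) (c : ℂ) :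
    parity κ hq (algebraMap ℂ _ c) = algebraMap ℂ _ c := by
  simp [parity, Matrix.algebraMap_matrix_apply]

lemma d_algebraMap (hq : 0 < q) (c : ℂ) : d κ hq (algebraMap ℂ _ c) = 0 := by
  simp [d, Matrix.algebraMap_matrix_apply]

/-- The two claims are proved together: in `d (d (f g))` the mixed terms cancel only because `d`
anticommutes with the parity map. -/
lemma parity_d_and_d_d (hq : 0 < q) (ω : DiscForms q κ) :
    parity κ hq (d κ hq ω) = -d κ hq (parity κ hq ω) ∧ d κ hq (d κ hq ω) = 0 := by
  induction ω using DiscForms.induction_on with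
  | hgen i =>
    cases i <;> simp [d, leibnizHom_gen, leibnizGen, parity]
  | hc c =>
    rw [parity_algebraMap, d_algebraMap]
    simp [parity]
  | hadd f g hf hg =>
    simp only [map_add, parity_add, hf, hg, add_zero, and_true]
    abel
  | hmul f g hf hg =>
    refine ⟨?_, ?_⟩
    · rw [d_mul, parity_add, parity_mul, parity_mul, parity_mul, d_mul, hf.1, hg.1]
      noncomm_ring
    · rw [d_mul, map_add, d_mul, d_mul, hf.1, hf.2, hg.2]
      noncomm_ring

lemma parity_ofDisc (hq : 0 < q) (f : Disc q κ) :
    parity κ hq (ofDisc q κ f) = ofDisc q κ f := by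
  induction f using Disc.induction_on with
  | hz => simp [parity, leibnizHom_gen, leibnizGen]
  | hzs => simp [parity, leibnizHom_gen, leibnizGen]
  | hc c => rw [AlgHom.commutes, parity_algebraMap]
  | hadd f g hf hg => rw [map_add, parity_add, hf, hg]
  | hmul f g hf hg => rw [map_mul, parity_mul, hf, hg]

/-! #### Coordinates of forms -/

section Matrices

variable {A : Type} [Ring A] [Algebra ℂ A]

/-- The action of the generators on the free right module with basis `1`, `dz`, `dz*`,
`dz ∧ dz*`, where `u`, `v` and `c` stand for `z`, `z*` and `q`. -/
def matGen (c : ℂ) (u v : A) : FormGen → Matrix (Fin 4) (Fin 4) A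
  | FormGen.z => !![u, 0, 0, 0; 0, c⁻¹ • u, 0, 0; 0, 0, c⁻¹ • u, 0; 0, 0, 0, (c⁻¹ * c⁻¹) • u]
  | FormGen.zs => !![v, 0, 0, 0; 0, c • v, 0, 0; 0, 0, c • v, 0; 0, 0, 0, (c * c) • v]
  | FormGen.dz => !![0, 0, 0, 0; 1, 0, 0, 0; 0, 0, 0, 0; 0, 0, 1, 0]
  | FormGen.dzs => !![0, 0, 0, 0; 0, 0, 0, 0; 1, 0, 0, 0; 0, -c • 1, 0, 0]

variable {c : ℂ} {u v : A}

lemma matGen_zs_mul_z (hc : c ≠ 0) {k : ℂ} (h : v * u = c • (u * v) + algebraMap ℂ A k) :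
    matGen c u v FormGen.zs * matGen c u v FormGen.z =
      c • (matGen c u v FormGen.z * matGen c u v FormGen.zs) + algebraMap ℂ _ k := by
  have h1 : c⁻¹ * c⁻¹ * (c * c * c) = c := by field_simp
  have h2 : c⁻¹ * c⁻¹ * (c * c) = 1 := by field_simp
  ext i j
  fin_cases i <;> fin_cases j <;>
    simp [matGen, Matrix.mul_apply, Fin.sum_univ_four, Matrix.algebraMap_matrix_apply, smul_smul,
      h, hc, h1, h2]

lemma matGen_z_mul_dz : matGen c u v FormGen.z * matGen c u v FormGen.dz =
    c⁻¹ • (matGen c u v FormGen.dz * matGen c u v FormGen.z) := by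
  ext i j
  fin_cases i <;> fin_cases j <;>
    simp [matGen, Matrix.mul_apply, Fin.sum_univ_four, smul_smul]

lemma matGen_zs_mul_dz : matGen c u v FormGen.zs * matGen c u v FormGen.dz =
    c • (matGen c u v FormGen.dz * matGen c u v FormGen.zs) := by
  ext i j
  fin_cases i <;> fin_cases j <;>
    simp [matGen, Matrix.mul_apply, Fin.sum_univ_four, smul_smul]

lemma matGen_dzs_mul_zs (hc : c ≠ 0) : matGen c u v FormGen.dzs * matGen c u v FormGen.zs =
    c⁻¹ • (matGen c u v FormGen.zs * matGen c u v FormGen.dzs) := by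
  have h : c * c = c⁻¹ * (c * c * c) := by field_simp
  ext i j
  fin_cases i <;> fin_cases j <;>
    simp [matGen, Matrix.mul_apply, Fin.sum_univ_four, smul_smul, hc, ← h]

lemma matGen_dzs_mul_z (hc : c ≠ 0) : matGen c u v FormGen.dzs * matGen c u v FormGen.z =
    c • (matGen c u v FormGen.z * matGen c u v FormGen.dzs) := by
  ext i j
  fin_cases i <;> fin_cases j <;>
    simp [matGen, Matrix.mul_apply, Fin.sum_univ_four, smul_smul, hc]

lemma matGen_dz_mul_dzs (hc : c ≠ 0) : matGen c u v FormGen.dz * matGen c u v FormGen.dzs =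
    -c⁻¹ • (matGen c u v FormGen.dzs * matGen c u v FormGen.dz) := by
  ext i j
  fin_cases i <;> fin_cases j <;>
    simp [matGen, Matrix.mul_apply, Fin.sum_univ_four, smul_smul, hc]

lemma matGen_dz_mul_dz : matGen c u v FormGen.dz * matGen c u v FormGen.dz = 0 := by
  ext i j
  fin_cases i <;> fin_cases j <;> simp [matGen, Matrix.mul_apply, Fin.sum_univ_four]

lemma matGen_dzs_mul_dzs : matGen c u v FormGen.dzs * matGen c u v FormGen.dzs = 0 := by
  ext i j
  fin_cases i <;> fin_cases j <;> simp [matGen, Matrix.mul_apply, Fin.sum_univ_four]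

end Matrices

/-- Left multiplication on forms, as matrices over the quantum disc. -/
def mat (κ : ℝ) (hq : 0 < q) : DiscForms q κ →ₐ[ℂ] Matrix (Fin 4) (Fin 4) (Disc q κ) :=
  RingQuot.liftAlgHom ℂ ⟨FreeAlgebra.lift ℂ (matGen (q : ℂ) (Disc.z q κ) (Disc.zs q κ)), by
    have hq' : (q : ℂ) ≠ 0 := by exact_mod_cast hq.ne'
    intro x y h
    cases h <;>
    simp only [map_mul, map_add, map_smul, map_zero, FreeAlgebra.lift_ι_apply, AlgHom.commutes]
    · exact matGen_zs_mul_z hq' (Disc.zs_mul_z q κ)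
    · exact matGen_z_mul_dz
    · exact matGen_dzs_mul_zs hq'
    · exact matGen_zs_mul_dz
    · exact matGen_dzs_mul_z hq'
    · exact matGen_dz_mul_dzs hq'
    · exact matGen_dz_mul_dz
    · exact matGen_dzs_mul_dzs⟩

lemma mat_gen (hq : 0 < q) (i : FormGen) : mat κ hq (gen q κ i) =
    matGen (q : ℂ) (Disc.z q κ) (Disc.zs q κ) i := by
  unfold mat gen
  erw [RingQuot.liftAlgHom_mkAlgHom_apply]
  simp

end DiscForms

end

section

open Polynomial

/-! ### Normal ordering of forms, coordinates, grading and derivatives -/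

namespace DiscForms

variable {q κ : ℝ}

lemma ofDisc_mul_dz (hq : 0 < q) (f : Disc q κ) :
    ofDisc q κ f * dz q κ = dz q κ * ofDisc q κ (Disc.twist κ hq f) := by
  induction f using Disc.induction_on with
  | hz => simp only [Disc.twist_z, map_smul, ofDisc_z, z_mul_dz, mul_smul_comm]
  | hzs => simp only [Disc.twist_zs, map_smul, ofDisc_zs, zs_mul_dz, mul_smul_comm]
  | hc c => simp [Algebra.commutes]
  | hadd f g hf hg => simp [add_mul, mul_add, hf, hg]
  | hmul f g hf hg => simp [mul_assoc, hg]; simp only [← mul_assoc, hf]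

lemma ofDisc_mul_dzs (hq : 0 < q) (f : Disc q κ) :
    ofDisc q κ f * dzs q κ = dzs q κ * ofDisc q κ (Disc.twist κ hq f) := by
  have hq' : (q : ℂ) ≠ 0 := by exact_mod_cast hq.ne'
  induction f using Disc.induction_on with
  | hz =>
    rw [Disc.twist_z, map_smul, ofDisc_z, mul_smul_comm, dzs_mul_z, smul_smul,
      inv_mul_cancel₀ hq', one_smul]
  | hzs =>
    rw [Disc.twist_zs, map_smul, ofDisc_zs, mul_smul_comm, dzs_mul_zs, smul_smul,
      mul_inv_cancel₀ hq', one_smul]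
  | hc c => simp [Algebra.commutes]
  | hadd f g hf hg => simp [add_mul, mul_add, hf, hg]
  | hmul f g hf hg => simp [mul_assoc, hg]; simp only [← mul_assoc, hf]

lemma dzs_mul_dz (hq : 0 < q) : dzs q κ * dz q κ = -(q : ℂ) • (dz q κ * dzs q κ) := by
  have hq' : (q : ℂ) ≠ 0 := by exact_mod_cast hq.ne'
  rw [dz_mul_dzs, smul_smul, neg_mul_neg, mul_inv_cancel₀ hq', one_smul]

variable (q κ) in
/-- The volume form `dz ∧ dz*`. -/
def vol : DiscForms q κ := dz q κ * dzs q κ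

lemma ofDisc_mul_vol (hq : 0 < q) (f : Disc q κ) :
    ofDisc q κ f * vol q κ = vol q κ * ofDisc q κ (Disc.twist κ hq (Disc.twist κ hq f)) := by
  rw [vol, ← mul_assoc, ofDisc_mul_dz hq, mul_assoc, ofDisc_mul_dzs hq, mul_assoc]

/-- The one-form `dz f + dz* g`. -/
def oneForm (f g : Disc q κ) : DiscForms q κ :=
  dz q κ * ofDisc q κ f + dzs q κ * ofDisc q κ g

lemma oneForm_add (f g f' g' : Disc q κ) :
    oneForm f g + oneForm f' g' = oneForm (f + f') (g + g') := by
  simp only [oneForm, map_add, mul_add]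
  abel

lemma oneForm_sub (f g f' g' : Disc q κ) :
    oneForm f g - oneForm f' g' = oneForm (f - f') (g - g') := by
  simp only [oneForm, map_sub, mul_sub]
  abel

lemma smul_oneForm (c : ℂ) (f g : Disc q κ) : c • oneForm f g = oneForm (c • f) (c • g) := by
  simp only [oneForm, map_smul, mul_smul_comm, smul_add]

lemma oneForm_mul_ofDisc (f g h : Disc q κ) :
    oneForm f g * ofDisc q κ h = oneForm (f * h) (g * h) := by
  simp only [oneForm, map_mul, add_mul, mul_assoc]

lemma ofDisc_mul_oneForm (hq : 0 < q) (f g h : Disc q κ) :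
    ofDisc q κ h * oneForm f g = oneForm (Disc.twist κ hq h * f) (Disc.twist κ hq h * g) := by
  simp only [oneForm, map_mul, mul_add, ← mul_assoc, ofDisc_mul_dz hq, ofDisc_mul_dzs hq]

lemma oneForm_mul_oneForm (hq : 0 < q) (f g f' g' : Disc q κ) :
    oneForm f g * oneForm f' g' = vol q κ *
      ofDisc q κ (Disc.twist κ hq f * g' - (q : ℂ) • (Disc.twist κ hq g * f')) := by
  have h (s t : DiscForms q κ) (f g : Disc q κ) (hs : ofDisc q κ f * t =
      t * ofDisc q κ (Disc.twist κ hq f)) : s * ofDisc q κ f * (t * ofDisc q κ g) =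
      s * t * ofDisc q κ (Disc.twist κ hq f * g) := by
    rw [map_mul, mul_assoc, ← mul_assoc _ t, hs]
    simp only [mul_assoc]
  simp only [oneForm, add_mul, mul_add, h _ _ _ _ (ofDisc_mul_dz hq _),
    h _ _ _ _ (ofDisc_mul_dzs hq _), dz_mul_dz, dzs_mul_dzs, dzs_mul_dz hq, zero_mul, zero_add,
    add_zero, map_sub, map_smul, mul_sub, vol, neg_smul, neg_mul, smul_mul_assoc, mul_smul_comm]
  abel

/-- The form `v₀ + dz v₁ + dz* v₂ + dz ∧ dz* v₃`. -/
def ofCoords (v : Fin 4 → Disc q κ) : DiscForms q κ :=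
  ofDisc q κ (v 0) + oneForm (v 1) (v 2) + vol q κ * ofDisc q κ (v 3)

/-- The matrices compute genuine left multiplication, which needs checking on generators only.
Applied to the coordinates of the form `1`, this recovers every form from the first column of its
matrix. -/
lemma ofCoords_mulVec (hq : 0 < q) (ω : DiscForms q κ) (v : Fin 4 → Disc q κ) :
    ofCoords ((mat κ hq ω).mulVec v) = ω * ofCoords v := by
  have hz : z q κ * vol q κ = ((q : ℂ)⁻¹ * (q : ℂ)⁻¹) • (vol q κ * z q κ) := by
    have := ofDisc_mul_vol hq (Disc.z q κ)
    simpa [smul_smul] using this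
  have hzs : zs q κ * vol q κ = ((q : ℂ) * (q : ℂ)) • (vol q κ * zs q κ) := by
    have := ofDisc_mul_vol hq (Disc.zs q κ)
    simpa only [Disc.twist_zs, map_smul, ofDisc_zs, mul_smul_comm, smul_smul] using this
  induction ω using DiscForms.induction_on generalizing v with
  | hgen i =>
    rw [mat_gen]
    cases i
    · change _ = z q κ * _
      have h1 := ofDisc_mul_oneForm hq (v 1) (v 2) (Disc.z q κ)
      rw [ofDisc_z] at h1
      simp only [ofCoords, mul_add, h1, ← mul_assoc, hz]
      simp [Matrix.mulVec, dotProduct, Fin.sum_univ_four, matGen, mul_assoc]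
    · change _ = zs q κ * _
      have h1 := ofDisc_mul_oneForm hq (v 1) (v 2) (Disc.zs q κ)
      rw [ofDisc_zs] at h1
      simp only [ofCoords, mul_add, h1, ← mul_assoc, hzs]
      simp only [Matrix.mulVec, dotProduct, Fin.sum_univ_four, matGen, Disc.twist_zs]
      simp [mul_assoc]
    · change _ = dz q κ * _
      simp only [ofCoords, oneForm, mul_add, vol, ← mul_assoc, dz_mul_dz]
      simp [Matrix.mulVec, dotProduct, Fin.sum_univ_four, matGen]
    · change _ = dzs q κ * _
      simp only [ofCoords, oneForm, mul_add, vol, ← mul_assoc, dzs_mul_dzs, dzs_mul_dz hq]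
      simp only [Matrix.mulVec, dotProduct, Fin.sum_univ_four, matGen]
      simp [mul_assoc, -Complex.coe_smul]
      rw [← mul_assoc (dzs q κ), dzs_mul_dzs, zero_mul]
      simp
  | hc c =>
    rw [Algebra.algebraMap_eq_smul_one, map_smul, map_one, Matrix.smul_mulVec, Matrix.one_mulVec,
      smul_mul_assoc, one_mul]
    simp only [ofCoords, Pi.smul_apply, map_smul, ← smul_oneForm, mul_smul_comm, smul_add]
  | hadd f g hf hg =>
    rw [map_add, Matrix.add_mulVec, add_mul, ← hf, ← hg]
    simp only [ofCoords, Pi.add_apply, map_add, ← oneForm_add, mul_add]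
    abel
  | hmul f g hf hg => rw [map_mul, ← Matrix.mulVec_mulVec, hf, hg, mul_assoc]

/-- The coordinates of a form with respect to the basis `1`, `dz`, `dz*`, `dz ∧ dz*` of the right
module of forms. -/
def coord (κ : ℝ) (hq : 0 < q) (i : Fin 4) : DiscForms q κ →ₗ[ℂ] Disc q κ where
  toFun ω := mat κ hq ω i 0
  map_add' _ _ := by simp
  map_smul' _ _ := by simp

lemma ofCoords_coord (hq : 0 < q) (ω : DiscForms q κ) :
    ofCoords (fun i => coord κ hq i ω) = ω := by
  have h := ofCoords_mulVec hq ω (Pi.single 0 1)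
  rw [Matrix.mulVec_single_one] at h
  have h1 : ofCoords (Pi.single 0 1 : Fin 4 → Disc q κ) = 1 := by
    simp [ofCoords, oneForm]
  rw [h1, mul_one] at h
  exact h

lemma mat_ofDisc (hq : 0 < q) (f : Disc q κ) : mat κ hq (ofDisc q κ f) =
    Matrix.diagonal ![f, Disc.twist κ hq f, Disc.twist κ hq f,
      Disc.twist κ hq (Disc.twist κ hq f)] := by
  induction f using Disc.induction_on with
  | hz =>
    rw [ofDisc_z, mat_gen, matGen]
    ext i j
    fin_cases i <;> fin_cases j <;> simp [smul_smul]
  | hzs =>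
    rw [ofDisc_zs, mat_gen, matGen]
    ext i j
    fin_cases i <;> fin_cases j <;>
      simp only [Disc.twist_zs, map_smul, smul_smul] <;> simp
  | hc c =>
    rw [AlgHom.commutes, AlgHom.commutes, Matrix.algebraMap_eq_diagonal]
    congr 1
    ext i
    fin_cases i <;> simp
  | hadd f g hf hg =>
    rw [map_add, map_add, hf, hg, Matrix.diagonal_add]
    congr 1
    ext i
    fin_cases i <;> simp
  | hmul f g hf hg =>
    rw [map_mul, map_mul, hf, hg, Matrix.diagonal_mul_diagonal]
    congr 1
    ext i
    fin_cases i <;> simp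

lemma coord_mul_ofDisc (hq : 0 < q) (i : Fin 4) (ω : DiscForms q κ) (f : Disc q κ) :
    coord κ hq i (ω * ofDisc q κ f) = coord κ hq i ω * f := by
  change mat κ hq (ω * ofDisc q κ f) i 0 = mat κ hq ω i 0 * f
  rw [map_mul, mat_ofDisc, Matrix.mul_diagonal]
  simp

lemma coord_ofDisc (hq : 0 < q) (i : Fin 4) (f : Disc q κ) :
    coord κ hq i (ofDisc q κ f) = if i = 0 then f else 0 := by
  change mat κ hq (ofDisc q κ f) i 0 = _
  rw [mat_ofDisc]
  fin_cases i <;> simp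

lemma coord_dz (hq : 0 < q) (i : Fin 4) : coord κ hq i (dz q κ) = if i = 1 then 1 else 0 := by
  change mat κ hq (dz q κ) i 0 = _
  rw [mat_gen]
  fin_cases i <;> simp [matGen]

lemma coord_dzs (hq : 0 < q) (i : Fin 4) : coord κ hq i (dzs q κ) = if i = 2 then 1 else 0 := by
  change mat κ hq (dzs q κ) i 0 = _
  rw [mat_gen]
  fin_cases i <;> simp [matGen]

lemma coord_vol (hq : 0 < q) (i : Fin 4) : coord κ hq i (vol q κ) = if i = 3 then 1 else 0 := by
  change mat κ hq (vol q κ) i 0 = _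
  rw [vol, map_mul, mat_gen, mat_gen]
  fin_cases i <;> simp [matGen, Matrix.mul_apply, Fin.sum_univ_four]

lemma coord_oneForm (hq : 0 < q) (i : Fin 4) (f g : Disc q κ) :
    coord κ hq i (oneForm f g) = if i = 1 then f else if i = 2 then g else 0 := by
  rw [oneForm, map_add, coord_mul_ofDisc, coord_mul_ofDisc, coord_dz, coord_dzs]
  fin_cases i <;> simp

lemma coord_vol_mul (hq : 0 < q) (i : Fin 4) (f : Disc q κ) :
    coord κ hq i (vol q κ * ofDisc q κ f) = if i = 3 then f else 0 := by
  rw [coord_mul_ofDisc, coord_vol]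
  fin_cases i <;> simp

lemma oneForm_inj (hq : 0 < q) {f g f' g' : Disc q κ} :
    oneForm f g = oneForm f' g' ↔ f = f' ∧ g = g' := by
  refine ⟨fun h => ⟨?_, ?_⟩, fun h => by rw [h.1, h.2]⟩
  · simpa [coord_oneForm] using congrArg (coord κ hq 1) h
  · simpa [coord_oneForm] using congrArg (coord κ hq 2) h

/-! #### The grading -/

/-- The degrees of the basis elements `1`, `dz`, `dz*`, `dz ∧ dz*`. -/
def basisDegree : Fin 4 → ℕ := ![0, 1, 1, 2]

/-- The forms of degree `n`: those whose left multiplication raises degrees by `n`. -/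
def homogeneous (κ : ℝ) (hq : 0 < q) (n : ℕ) : Submodule ℂ (DiscForms q κ) where
  carrier := {ω | ∀ i j, basisDegree i ≠ basisDegree j + n → mat κ hq ω i j = 0}
  add_mem' hω hη i j h := by simp [hω i j h, hη i j h]
  zero_mem' i j h := by simp
  smul_mem' c ω hω i j h := by simp [hω i j h]

lemma mul_mem_homogeneous (hq : 0 < q) {m n : ℕ} {ω η : DiscForms q κ}
    (hω : ω ∈ homogeneous κ hq m) (hη : η ∈ homogeneous κ hq n) :
    ω * η ∈ homogeneous κ hq (m + n) := by
  intro i j h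
  rw [map_mul, Matrix.mul_apply]
  refine Finset.sum_eq_zero fun k _ => ?_
  by_cases hk : basisDegree k = basisDegree j + n
  · rw [hω i k (by omega), zero_mul]
  · rw [hη k j hk, mul_zero]

lemma ofDisc_mem_homogeneous (hq : 0 < q) (f : Disc q κ) :
    ofDisc q κ f ∈ homogeneous κ hq 0 := by
  intro i j h
  rw [mat_ofDisc, Matrix.diagonal_apply_ne]
  rintro rfl
  exact h rfl

lemma dz_mem_homogeneous (hq : 0 < q) : dz q κ ∈ homogeneous κ hq 1 := by
  intro i j h
  rw [mat_gen]
  fin_cases i <;> fin_cases j <;> simp_all [matGen, basisDegree]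

lemma dzs_mem_homogeneous (hq : 0 < q) : dzs q κ ∈ homogeneous κ hq 1 := by
  intro i j h
  rw [mat_gen]
  fin_cases i <;> fin_cases j <;> simp_all [matGen, basisDegree]

lemma coord_eq_zero (hq : 0 < q) {n : ℕ} {ω : DiscForms q κ} (hω : ω ∈ homogeneous κ hq n)
    {i : Fin 4} (hi : basisDegree i ≠ n) : coord κ hq i ω = 0 :=
  hω i 0 (by simpa [basisDegree] using hi)

lemma homogeneous_eq_bot (hq : 0 < q) {n : ℕ} (hn : 2 < n) : homogeneous κ hq n = ⊥ := by
  rw [eq_bot_iff]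
  intro ω hω
  rw [Submodule.mem_bot, ← ofCoords_coord hq ω]
  have h (i : Fin 4) : coord κ hq i ω = 0 := by
    refine coord_eq_zero hq hω ?_
    fin_cases i <;> simp [basisDegree] <;> omega
  simp [h, ofCoords, oneForm]

lemma eq_oneForm_of_mem (hq : 0 < q) {ω : DiscForms q κ} (hω : ω ∈ homogeneous κ hq 1) :
    ω = oneForm (coord κ hq 1 ω) (coord κ hq 2 ω) := by
  conv_lhs => rw [← ofCoords_coord hq ω]
  rw [ofCoords, coord_eq_zero hq hω (i := 0) (by simp [basisDegree]),
    coord_eq_zero hq hω (i := 3) (by simp [basisDegree])]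
  simp

/-- Each coordinate lives in a single degree. It vanishes either because the form has degree `n` or
because the form is a sum of forms of other degrees. -/
lemma iSupIndep_homogeneous (hq : 0 < q) : iSupIndep (homogeneous κ hq) := by
  intro n
  rw [Submodule.disjoint_def]
  intro ω hω hω'
  rw [← ofCoords_coord hq ω]
  have h (i : Fin 4) : coord κ hq i ω = 0 := by
    by_cases hi : basisDegree i = n
    · have hle : (⨆ m, ⨆ (_ : m ≠ n), homogeneous κ hq m) ≤ LinearMap.ker (coord κ hq i) :=
        iSup₂_le fun m hm η hη => coord_eq_zero hq hη (by omega)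
      exact hle hω'
    · exact coord_eq_zero hq hω hi
  simp [h, ofCoords, oneForm]

/-! #### The partial derivatives -/

/-- The coefficient of `dz` in `df`. -/
def del (κ : ℝ) (hq : 0 < q) (f : Disc q κ) : Disc q κ := coord κ hq 1 (d κ hq (ofDisc q κ f))

/-- The coefficient of `dz*` in `df`. -/
def delBar (κ : ℝ) (hq : 0 < q) (f : Disc q κ) : Disc q κ := coord κ hq 2 (d κ hq (ofDisc q κ f))

lemma d_ofDisc_mul (hq : 0 < q) (f g : Disc q κ) : d κ hq (ofDisc q κ (f * g)) =
    d κ hq (ofDisc q κ f) * ofDisc q κ g + ofDisc q κ f * d κ hq (ofDisc q κ g) := by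
  rw [map_mul, d_mul, parity_ofDisc]

lemma d_ofDisc_mem_homogeneous (hq : 0 < q) (f : Disc q κ) :
    d κ hq (ofDisc q κ f) ∈ homogeneous κ hq 1 := by
  induction f using Disc.induction_on with
  | hz => rw [ofDisc_z, d_z]; exact dz_mem_homogeneous hq
  | hzs => rw [ofDisc_zs, d_zs]; exact dzs_mem_homogeneous hq
  | hc c => rw [AlgHom.commutes, d_algebraMap]; exact zero_mem _
  | hadd f g hf hg => rw [map_add, map_add]; exact add_mem hf hg
  | hmul f g hf hg =>
    rw [d_ofDisc_mul]
    exact add_mem (mul_mem_homogeneous hq hf (ofDisc_mem_homogeneous hq g))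
      (by simpa using mul_mem_homogeneous hq (ofDisc_mem_homogeneous hq f) hg)

lemma d_ofDisc (hq : 0 < q) (f : Disc q κ) :
    d κ hq (ofDisc q κ f) = oneForm (del κ hq f) (delBar κ hq f) :=
  eq_oneForm_of_mem hq (d_ofDisc_mem_homogeneous hq f)

lemma del_z (hq : 0 < q) : del κ hq (Disc.z q κ) = 1 := by
  simp [del, d_z, coord_dz]

lemma del_zs (hq : 0 < q) : del κ hq (Disc.zs q κ) = 0 := by
  simp [del, d_zs, coord_dzs]

lemma delBar_z (hq : 0 < q) : delBar κ hq (Disc.z q κ) = 0 := by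
  simp [delBar, d_z, coord_dz]

lemma delBar_zs (hq : 0 < q) : delBar κ hq (Disc.zs q κ) = 1 := by
  simp [delBar, d_zs, coord_dzs]

lemma del_algebraMap (hq : 0 < q) (c : ℂ) : del κ hq (algebraMap ℂ _ c) = 0 := by
  simp [del, d_algebraMap]

lemma delBar_algebraMap (hq : 0 < q) (c : ℂ) : delBar κ hq (algebraMap ℂ _ c) = 0 := by
  simp [delBar, d_algebraMap]

lemma del_add (hq : 0 < q) (f g : Disc q κ) : del κ hq (f + g) = del κ hq f + del κ hq g := by
  simp [del]

lemma delBar_add (hq : 0 < q) (f g : Disc q κ) :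
    delBar κ hq (f + g) = delBar κ hq f + delBar κ hq g := by
  simp [delBar]

lemma del_smul (hq : 0 < q) (c : ℂ) (f : Disc q κ) : del κ hq (c • f) = c • del κ hq f := by
  simp [del]

lemma delBar_smul (hq : 0 < q) (c : ℂ) (f : Disc q κ) :
    delBar κ hq (c • f) = c • delBar κ hq f := by
  simp [delBar]

lemma del_mul_and_delBar_mul (hq : 0 < q) (f g : Disc q κ) :
    del κ hq (f * g) = del κ hq f * g + Disc.twist κ hq f * del κ hq g ∧
    delBar κ hq (f * g) = delBar κ hq f * g + Disc.twist κ hq f * delBar κ hq g := by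
  rw [← oneForm_inj hq, ← d_ofDisc, d_ofDisc_mul, d_ofDisc, d_ofDisc, oneForm_mul_ofDisc,
    ofDisc_mul_oneForm hq, oneForm_add]

lemma del_mul (hq : 0 < q) (f g : Disc q κ) :
    del κ hq (f * g) = del κ hq f * g + Disc.twist κ hq f * del κ hq g :=
  (del_mul_and_delBar_mul hq f g).1

lemma delBar_mul (hq : 0 < q) (f g : Disc q κ) :
    delBar κ hq (f * g) = delBar κ hq f * g + Disc.twist κ hq f * delBar κ hq g :=
  (del_mul_and_delBar_mul hq f g).2

/-- Up to `normalElt` the partial derivative is the commutator with `z*`: both are twisted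
derivations, and they agree on generators. In particular a function with zero derivative commutes
with `z*`. -/
lemma normalElt_mul_del (hq : 0 < q) (f : Disc q κ) :
    Disc.normalElt q κ * del κ hq f = Disc.zs q κ * f - f * Disc.zs q κ := by
  induction f using Disc.induction_on with
  | hz => rw [del_z, mul_one, Disc.normalElt_eq hq]
  | hzs => simp [del_zs]
  | hc c => simp [del_algebraMap, Algebra.commutes]
  | hadd f g hf hg => rw [del_add, mul_add, hf, hg]; noncomm_ring
  | hmul f g hf hg =>
    rw [del_mul, mul_add, ← mul_assoc, hf, ← mul_assoc, ← Disc.mul_normalElt, mul_assoc f, hg]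
    noncomm_ring

/-- The companion statement, with the commutator with `z` of opposite sign. -/
lemma normalElt_mul_delBar (hq : 0 < q) (f : Disc q κ) :
    Disc.normalElt q κ * delBar κ hq f = f * Disc.z q κ - Disc.z q κ * f := by
  induction f using Disc.induction_on with
  | hz => simp [delBar_z]
  | hzs => rw [delBar_zs, mul_one, Disc.normalElt_eq hq]
  | hc c => simp [delBar_algebraMap, Algebra.commutes]
  | hadd f g hf hg => rw [delBar_add, mul_add, hf, hg]; noncomm_ring
  | hmul f g hf hg =>
    rw [delBar_mul, mul_add, ← mul_assoc, hf, ← mul_assoc, ← Disc.mul_normalElt, mul_assoc f, hg]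
    noncomm_ring

/-- The calculus on the quantum disc is connected. -/
lemma exists_eq_algebraMap_of_d_eq_zero (hq : 0 < q) (hκ : κ ≠ 0) {f : Disc q κ}
    (hf : d κ hq (ofDisc q κ f) = 0) : ∃ c : ℂ, f = algebraMap ℂ _ c := by
  have h1 : del κ hq f = 0 := by simp [del, hf]
  have h2 : delBar κ hq f = 0 := by simp [delBar, hf]
  have h3 := normalElt_mul_del hq f
  have h4 := normalElt_mul_delBar hq f
  rw [h1, mul_zero] at h3
  rw [h2, mul_zero] at h4
  exact Disc.exists_eq_algebraMap_of_commute hq hκ (sub_eq_zero.1 h4.symm).symm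
    (sub_eq_zero.1 h3.symm)

/-- `dz` carries weight `1`, so its coefficient in `df` has weight one less than `f`. -/
lemma del_scale (hq : 0 < q) (u : ℂˣ) (f : Disc q κ) :
    del κ hq (Disc.scale q κ u f) = (u : ℂ) • Disc.scale q κ u (del κ hq f) := by
  induction f using Disc.induction_on with
  | hz => simp [del_smul, del_z]
  | hzs => simp [del_smul, del_zs]
  | hc c => simp [del_algebraMap]
  | hadd f g hf hg => simp only [map_add, del_add, hf, hg, smul_add]
  | hmul f g hf hg =>
    simp only [map_mul, del_mul, hf, hg, map_add, smul_add, Disc.scale_twist, smul_mul_assoc,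
      mul_smul_comm]

lemma delBar_scale (hq : 0 < q) (u : ℂˣ) (f : Disc q κ) :
    delBar κ hq (Disc.scale q κ u f) = (u : ℂ)⁻¹ • Disc.scale q κ u (delBar κ hq f) := by
  induction f using Disc.induction_on with
  | hz => simp [delBar_smul, delBar_z]
  | hzs => simp [delBar_smul, delBar_zs]
  | hc c => simp [delBar_algebraMap]
  | hadd f g hf hg => simp only [map_add, delBar_add, hf, hg, smul_add]
  | hmul f g hf hg =>
    simp only [map_mul, delBar_mul, hf, hg, map_add, smul_add, Disc.scale_twist, smul_mul_assoc,
      mul_smul_comm]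

lemma del_mem_weight (hq : 0 < q) {u : ℂˣ} {f : Disc q κ} (hf : f ∈ Disc.weight q κ u 0) :
    del κ hq f ∈ Disc.weight q κ u (-1) := by
  have h := del_scale hq u f
  rw [Disc.mem_weight] at hf ⊢
  rw [hf, zpow_zero, Units.val_one, one_smul] at h
  rw [h, smul_smul]
  simp [← h]

lemma delBar_mem_weight (hq : 0 < q) {u : ℂˣ} {f : Disc q κ} (hf : f ∈ Disc.weight q κ u 0) :
    delBar κ hq f ∈ Disc.weight q κ u 1 := by
  have h := delBar_scale hq u f
  rw [Disc.mem_weight] at hf ⊢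
  rw [hf, zpow_zero, Units.val_one, one_smul] at h
  rw [h, smul_smul]
  simp [← h]

lemma del_x (hq : 0 < q) : del κ hq (Disc.x q κ) = Disc.zs q κ := by
  simp [Disc.x, del_mul, del_z, del_zs]

lemma delBar_x (hq : 0 < q) : delBar κ hq (Disc.x q κ) = (q : ℂ)⁻¹ • Disc.z q κ := by
  simp [Disc.x, delBar_mul, delBar_z, delBar_zs]

/-- The constant is `1 + q⁻¹ + ⋯ + q⁻ⁿ`. Only its positivity is used, to divide by it. -/
lemma exists_d_z_pow (hq : 0 < q) (n : ℕ) : ∃ c : ℝ, 0 < c ∧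
    d κ hq (ofDisc q κ (Disc.z q κ ^ (n + 1))) = oneForm ((c : ℂ) • Disc.z q κ ^ n) 0 := by
  suffices h : ∃ c : ℝ, 0 < c ∧ del κ hq (Disc.z q κ ^ (n + 1)) = (c : ℂ) • Disc.z q κ ^ n ∧
      delBar κ hq (Disc.z q κ ^ (n + 1)) = 0 by
    obtain ⟨c, hc, h1, h2⟩ := h
    exact ⟨c, hc, by rw [d_ofDisc, h1, h2]⟩
  induction n with
  | zero => exact ⟨1, one_pos, by simp [del_z], by simp [delBar_z]⟩
  | succ n ih =>
    obtain ⟨c, hc, h1, h2⟩ := ih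
    refine ⟨1 + q⁻¹ * c, by positivity, ?_, ?_⟩
    · rw [pow_succ' _ (n + 1), del_mul, h1, del_z, Disc.twist_z, smul_mul_smul_comm, ← pow_succ',
        one_mul]
      push_cast
      module
    · rw [pow_succ' _ (n + 1), delBar_mul, h2, delBar_z]
      simp

lemma exists_d_zs_pow (hq : 0 < q) (n : ℕ) : ∃ c : ℝ, 0 < c ∧
    d κ hq (ofDisc q κ (Disc.zs q κ ^ (n + 1))) = oneForm 0 ((c : ℂ) • Disc.zs q κ ^ n) := by
  suffices h : ∃ c : ℝ, 0 < c ∧ del κ hq (Disc.zs q κ ^ (n + 1)) = 0 ∧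
      delBar κ hq (Disc.zs q κ ^ (n + 1)) = (c : ℂ) • Disc.zs q κ ^ n by
    obtain ⟨c, hc, h1, h2⟩ := h
    exact ⟨c, hc, by rw [d_ofDisc, h1, h2]⟩
  induction n with
  | zero => exact ⟨1, one_pos, by simp [del_zs], by simp [delBar_zs]⟩
  | succ n ih =>
    obtain ⟨c, hc, h1, h2⟩ := ih
    refine ⟨1 + q * c, by positivity, ?_, ?_⟩
    · rw [pow_succ' _ (n + 1), del_mul, h1, del_zs]
      simp
    · rw [pow_succ' _ (n + 1), delBar_mul, h2, delBar_zs, Disc.twist_zs, smul_mul_smul_comm,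
        ← pow_succ', one_mul]
      push_cast
      module

end DiscForms

end

/-! ### Integrability of two-dimensional calculi -/

namespace DifferentialCalculus

variable {A : Type} [Ring A] [Algebra ℂ A] (Γ : DifferentialCalculus A)

lemma exists_eq_ι {ω : Γ.E} (hω : ω ∈ Γ.forms 0) : ∃ a, ω = Γ.ι a := by
  have h : Γ.forms 0 ≤ LinearMap.range Γ.ι.toLinearMap := by
    refine Submodule.span_le.2 ?_
    rintro _ ⟨a, l, hl, rfl⟩
    rw [List.length_eq_zero_iff] at hl
    subst hl
    exact ⟨a, by simp⟩
  obtain ⟨a, ha⟩ := h hω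
  exact ⟨a, ha.symm⟩

variable {Γ}

/-- The map `ω ↦ (η ↦ (-1)ᵏ π(ω ∧ η))` from `k`-forms to integral `m`-forms, where `π` is a right
linear map on the forms of top degree `n = k + m`. -/
def pairing {n : ℕ} (π : Γ.forms n →ₗ[ℂ] A) (hπ : ∀ ω a, π (rsmul ω a) = π ω * a) (k m : ℕ)
    (h : k + m = n) : Γ.forms k →ₗ[ℂ] Γ.integralForms m where
  toFun ω :=
    ⟨{ toFun := fun η => (-1 : ℂ) ^ k • π ⟨ω * η, h ▸ Γ.mul_mem_forms ω.2 η.2⟩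
       map_add' := fun η ξ => by
        rw [← smul_add, ← map_add]
        congr 2
        exact Subtype.ext (mul_add _ _ _)
       map_smul' := fun c η => by
        rw [RingHom.id_apply, smul_comm c, ← map_smul π c]
        congr 2
        exact Subtype.ext (mul_smul_comm _ _ _) }, fun η a => by
        change (-1 : ℂ) ^ k • π _ = ((-1 : ℂ) ^ k • π _) * a
        rw [smul_mul_assoc, ← hπ]
        congr 2
        exact Subtype.ext (mul_assoc _ _ _).symm⟩
  map_add' ω ω' := by
    refine Subtype.ext (LinearMap.ext fun η => ?_)
    change (-1 : ℂ) ^ k • π _ = (-1 : ℂ) ^ k • π _ + (-1 : ℂ) ^ k • π _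
    rw [← smul_add, ← map_add]
    congr 2
    exact Subtype.ext (add_mul _ _ _)
  map_smul' c ω := by
    refine Subtype.ext (LinearMap.ext fun η => ?_)
    change (-1 : ℂ) ^ k • π _ = c • ((-1 : ℂ) ^ k • π _)
    rw [smul_comm c, ← map_smul π c]
    congr 2
    exact Subtype.ext (smul_mul_assoc _ _ _)

lemma pairing_apply {n : ℕ} (π : Γ.forms n →ₗ[ℂ] A) (hπ : ∀ ω a, π (rsmul ω a) = π ω * a)
    (k m : ℕ) (h : k + m = n) (ω : Γ.forms k) (η : Γ.forms m) (ξ : Γ.forms n)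
    (hξ : (ξ : Γ.E) = ω * η) : (pairing π hπ k m h ω).1 η = (-1 : ℂ) ^ k • π ξ := by
  change (-1 : ℂ) ^ k • π _ = _
  congr 2
  exact Subtype.ext hξ.symm

variable (Γ)

variable {Γ} in
/-- The product of one-forms. -/
def wedgeOne (ω η : Γ.forms 1) : Γ.forms 2 :=
  ⟨ω * η, Γ.mul_mem_forms (m := 1) (n := 1) ω.2 η.2⟩

variable {Γ} in
/-- The differential on one-forms. -/
def dOne : Γ.forms 1 →ₗ[ℂ] Γ.forms 2 where
  toFun ω := dForm ω
  map_add' _ _ := Subtype.ext (map_add _ _ _)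
  map_smul' _ _ := Subtype.ext (map_smul _ _ _)

/-- Besides the perfect pairing in degree `(1, 1)`, the case `(0, 2)` holds because two-forms are
free on the preimage of `1` under `π`, and the case `(2, 0)` because a right linear map on `A` is
determined by its value at `1`. -/
lemma pairing_bijective (π : Γ.forms 2 ≃ₗ[ℂ] A) (ν : A ≃ₐ[ℂ] A)
    (hr : ∀ ω a, (π : Γ.forms 2 →ₗ[ℂ] A) (rsmul ω a) = (π : Γ.forms 2 →ₗ[ℂ] A) ω * a)
    (hl : ∀ a ω, π (lsmul a ω) = ν a * π ω)
    (hinj : ∀ ω : Γ.forms 1, (∀ η : Γ.forms 1, π (wedgeOne ω η) = 0) → ω = 0)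
    (hsurj : ∀ φ : Γ.integralForms 1, ∃ ω : Γ.forms 1, ∀ η, φ.1 η = π (wedgeOne ω η))
    (k m : ℕ) (h : k + m = 2) :
    Function.Bijective (pairing (π : Γ.forms 2 →ₗ[ℂ] A) hr k m h) := by
  have hker : (∀ ω, pairing (π : Γ.forms 2 →ₗ[ℂ] A) hr k m h ω = 0 → ω = 0) →
      Function.Injective (pairing (π : Γ.forms 2 →ₗ[ℂ] A) hr k m h) :=
    (injective_iff_map_eq_zero _).2
  obtain ⟨rfl, rfl⟩ | ⟨rfl, rfl⟩ | ⟨rfl, rfl⟩ :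
      (k = 0 ∧ m = 2) ∨ (k = 1 ∧ m = 1) ∨ (k = 2 ∧ m = 0) := by omega
  · have hgen (η : Γ.forms 2) : rsmul (π.symm 1) (π η) = η := by
      apply π.injective
      exact (hr _ _).trans (by simp)
    refine ⟨hker fun ω hω => ?_, fun φ => ?_⟩
    · obtain ⟨f, hf⟩ := Γ.exists_eq_ι ω.2
      have h1 := pairing_apply (π : Γ.forms 2 →ₗ[ℂ] A) hr 0 2 h ω (π.symm 1)
        (lsmul f (π.symm 1)) (by rw [hf]; rfl)
      rw [hω] at h1
      simp only [pow_zero, one_smul, LinearEquiv.coe_coe, hl, LinearEquiv.apply_symm_apply,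
        mul_one] at h1
      have h2 : f = 0 := (map_eq_zero_iff ν ν.injective).1 h1.symm
      exact Subtype.ext (by rw [hf, h2, map_zero]; rfl)
    · refine ⟨⟨Γ.ι (ν.symm (φ.1 (π.symm 1))), Γ.ι_mem_forms _⟩,
        Subtype.ext (LinearMap.ext fun η => ?_)⟩
      rw [pairing_apply (π : Γ.forms 2 →ₗ[ℂ] A) hr 0 2 h _ η
        (lsmul (ν.symm (φ.1 (π.symm 1))) η) rfl]
      simp only [pow_zero, one_smul, LinearEquiv.coe_coe, hl, AlgEquiv.apply_symm_apply]
      rw [← φ.2, hgen]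
  · refine ⟨hker fun ω hω => hinj ω fun η => ?_, fun φ => ?_⟩
    · have h1 := pairing_apply (π : Γ.forms 2 →ₗ[ℂ] A) hr 1 1 h ω η (wedgeOne ω η) rfl
      rw [hω] at h1
      simpa using h1
    · obtain ⟨ω, hω⟩ := hsurj φ
      -- The sign compensates the factor `(-1)ᵏ` at `k = 1` in the pairing.
      refine ⟨-ω, Subtype.ext (LinearMap.ext fun η => ?_)⟩
      rw [map_neg]
      change -(pairing (π : Γ.forms 2 →ₗ[ℂ] A) hr 1 1 h ω).1 η = _
      rw [pairing_apply (π : Γ.forms 2 →ₗ[ℂ] A) hr 1 1 h ω η (wedgeOne ω η) rfl, hω]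
      simp
  · refine ⟨hker fun ω hω => ?_, fun φ => ?_⟩
    · have h1 := pairing_apply (π : Γ.forms 2 →ₗ[ℂ] A) hr 2 0 h ω ⟨Γ.ι 1, Γ.ι_mem_forms 1⟩ ω
        (by simp)
      rw [hω] at h1
      simpa using h1.symm
    · refine ⟨π.symm (φ.1 ⟨Γ.ι 1, Γ.ι_mem_forms 1⟩), Subtype.ext (LinearMap.ext fun η => ?_)⟩
      obtain ⟨b, hb⟩ := Γ.exists_eq_ι η.2
      have h1 : η = rsmul ⟨Γ.ι 1, Γ.ι_mem_forms 1⟩ b := by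
        refine Subtype.ext ?_
        change _ = Γ.ι 1 * Γ.ι b
        rw [map_one, one_mul, hb]
      rw [pairing_apply (π : Γ.forms 2 →ₗ[ℂ] A) hr 2 0 h _ η
        (rsmul (π.symm (φ.1 ⟨Γ.ι 1, Γ.ι_mem_forms 1⟩)) b) (by rw [hb]; rfl)]
      rw [h1, φ.2]
      rw [hr]
      simp

/-- A two-dimensional calculus with a volume form which is free as a generator of the right module
of two-forms, and such that the product of one-forms is a perfect pairing, is integrable. -/
theorem isIntegrable_two_of_perfect_pairing (hdim : Γ.HasDimension 2) (π : Γ.forms 2 ≃ₗ[ℂ] A)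
    (ν : A ≃ₐ[ℂ] A) (hr : ∀ ω a, π (rsmul ω a) = π ω * a) (hl : ∀ a ω, π (lsmul a ω) = ν a * π ω)
    (hinj : ∀ ω : Γ.forms 1, (∀ η : Γ.forms 1, π (wedgeOne ω η) = 0) → ω = 0)
    (hsurj : ∀ φ : Γ.integralForms 1, ∃ ω : Γ.forms 1, ∀ η, φ.1 η = π (wedgeOne ω η)) :
    Γ.IsIntegrable 2 := by
  have hr' : ∀ ω a, (π : Γ.forms 2 →ₗ[ℂ] A) (rsmul ω a) = (π : Γ.forms 2 →ₗ[ℂ] A) ω * a := hr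
  obtain ⟨Θ, hΘ_apply⟩ : ∃ Θ : ∀ k m : ℕ, k + m = 2 → (Γ.forms k ≃ₗ[ℂ] Γ.integralForms m),
      ∀ (k m : ℕ) (h : k + m = 2) (ω : Γ.forms k) (η : Γ.forms m) (ξ : Γ.forms 2),
        (ξ : Γ.E) = ω * η → (Θ k m h ω).1 η = (-1 : ℂ) ^ k • π ξ :=
    ⟨fun k m h => LinearEquiv.ofBijective _ (Γ.pairing_bijective π ν hr' hl hinj hsurj k m h),
      fun k m h ω η ξ hξ => pairing_apply (π : Γ.forms 2 →ₗ[ℂ] A) hr' k m h ω η ξ hξ⟩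
  have hbi (k m : ℕ) (h : k + m = 2) (a b : A) (ω : Γ.forms k) :
      Θ k m h (lsmul a (rsmul ω b)) = integralBismul (ν a) (Θ k m h ω) b := by
    refine Subtype.ext (LinearMap.ext fun η => ?_)
    change _ = ν a * (Θ k m h ω).1 (lsmul b η)
    have hmem : ((ω : Γ.E) * lsmul b η) ∈ Γ.forms 2 := h ▸ Γ.mul_mem_forms ω.2 (lsmul b η).2
    rw [hΘ_apply k m h ω (lsmul b η) ⟨_, hmem⟩ rfl,
      hΘ_apply k m h _ η (lsmul a ⟨_, hmem⟩)]
    · rw [hl, mul_smul_comm]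
    · change Γ.ι a * (ω * (Γ.ι b * η)) = Γ.ι a * (ω * Γ.ι b) * η
      simp only [mul_assoc]
  -- The divergence is forced: it must correspond to `d` on one-forms. Its Leibniz rule is `d(ω a) =
  -- dω a - ω ∧ da`, the minus sign being absorbed by that of `Θ` in degree one.
  let D : Γ.Divergence :=
    { toLinearMap := (π : Γ.forms 2 →ₗ[ℂ] A) ∘ₗ dOne ∘ₗ (Θ 1 1 rfl).symm
      leibniz := fun φ a => by
        obtain ⟨ω, rfl⟩ := (Θ 1 1 rfl).surjective φ
        have h1 : integralBismul 1 (Θ 1 1 rfl ω) a = Θ 1 1 rfl (rsmul ω a) := by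
          have := hbi 1 1 rfl 1 a ω
          rw [map_one] at this
          rw [← this]
          congr 1
          refine Subtype.ext ?_
          change Γ.ι 1 * _ = _
          rw [map_one, one_mul]
        have h2 : dOne (rsmul ω a) = rsmul (dOne ω) a - wedgeOne ω (Γ.dAlg a) := by
          refine Subtype.ext ?_
          have := Γ.leibniz 1 0 _ ω.2 _ (Γ.ι_mem_forms a)
          rw [pow_one, neg_one_smul, ← sub_eq_add_neg] at this
          exact this
        change π (dOne ((Θ 1 1 rfl).symm (integralBismul 1 (Θ 1 1 rfl ω) a))) =
          π (dOne ((Θ 1 1 rfl).symm (Θ 1 1 rfl ω))) * a + (Θ 1 1 rfl ω).1 (Γ.dAlg a)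
        rw [h1, LinearEquiv.symm_apply_apply, LinearEquiv.symm_apply_apply, h2,
          hΘ_apply 1 1 rfl ω (Γ.dAlg a) (wedgeOne ω (Γ.dAlg a)) rfl, ← hr]
        have h3 := map_sub π (rsmul (dOne ω) a) (wedgeOne ω (Γ.dAlg a))
        rw [pow_one, neg_one_smul, ← sub_eq_add_neg]
        exact h3 }
  have hD (ω : Γ.forms 1) : D.toLinearMap (Θ 1 1 rfl ω) = π (dOne ω) := by
    change π (dOne ((Θ 1 1 rfl).symm (Θ 1 1 rfl ω))) = _
    rw [LinearEquiv.symm_apply_apply]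
  have h01 (ω : Γ.forms 0) : Θ 1 1 rfl (dForm ω) = D.extend 1 (Θ 0 2 rfl ω) := by
    refine Subtype.ext (LinearMap.ext fun η => ?_)
    have hωη : (ω : Γ.E) * η ∈ Γ.forms 1 := by simpa using Γ.mul_mem_forms ω.2 η.2
    have hdη : (ω : Γ.E) * Γ.d η ∈ Γ.forms 2 := by
      simpa using Γ.mul_mem_forms ω.2 (Γ.d_mem_forms η.2)
    -- Moving `η` into the argument passes from `Θ` in degree `0` to degree `1`, which changes the
    -- sign.
    have h1 : integralAct (m := 1) (n := 1) (Θ 0 2 rfl ω) η = -Θ 1 1 rfl ⟨_, hωη⟩ := by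
      refine Subtype.ext (LinearMap.ext fun ξ => ?_)
      have hmem : (ω : Γ.E) * (η * ξ) ∈ Γ.forms 2 := by
        rw [← mul_assoc]; exact Γ.mul_mem_forms (m := 1) (n := 1) hωη ξ.2
      change (Θ 0 2 rfl ω).1 (wedgeOne η ξ) = -(Θ 1 1 rfl ⟨_, hωη⟩).1 ξ
      rw [hΘ_apply 0 2 rfl ω (wedgeOne η ξ) ⟨_, hmem⟩ rfl,
        hΘ_apply 1 1 rfl ⟨_, hωη⟩ ξ ⟨_, hmem⟩ (mul_assoc _ _ _).symm]
      simp
    have h2 : dOne (⟨_, hωη⟩ : Γ.forms 1) = wedgeOne (dForm ω) η + ⟨_, hdη⟩ := by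
      refine Subtype.ext ?_
      have := Γ.leibniz 0 1 _ ω.2 _ η.2
      rw [pow_zero, one_smul] at this
      exact this
    change (Θ 1 1 rfl (dForm ω)).1 η = D.toLinearMap (integralAct (m := 1) (n := 1) (Θ 0 2 rfl ω) η) +
      (-1 : ℂ) ^ (1 + 1) • (Θ 0 2 rfl ω).1 (dForm η)
    have h4 := LinearMap.map_neg D.toLinearMap (Θ 1 1 rfl ⟨_, hωη⟩)
    rw [h1, h4, hD, hΘ_apply 1 1 rfl (dForm ω) η (wedgeOne (dForm ω) η) rfl, h2,
      hΘ_apply 0 2 rfl ω (dForm η) ⟨_, hdη⟩ rfl]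
    have h3 := map_add π (wedgeOne (dForm ω) η) ⟨_, hdη⟩
    simp only [pow_one, neg_one_smul, pow_zero, one_smul, Nat.reduceAdd, even_two, Even.neg_pow,
      one_pow]
    erw [h3]
    abel
  refine ⟨hdim, D, ν, Θ, ?_, hbi, ?_⟩
  · intro φ
    -- Every integral two-form comes from a function, so flatness is `d ∘ d = 0` on functions.
    obtain ⟨ω, rfl⟩ := (Θ 0 2 rfl).surjective φ
    rw [← h01, hD]
    have h0 : dOne (dForm ω) = 0 := Subtype.ext (Γ.d_d 0 _ ω.2)
    rw [h0]
    exact map_zero π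
  · intro k m h h' ω
    obtain ⟨rfl, rfl⟩ | ⟨rfl, rfl⟩ : (k = 0 ∧ m = 1) ∨ (k = 1 ∧ m = 0) := by omega
    · exact h01 ω
    · refine Subtype.ext (LinearMap.ext fun η => ?_)
      obtain ⟨b, hb⟩ := Γ.exists_eq_ι η.2
      have h1 : integralAct (m := 0) (n := 1) (Θ 1 1 rfl ω) η =
          Θ 1 1 rfl (rsmul ω b) := by
        refine Subtype.ext (LinearMap.ext fun ξ => ?_)
        have hmem : (ω : Γ.E) * (η * ξ) ∈ Γ.forms 2 := by
          have := Γ.mul_mem_forms ω.2 (Γ.mul_mem_forms η.2 ξ.2)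
          simpa using this
        change (Θ 1 1 rfl ω).1 (wedge η ξ : Γ.forms (0 + 1)) = (Θ 1 1 rfl (rsmul ω b)).1 ξ
        have e1 := hΘ_apply 1 1 rfl ω (wedge η ξ : Γ.forms (0 + 1)) ⟨_, hmem⟩ rfl
        have e2 := hΘ_apply 1 1 rfl (rsmul ω b) ξ ⟨_, hmem⟩ (by
          change (ω : Γ.E) * (η * ξ) = ω * Γ.ι b * ξ
          rw [hb, mul_assoc])
        exact e1.trans e2.symm
      have h2 : dOne (rsmul ω b) = rsmul (dOne ω) b - wedgeOne ω (Γ.dAlg b) := by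
        refine Subtype.ext ?_
        have := Γ.leibniz 1 0 _ ω.2 _ (Γ.ι_mem_forms b)
        rw [pow_one, neg_one_smul, ← sub_eq_add_neg] at this
        exact this
      change (Θ 2 0 rfl (dForm ω)).1 η =
        D.toLinearMap (integralAct (m := 0) (n := 1) (Θ 1 1 rfl ω) η) +
        (-1 : ℂ) ^ (0 + 1) • (Θ 1 1 rfl ω).1 (dForm η : Γ.forms (0 + 1))
      have e1 := hΘ_apply 1 1 rfl ω (dForm η : Γ.forms (0 + 1)) (wedgeOne ω (Γ.dAlg b)) (by
        change (ω : Γ.E) * Γ.d (Γ.ι b) = ω * Γ.d η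
        rw [hb])
      have e2 := hΘ_apply 2 0 rfl (dForm ω) η (rsmul (dOne ω) b) (by rw [hb]; rfl)
      have e3 := map_sub π (rsmul (dOne ω) b) (wedgeOne ω (Γ.dAlg b))
      refine e2.trans ?_
      rw [h1, hD, h2]
      erw [e1, e3]
      simp

end DifferentialCalculus

/-! ### Growth of the quantum cone -/

section WordSpan

variable {A : Type} [Ring A] [Algebra ℂ A] {S : Finset A}

lemma wordSpan_mono {m n : ℕ} (h : m ≤ n) : wordSpan S m ≤ wordSpan S n := by
  refine Submodule.span_mono ?_
  rintro _ ⟨l, hl, hS, rfl⟩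
  exact ⟨l, hl.trans h, hS, rfl⟩

lemma one_mem_wordSpan (n : ℕ) : (1 : A) ∈ wordSpan S n :=
  Submodule.subset_span ⟨[], by simp, by simp, by simp⟩

lemma subset_wordSpan_one {x : A} (hx : x ∈ S) : x ∈ wordSpan S 1 :=
  Submodule.subset_span ⟨[x], by simp, by simpa using hx, by simp⟩

lemma mul_mem_wordSpan {m n : ℕ} {x y : A} (hx : x ∈ wordSpan S m) (hy : y ∈ wordSpan S n) :
    x * y ∈ wordSpan S (m + n) := by
  have h : wordSpan S m * wordSpan S n ≤ wordSpan S (m + n) := by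
    rw [wordSpan, wordSpan, Submodule.span_mul_span, Submodule.span_le]
    rintro _ ⟨_, ⟨l, hl, hlS, rfl⟩, _, ⟨l', hl', hlS', rfl⟩, rfl⟩
    refine Submodule.subset_span ⟨l ++ l', ?_, ?_, by simp⟩
    · rw [List.length_append]; omega
    · intro y hy
      rcases List.mem_append.1 hy with h | h
      · exact hlS y h
      · exact hlS' y h
  exact h (Submodule.mul_mem_mul hx hy)

lemma pow_mem_wordSpan {m : ℕ} {x : A} (hx : x ∈ wordSpan S m) (i : ℕ) :
    x ^ i ∈ wordSpan S (m * i) := by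
  induction i with
  | zero => simpa using one_mem_wordSpan 0
  | succ i ih => rw [pow_succ, mul_add_one]; exact mul_mem_wordSpan ih hx

lemma exists_mem_wordSpan (hS : Algebra.adjoin ℂ (S : Set A) = ⊤) (x : A) :
    ∃ n, x ∈ wordSpan S n := by
  have hx : x ∈ Algebra.adjoin ℂ (S : Set A) := hS ▸ Algebra.mem_top
  induction hx using Algebra.adjoin_induction with
  | mem x hx => exact ⟨1, subset_wordSpan_one hx⟩
  | algebraMap c =>
    rw [Algebra.algebraMap_eq_smul_one]
    exact ⟨0, Submodule.smul_mem _ _ (one_mem_wordSpan 0)⟩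
  | add x y _ _ hx hy =>
    obtain ⟨m, hm⟩ := hx
    obtain ⟨n, hn⟩ := hy
    exact ⟨m + n, add_mem (wordSpan_mono (by omega) hm) (wordSpan_mono (by omega) hn)⟩
  | mul x y _ _ hx hy =>
    obtain ⟨m, hm⟩ := hx
    obtain ⟨n, hn⟩ := hy
    exact ⟨m + n, mul_mem_wordSpan hm hn⟩

lemma wordSpan_le {G : ℕ → Submodule ℂ A} (hG : Monotone G) (h1 : 1 ∈ G 0)
    (hmul : ∀ {n : ℕ} {s f : A}, s ∈ S → f ∈ G n → s * f ∈ G (n + 1)) (n : ℕ) :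
    wordSpan S n ≤ G n := by
  refine Submodule.span_le.2 ?_
  rintro _ ⟨l, hl, hS, rfl⟩
  refine hG hl ?_
  clear hl
  induction l with
  | nil => simpa using h1
  | cons y l ih =>
    rw [List.prod_cons]
    exact hmul (hS y (by simp)) (ih fun w hw => hS w (by simp [hw]))

/-- An algebra map distorts word lengths at most linearly. -/
lemma exists_map_wordSpan_le {B : Type} [Ring B] [Algebra ℂ B] {T : Finset B}
    (hT : Algebra.adjoin ℂ (T : Set B) = ⊤) (F : A →ₐ[ℂ] B) (S : Finset A) :
    ∃ M : ℕ, ∀ n, (wordSpan S n).map F.toLinearMap ≤ wordSpan T (M * n) := by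
  choose g hg using fun x => exists_mem_wordSpan hT (F x)
  -- The factor is the largest word length needed for the image of one generator.
  refine ⟨S.sup g, fun n => ?_⟩
  rw [wordSpan, Submodule.map_span, Submodule.span_le]
  rintro _ ⟨_, ⟨l, hl, hS, rfl⟩, rfl⟩
  have h : ∀ l : List A, (∀ y ∈ l, y ∈ S) → F l.prod ∈ wordSpan T (S.sup g * l.length) := by
    intro l hl
    induction l with
    | nil => simpa using one_mem_wordSpan 0
    | cons y l ih =>
      rw [List.prod_cons, map_mul, List.length_cons, mul_add_one, add_comm]
      exact mul_mem_wordSpan (wordSpan_mono (Finset.le_sup (hl y (by simp))) (hg y))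
        (ih fun w hw => hl w (by simp [hw]))
  exact wordSpan_mono (Nat.mul_le_mul_left _ hl) (h l hS)

/-- Quadratic growth gives growth exponent two. -/
lemma growthExponent_eq_two {M M' : ℕ}
    (hupper : ∀ n, Module.finrank ℂ (wordSpan S n) ≤ (M * n + 1) ^ 2)
    (hlower : ∀ n, (n + 1) ^ 2 ≤ Module.finrank ℂ (wordSpan S ((M' + 1) * n))) :
    growthExponent S = 2 := by
  have hpow (e : ℝ) (he : 0 < e) (c : ℝ) : ∀ᶠ n : ℕ in Filter.atTop, c ≤ (n : ℝ) ^ e :=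
    ((tendsto_rpow_atTop he).comp tendsto_natCast_atTop_atTop).eventually_ge_atTop c
  refine le_antisymm (le_of_forall_gt_imp_ge_of_dense fun r hr => ?_) (le_sInf ?_)
  · induction r using ENNReal.recTopCoe with
    | top => exact le_top
    | coe ν =>
      have hν : (2 : ℝ) < ν := by exact_mod_cast hr
      refine sInf_le ⟨ν, rfl, ?_⟩
      -- For `ν > 2` the surplus power `n^(ν-2)` eventually beats the constant `(M + 1)²`.
      filter_upwards [hpow (ν - 2) (by linarith) ((M + 1) ^ 2), Filter.eventually_ge_atTop 1]
        with n hn hn1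
      have hn1' : (1 : ℝ) ≤ n := by exact_mod_cast hn1
      have h1 : (Module.finrank ℂ (wordSpan S n) : ℝ) ≤ (M * n + 1) ^ 2 := by
        exact_mod_cast hupper n
      calc (Module.finrank ℂ (wordSpan S n) : ℝ) ≤ (M * n + 1) ^ 2 := h1
        _ ≤ ((M + 1) * n) ^ 2 := by gcongr; linarith
        _ = (M + 1) ^ 2 * (n : ℝ) ^ 2 := by ring
        _ ≤ (n : ℝ) ^ ((ν : ℝ) - 2) * (n : ℝ) ^ 2 := by gcongr
        _ = (n : ℝ) ^ (ν : ℝ) := by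
          rw [← Real.rpow_natCast, ← Real.rpow_add (by linarith)]
          norm_num
  · rintro _ ⟨ν, rfl, h⟩
    by_contra hν
    have hν' : (ν : ℝ) < 2 := by exact_mod_cast not_le.1 hν
    -- The lower bound is known only along multiples of `M' + 1`; the successor keeps the factor
    -- positive, so this subsequence is unbounded. An exponent below `2` is refuted there.
    have ht : Filter.Tendsto (fun n : ℕ => (M' + 1) * n) Filter.atTop Filter.atTop :=
      Filter.tendsto_id.const_mul_atTop' (Nat.succ_pos M')
    obtain ⟨n, h1, h2, h3⟩ := ((ht.eventually h).and
      ((hpow (2 - ν) (by linarith) ((M' + 1 : ℝ) ^ (ν : ℝ) + 1)).and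
        (Filter.eventually_ge_atTop 1))).exists
    have hn0 : (0 : ℝ) < n := by exact_mod_cast h3
    have h4 : ((n : ℝ) + 1) ^ 2 ≤ ((M' + 1 : ℝ) * n) ^ (ν : ℝ) := by
      refine le_trans ?_ (h1.trans_eq (by push_cast; rfl))
      exact_mod_cast hlower n
    rw [Real.mul_rpow (by positivity) hn0.le] at h4
    have h5 : (n : ℝ) ^ 2 = (n : ℝ) ^ (2 - (ν : ℝ)) * (n : ℝ) ^ (ν : ℝ) := by
      rw [← Real.rpow_natCast, ← Real.rpow_add hn0]
      norm_num
    have h6 : 0 < (n : ℝ) ^ (ν : ℝ) := Real.rpow_pos_of_pos hn0 _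
    nlinarith

end WordSpan

/-! ### Upper growth bound from ordered monomials -/

namespace Disc

variable {q κ : ℝ}

variable (q κ) in
/-- The generating set `{z, z*}`. -/
def gens : Finset (Disc q κ) := (Set.toFinite {z q κ, zs q κ}).toFinset

lemma adjoin_gens : Algebra.adjoin ℂ (gens q κ : Set (Disc q κ)) = ⊤ := by
  simp [gens, adjoin_eq_top]

variable (q κ) in
/-- The span of the monomials `z^i z*^j` with `i, j ≤ n`. -/
def monomialSpan (n : ℕ) : Submodule ℂ (Disc q κ) :=
  Submodule.span ℂ (Set.range fun p : Fin (n + 1) × Fin (n + 1) =>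
    z q κ ^ (p.1 : ℕ) * zs q κ ^ (p.2 : ℕ))

instance (n : ℕ) : Module.Finite ℂ (monomialSpan q κ n) :=
  Module.Finite.span_of_finite ℂ (Set.finite_range _)

lemma finrank_monomialSpan_le (n : ℕ) :
    Module.finrank ℂ (monomialSpan q κ n) ≤ (n + 1) ^ 2 := by
  refine (finrank_range_le_card _).trans ?_
  simp [sq]

lemma mem_monomialSpan {n i j : ℕ} (hi : i ≤ n) (hj : j ≤ n) :
    z q κ ^ i * zs q κ ^ j ∈ monomialSpan q κ n :=
  Submodule.subset_span ⟨(⟨i, by omega⟩, ⟨j, by omega⟩), rfl⟩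

lemma zs_mul_z_pow (hq : 0 < q) (i : ℕ) : zs q κ * z q κ ^ (i + 1) =
    (q : ℂ) ^ (i + 1) • (z q κ ^ (i + 1) * zs q κ) +
      ((κ * qInt q (i + 1) : ℝ) : ℂ) • z q κ ^ i := by
  have h := shift_mul_z_pow κ hq 1 i
  rw [shift_one κ hq, shift, add_comm 1 (i : ℤ)] at h
  rw [pow_succ' (z q κ), ← mul_assoc, h, mul_add, Algebra.algebraMap_eq_smul_one, mul_smul_comm,
    mul_smul_comm, mul_one, ← mul_assoc, ← pow_succ, ← pow_succ']
  congr 2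

lemma mul_mem_monomialSpan (hq : 0 < q) {n : ℕ} {s f : Disc q κ} (hs : s ∈ gens q κ)
    (hf : f ∈ monomialSpan q κ n) : s * f ∈ monomialSpan q κ (n + 1) := by
  induction hf using Submodule.span_induction with
  | mem f hf =>
    obtain ⟨⟨⟨i, hi⟩, ⟨j, hj⟩⟩, rfl⟩ := hf
    simp only [gens, Set.Finite.mem_toFinset] at hs
    rcases hs with rfl | rfl
    · rw [← mul_assoc, ← pow_succ']
      exact mem_monomialSpan (by omega) (by omega)
    · rw [← mul_assoc]
      cases i with
      | zero =>
        rw [pow_zero, mul_one, ← pow_succ']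
        simpa using mem_monomialSpan (q := q) (κ := κ) (n := n + 1) (i := 0) (j := j + 1)
          (by omega) (by omega)
      | succ i =>
        rw [zs_mul_z_pow hq, add_mul, smul_mul_assoc, smul_mul_assoc, mul_assoc, ← pow_succ']
        exact add_mem (Submodule.smul_mem _ _ (mem_monomialSpan (by omega) (by omega)))
          (Submodule.smul_mem _ _ (mem_monomialSpan (by omega) (by omega)))
  | zero => simp
  | add f g _ _ hf hg => rw [mul_add]; exact add_mem hf hg
  | smul c f _ hf => rw [mul_smul_comm]; exact Submodule.smul_mem _ _ hf

lemma monomialSpan_mono {m n : ℕ} (h : m ≤ n) : monomialSpan q κ m ≤ monomialSpan q κ n := by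
  refine Submodule.span_le.2 ?_
  rintro _ ⟨⟨⟨i, hi⟩, ⟨j, hj⟩⟩, rfl⟩
  exact mem_monomialSpan (by omega) (by omega)

lemma wordSpan_gens_le (hq : 0 < q) (n : ℕ) :
    wordSpan (gens q κ) n ≤ monomialSpan q κ n := by
  refine wordSpan_le (G := monomialSpan q κ) (fun _ _ h => monomialSpan_mono h) ?_
    (fun hs hf => mul_mem_monomialSpan hq hs hf) n
  simpa using mem_monomialSpan (q := q) (κ := κ) (n := 0) (i := 0) (j := 0) le_rfl le_rfl

end Disc

/-! ### Gelfand-Kirillov dimension of the cone -/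

namespace Cone

variable {N : ℕ} {q κ : ℝ}

-- These are normal forms with nonnegative exponent only, which already suffices for quadratic
-- growth.
open Polynomial in
lemma linearIndependent_a_pow_mul_b_pow (hN : 0 < N) (hq : 0 < q) (hκ : κ ≠ 0) :
    LinearIndependent ℂ fun p : ℕ × ℕ => a N q κ ^ p.1 * b N q κ ^ p.2 := by
  have h1 : LinearIndependent ℂ fun p : (_ : ℤ) × ℕ =>
      (Finsupp.single p.1 (basisMonomials ℂ p.2) : ℤ →₀ ℂ[X]) :=
    Finsupp.linearIndependent_single (f := fun (_ : ℤ) (i : ℕ) => basisMonomials ℂ i)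
      fun _ => (basisMonomials ℂ).linearIndependent
  have h2 := (h1.map' (nf N q κ) (LinearMap.ker_eq_bot.2 (nf_injective hN hq hκ))).comp
    (fun p : ℕ × ℕ => (⟨(p.2 : ℤ), p.1⟩ : (_ : ℤ) × ℕ)) (by
      rintro ⟨i, k⟩ ⟨i', k'⟩ h
      simp only [Sigma.mk.injEq, Nat.cast_inj, heq_eq_eq] at h
      rw [h.1, h.2])
  have h3 : (fun p : ℕ × ℕ => a N q κ ^ p.1 * b N q κ ^ p.2) = (nf N q κ ∘ fun p : (_ : ℤ) × ℕ =>
      (Finsupp.single p.1 (basisMonomials ℂ p.2) : ℤ →₀ ℂ[X])) ∘ fun p => ⟨(p.2 : ℤ), p.1⟩ := by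
    funext p
    simp [aeval_monomial]
  rw [h3]
  exact h2

/-- For an arbitrary generating set, the upper bound is taken inside the disc through the embedding.
The lower bound counts the `a^i b^k` with `i, k ≤ n`, whose word lengths are linear in `n`. -/
theorem isAffineOfGKDim (hN : 0 < N) (hq : 0 < q) (hκ : κ ≠ 0) :
    IsAffineOfGKDim (Cone N q κ) 2 := by
  refine ⟨⟨Subalgebra.fg_def.2 ⟨_, Set.toFinite _, adjoin_eq_top N q κ⟩⟩, fun S hS => ?_⟩
  have hinj := coneToDisc_injective hN hq hκ
  obtain ⟨M, hM⟩ := exists_map_wordSpan_le Disc.adjoin_gens (coneToDisc N κ hq) S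
  have hle (n : ℕ) : (wordSpan S n).map (coneToDisc N κ hq).toLinearMap ≤
      Disc.monomialSpan q κ (M * n) := (hM n).trans (Disc.wordSpan_gens_le hq _)
  let e (n : ℕ) := Submodule.equivMapOfInjective (coneToDisc N κ hq).toLinearMap hinj
    (wordSpan S n)
  -- `finrank` is `0` on infinite-dimensional spaces, so the lower bound needs finiteness.
  have hfin (n : ℕ) : Module.Finite ℂ (wordSpan S n) := by
    have := Submodule.finiteDimensional_of_le (hle n)
    exact Module.Finite.equiv (e n).symm
  obtain ⟨m₁, h₁⟩ := exists_mem_wordSpan hS (a N q κ)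
  obtain ⟨m₂, h₂⟩ := exists_mem_wordSpan hS (b N q κ)
  refine growthExponent_eq_two (M := M) (M' := m₁ + m₂) (fun n => ?_) fun n => ?_
  · rw [(e n).finrank_eq]
    exact (Submodule.finrank_mono (hle n)).trans (Disc.finrank_monomialSpan_le _)
  · have hmem (p : Fin (n + 1) × Fin (n + 1)) :
        a N q κ ^ (p.1 : ℕ) * b N q κ ^ (p.2 : ℕ) ∈ wordSpan S ((m₁ + m₂ + 1) * n) := by
      refine wordSpan_mono ?_ (mul_mem_wordSpan (pow_mem_wordSpan h₁ p.1)
        (pow_mem_wordSpan h₂ p.2))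
      calc m₁ * (p.1 : ℕ) + m₂ * (p.2 : ℕ) ≤ m₁ * n + m₂ * n := by
            gcongr <;> omega
        _ ≤ (m₁ + m₂ + 1) * n := by nlinarith
    have hli : LinearIndependent ℂ fun p : Fin (n + 1) × Fin (n + 1) =>
        (⟨_, hmem p⟩ : wordSpan S ((m₁ + m₂ + 1) * n)) := by
      refine LinearIndependent.of_comp (Submodule.subtype _) ?_
      exact (linearIndependent_a_pow_mul_b_pow hN hq hκ).comp
        (fun p : Fin (n + 1) × Fin (n + 1) => ((p.1 : ℕ), (p.2 : ℕ))) (by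
          rintro ⟨i, k⟩ ⟨i', k'⟩ h
          simp only [Prod.mk.injEq, Fin.val_inj] at h
          rw [h.1, h.2])
    have := hli.fintype_card_le_finrank
    simpa [sq] using this

end Cone

section

open Polynomial

/-! ### The calculus on the quantum cone -/

namespace Disc

variable {q κ : ℝ}

lemma x_mul_z : x q κ * z q κ = (q : ℂ) • (z q κ * x q κ) + (κ : ℂ) • z q κ := by
  rw [x, mul_assoc, zs_mul_z, mul_add, mul_smul_comm, Algebra.algebraMap_eq_smul_one,
    mul_smul_comm, mul_one]

lemma zs_mul_x_eq : zs q κ * x q κ = (q : ℂ) • (x q κ * zs q κ) + (κ : ℂ) • zs q κ := by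
  rw [x, ← mul_assoc, zs_mul_z, add_mul, smul_mul_assoc, Algebra.algebraMap_eq_smul_one,
    smul_mul_assoc, one_mul]

lemma normalElt_eq_smul : normalElt q κ = ((q : ℂ) - 1) • x q κ + (κ : ℂ) • 1 := by
  simp only [normalElt, normalPoly, map_add, map_mul, aeval_C, aeval_X, Algebra.smul_def, mul_one]

/-- The left side is the `dz` coefficient of `q dx x - x dx + κ dx`, a combination whose `dz*`
coefficient vanishes. -/
lemma zs_mul_normalElt (hq : 0 < q) :
    (q : ℂ) • (zs q κ * x q κ) - (x q κ * zs q κ - (κ : ℂ) • zs q κ) =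
      (1 + (q : ℂ)⁻¹) • (zs q κ * normalElt q κ) := by
  have hq' : (q : ℂ) ≠ 0 := by exact_mod_cast hq.ne'
  rw [normalElt_eq_smul, mul_add, mul_smul_comm, mul_smul_comm, mul_one, zs_mul_x_eq]
  match_scalars <;> field_simp <;> ring

/-- Up to the factor `q⁻¹`, the left side is the `dz*` coefficient of `dx x - q x dx - κ dx`, whose
`dz` coefficient vanishes. -/
lemma z_mul_normalElt :
    z q κ * x q κ - ((q : ℂ) • (x q κ * z q κ) + (κ : ℂ) • z q κ) =
      -(1 + (q : ℂ)) • (z q κ * normalElt q κ) := by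
  rw [normalElt_eq_smul, mul_add, mul_smul_comm, mul_smul_comm, mul_one, x_mul_z]
  match_scalars <;> ring

end Disc

namespace Cone

variable {N : ℕ} {q κ : ℝ}

open DiscForms

variable (N κ) in
/-- The `n`-forms on the quantum cone, inside the algebra of forms on the quantum disc. -/
def forms (hq : 0 < q) (n : ℕ) : Submodule ℂ (DiscForms q κ) :=
  Submodule.span ℂ {ω | ∃ (f : Cone N q κ) (l : List (Cone N q κ)), l.length = n ∧
    ω = ofDisc q κ (coneToDisc N κ hq f) *
      (l.map fun g => d κ hq (ofDisc q κ (coneToDisc N κ hq g))).prod}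

lemma forms_le_homogeneous (hq : 0 < q) (n : ℕ) : forms N κ hq n ≤ homogeneous κ hq n := by
  refine Submodule.span_le.2 ?_
  rintro _ ⟨f, l, rfl, rfl⟩
  have h : (l.map fun g => d κ hq (ofDisc q κ (coneToDisc N κ hq g))).prod ∈
      homogeneous κ hq l.length := by
    induction l with
    | nil => simpa using ofDisc_mem_homogeneous hq (1 : Disc q κ)
    | cons g l ih =>
      rw [List.map_cons, List.prod_cons, List.length_cons, add_comm]
      exact mul_mem_homogeneous hq (d_ofDisc_mem_homogeneous hq _) ih
  simpa using mul_mem_homogeneous hq (ofDisc_mem_homogeneous hq (coneToDisc N κ hq f)) h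

lemma parity_eq (hq : 0 < q) {n : ℕ} {ω : DiscForms q κ} (hω : ω ∈ forms N κ hq n) :
    parity κ hq ω = (-1 : ℂ) ^ n • ω := by
  induction hω using Submodule.span_induction with
  | mem ω hω =>
    obtain ⟨f, l, rfl, rfl⟩ := hω
    have h : parity κ hq (l.map fun g => d κ hq (ofDisc q κ (coneToDisc N κ hq g))).prod =
        (-1 : ℂ) ^ l.length •
          (l.map fun g => d κ hq (ofDisc q κ (coneToDisc N κ hq g))).prod := by
      induction l with
      | nil => simpa using parity_algebraMap hq (1 : ℂ)
      | cons g l ih =>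
        rw [List.map_cons, List.prod_cons, List.length_cons, parity_mul, ih,
          (parity_d_and_d_d hq _).1, parity_ofDisc, pow_succ]
        simp
    rw [parity_mul, parity_ofDisc, h, mul_smul_comm]
  | zero => simp [parity]
  | add ω η _ _ hω hη => rw [parity_add, hω, hη, smul_add]
  | smul c ω _ hω => rw [parity_smul, hω, smul_comm]

lemma d_mul_of_mem (hq : 0 < q) {m : ℕ} {ω : DiscForms q κ} (hω : ω ∈ forms N κ hq m)
    (η : DiscForms q κ) :
    d κ hq (ω * η) = d κ hq ω * η + (-1 : ℂ) ^ m • (ω * d κ hq η) := by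
  rw [d_mul, parity_eq hq hω, smul_mul_assoc]

lemma ofDisc_injective (hq : 0 < q) : Function.Injective (ofDisc q κ) := by
  intro f g h
  simpa [coord_ofDisc] using congrArg (coord κ hq 0) h

/-- The calculus on the quantum cone. -/
def calculus (hN : 0 < N) (hq : 0 < q) (hκ : κ ≠ 0) : DifferentialCalculus (Cone N q κ) where
  toCalculusData := coneCalculus N κ hq
  ι_injective := (ofDisc_injective hq).comp (coneToDisc_injective hN hq hκ)
  independent := (iSupIndep_homogeneous hq).mono (forms_le_homogeneous hq)
  leibniz _ _ _ hω η _ := d_mul_of_mem hq hω η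
  d_d _ ω _ := (parity_d_and_d_d hq ω).2

lemma isConnected (hN : 0 < N) (hq : 0 < q) (hκ : κ ≠ 0) : (calculus hN hq hκ).IsConnected := by
  intro f
  refine ⟨fun h => ?_, ?_⟩
  · obtain ⟨c, hc⟩ := exists_eq_algebraMap_of_d_eq_zero hq hκ (f := coneToDisc N κ hq f) h
    refine ⟨c, coneToDisc_injective hN hq hκ ?_⟩
    rw [hc, map_smul, map_one, Algebra.algebraMap_eq_smul_one]
  · rintro ⟨c, rfl⟩
    change d κ hq (ofDisc q κ (coneToDisc N κ hq (c • 1))) = 0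
    rw [map_smul, map_smul, map_smul, map_one, map_one]
    have := d_algebraMap (κ := κ) hq 1
    rw [map_one] at this
    rw [this, smul_zero]

/-! #### Coefficients of forms -/

variable {u : ℂˣ}

lemma ofDisc_mul_mem (hN : 0 < N) (hu : IsPrimitiveRoot u N) (hq : 0 < q) (hκ : κ ≠ 0) {n : ℕ}
    {f : Disc q κ} (hf : f ∈ Disc.weight q κ u 0) {ω : DiscForms q κ}
    (hω : ω ∈ forms N κ hq n) : ofDisc q κ f * ω ∈ forms N κ hq n := by
  obtain ⟨g, rfl⟩ := exists_coneToDisc_eq hN hu hq hκ hf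
  exact (calculus hN hq hκ).forms_ι_mul g hω

lemma mul_ofDisc_mem (hN : 0 < N) (hu : IsPrimitiveRoot u N) (hq : 0 < q) (hκ : κ ≠ 0) {n : ℕ}
    {f : Disc q κ} (hf : f ∈ Disc.weight q κ u 0) {ω : DiscForms q κ}
    (hω : ω ∈ forms N κ hq n) : ω * ofDisc q κ f ∈ forms N κ hq n := by
  obtain ⟨g, rfl⟩ := exists_coneToDisc_eq hN hu hq hκ hf
  exact (calculus hN hq hκ).forms_mul_ι g hω

lemma d_ofDisc_mem (hN : 0 < N) (hq : 0 < q) (hκ : κ ≠ 0) (f : Cone N q κ) :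
    d κ hq (ofDisc q κ (coneToDisc N κ hq f)) ∈ forms N κ hq 1 :=
  (calculus hN hq hκ).d_ι_mem_forms f

lemma mul_mem_forms_two (hN : 0 < N) (hq : 0 < q) (hκ : κ ≠ 0) {ω η : DiscForms q κ}
    (hω : ω ∈ forms N κ hq 1) (hη : η ∈ forms N κ hq 1) : ω * η ∈ forms N κ hq 2 :=
  (calculus hN hq hκ).mul_mem_forms (m := 1) (n := 1) hω hη

/-- A scalar multiple of `db`. -/
lemma oneForm_z_pow_mem (hN : 0 < N) (hq : 0 < q) (hκ : κ ≠ 0) :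
    oneForm (Disc.z q κ ^ (N - 1)) 0 ∈ forms N κ hq 1 := by
  obtain ⟨c, hc, h⟩ := exists_d_z_pow (κ := κ) hq (N - 1)
  have hc' : (c : ℂ) ≠ 0 := by exact_mod_cast hc.ne'
  have h1 := d_ofDisc_mem hN hq hκ (b N q κ)
  rw [Nat.sub_add_cancel hN] at h
  rw [coneToDisc_b, h] at h1
  have h2 := Submodule.smul_mem _ (c : ℂ)⁻¹ h1
  rwa [smul_oneForm, smul_smul, inv_mul_cancel₀ hc', one_smul, smul_zero] at h2

lemma oneForm_zs_pow_mem (hN : 0 < N) (hq : 0 < q) (hκ : κ ≠ 0) :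
    oneForm 0 (Disc.zs q κ ^ (N - 1)) ∈ forms N κ hq 1 := by
  obtain ⟨c, hc, h⟩ := exists_d_zs_pow (κ := κ) hq (N - 1)
  have hc' : (c : ℂ) ≠ 0 := by exact_mod_cast hc.ne'
  have h1 := d_ofDisc_mem hN hq hκ (bs N q κ)
  rw [Nat.sub_add_cancel hN] at h
  rw [coneToDisc_bs, h] at h1
  have h2 := Submodule.smul_mem _ (c : ℂ)⁻¹ h1
  rwa [smul_oneForm, smul_smul, inv_mul_cancel₀ hc', one_smul, smul_zero] at h2

lemma d_x_mem (hN : 0 < N) (hq : 0 < q) (hκ : κ ≠ 0) :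
    oneForm (Disc.zs q κ) ((q : ℂ)⁻¹ • Disc.z q κ) ∈ forms N κ hq 1 := by
  have h := d_ofDisc_mem hN hq hκ (a N q κ)
  rwa [coneToDisc_a, d_ofDisc, del_x, delBar_x] at h

lemma oneForm_zs_mul_normalElt_mem (hN : 0 < N) (hu : IsPrimitiveRoot u N) (hq : 0 < q)
    (hκ : κ ≠ 0) : oneForm (Disc.zs q κ * Disc.normalElt q κ) 0 ∈ forms N κ hq 1 := by
  have hq' : (q : ℂ) ≠ 0 := by exact_mod_cast hq.ne'
  have hc : 1 + (q : ℂ)⁻¹ ≠ 0 := by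
    have : (1 + q⁻¹ : ℝ) ≠ 0 := by positivity
    exact_mod_cast this
  have hx : Disc.x q κ ∈ Disc.weight q κ u 0 := by
    simpa using Disc.aeval_mem_weight (q := q) (κ := κ) (u := u) X
  have h1 := d_x_mem hN hq hκ
  have h2 := sub_mem (Submodule.smul_mem _ (q : ℂ) (mul_ofDisc_mem hN hu hq hκ hx h1))
    (sub_mem (ofDisc_mul_mem hN hu hq hκ hx h1) (Submodule.smul_mem _ (κ : ℂ) h1))
  rw [oneForm_mul_ofDisc, ofDisc_mul_oneForm hq, smul_oneForm, smul_oneForm, oneForm_sub,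
    oneForm_sub, Disc.twist_x, Disc.zs_mul_normalElt hq, mul_smul_comm, Disc.x_mul_z] at h2
  have h3 : (q : ℂ) • ((q : ℂ)⁻¹ • Disc.z q κ * Disc.x q κ) -
      ((q : ℂ)⁻¹ • ((q : ℂ) • (Disc.z q κ * Disc.x q κ) + (κ : ℂ) • Disc.z q κ) -
        (κ : ℂ) • (q : ℂ)⁻¹ • Disc.z q κ) = 0 := by
    rw [smul_mul_assoc]
    match_scalars <;> field_simp <;> ring
  rw [h3] at h2
  have h4 := Submodule.smul_mem _ (1 + (q : ℂ)⁻¹)⁻¹ h2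
  rwa [smul_oneForm, smul_smul, inv_mul_cancel₀ hc, one_smul, smul_zero] at h4

lemma oneForm_z_mul_normalElt_mem (hN : 0 < N) (hu : IsPrimitiveRoot u N) (hq : 0 < q)
    (hκ : κ ≠ 0) : oneForm 0 (Disc.z q κ * Disc.normalElt q κ) ∈ forms N κ hq 1 := by
  have hq' : (q : ℂ) ≠ 0 := by exact_mod_cast hq.ne'
  have hc : (q : ℂ)⁻¹ * -(1 + (q : ℂ)) ≠ 0 := by
    have : (q⁻¹ * -(1 + q) : ℝ) ≠ 0 := mul_ne_zero (by positivity) (neg_ne_zero.2 (by positivity))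
    exact_mod_cast this
  have hx : Disc.x q κ ∈ Disc.weight q κ u 0 := by
    simpa using Disc.aeval_mem_weight (q := q) (κ := κ) (u := u) X
  have h1 := d_x_mem hN hq hκ
  have h2 := sub_mem (mul_ofDisc_mem hN hu hq hκ hx h1)
    (add_mem (Submodule.smul_mem _ (q : ℂ) (ofDisc_mul_mem hN hu hq hκ hx h1))
      (Submodule.smul_mem _ (κ : ℂ) h1))
  rw [oneForm_mul_ofDisc, ofDisc_mul_oneForm hq, smul_oneForm, smul_oneForm, oneForm_add,
    oneForm_sub, Disc.twist_x, Disc.zs_mul_x_eq, sub_self, smul_mul_assoc, mul_smul_comm,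
    smul_comm (q : ℂ), smul_comm (κ : ℂ), ← smul_add, ← smul_sub, Disc.z_mul_normalElt,
    smul_smul] at h2
  have h4 := Submodule.smul_mem _ ((q : ℂ)⁻¹ * -(1 + (q : ℂ)))⁻¹ h2
  rwa [smul_oneForm, smul_smul, inv_mul_cancel₀ hc, one_smul, smul_zero] at h4

/-- Two multiples of `dz z*` are available, one by `normalElt` and one by the product of shift
polynomials in `z*^N z^(N-1)`. The polynomials are coprime, so Bézout yields `dz z*` itself. -/
lemma oneForm_zs_mem (hN : 0 < N) (hu : IsPrimitiveRoot u N) (hq : 0 < q) (hκ : κ ≠ 0) :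
    oneForm (Disc.zs q κ) 0 ∈ forms N κ hq 1 := by
  have hcop : IsCoprime (Disc.normalPoly q κ)
      ((List.range (N - 1)).map fun l : ℕ => Disc.shiftPoly q κ ((l : ℤ) + 1)).prod :=
    isCoprime_list_prod_map fun l _ => Disc.isCoprime_normalPoly hκ _
  obtain ⟨r, s, h⟩ := hcop
  have hw : Disc.zs q κ ^ N ∈ Disc.weight q κ u 0 := by
    have := coneToDisc_mem_weight (κ := κ) hu.pow_eq_one hq (bs N q κ)
    rwa [coneToDisc_bs] at this
  -- Left multiplication by the inverse twist of `z*^N` places `z*^N` between `dz` and `z^(N-1)`.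
  have h1 := ofDisc_mul_mem hN hu hq hκ (Disc.twist_symm_mem_weight hq hw)
    (oneForm_z_pow_mem hN hq hκ)
  rw [ofDisc_mul_oneForm hq, AlgEquiv.apply_symm_apply, mul_zero] at h1
  have h2 : Disc.zs q κ ^ N * Disc.z q κ ^ (N - 1) = Disc.zs q κ * aeval (Disc.x q κ)
      ((List.range (N - 1)).map fun l : ℕ => Disc.shiftPoly q κ ((l : ℤ) + 1)).prod := by
    rw [← Disc.zs_pow_mul_z_pow_eq hq, ← mul_assoc, ← pow_succ', Nat.sub_add_cancel hN]
  rw [h2] at h1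
  have h3 := add_mem
    (mul_ofDisc_mem hN hu hq hκ (Disc.aeval_mem_weight r)
      (oneForm_zs_mul_normalElt_mem hN hu hq hκ))
    (mul_ofDisc_mem hN hu hq hκ (Disc.aeval_mem_weight s) h1)
  rwa [oneForm_mul_ofDisc, oneForm_mul_ofDisc, oneForm_add, mul_assoc, mul_assoc, ← mul_add,
    Disc.normalElt, ← map_mul, ← map_mul, ← map_add, mul_comm _ r, mul_comm _ s, h, map_one,
    mul_one, zero_mul, zero_mul, add_zero] at h3

lemma oneForm_z_mem (hN : 0 < N) (hu : IsPrimitiveRoot u N) (hq : 0 < q) (hκ : κ ≠ 0) :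
    oneForm 0 (Disc.z q κ) ∈ forms N κ hq 1 := by
  have hcop : IsCoprime (Disc.normalPoly q κ)
      ((List.range (N - 1)).map fun l : ℕ => Disc.shiftPoly q κ (-(l : ℤ))).prod :=
    isCoprime_list_prod_map fun l _ => Disc.isCoprime_normalPoly hκ _
  obtain ⟨r, s, h⟩ := hcop
  have hw : Disc.z q κ ^ N ∈ Disc.weight q κ u 0 := by
    have := coneToDisc_mem_weight (κ := κ) hu.pow_eq_one hq (b N q κ)
    rwa [coneToDisc_b] at this
  have h1 := ofDisc_mul_mem hN hu hq hκ (Disc.twist_symm_mem_weight hq hw)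
    (oneForm_zs_pow_mem hN hq hκ)
  rw [ofDisc_mul_oneForm hq, AlgEquiv.apply_symm_apply, mul_zero] at h1
  have h2 : Disc.z q κ ^ N * Disc.zs q κ ^ (N - 1) = Disc.z q κ * aeval (Disc.x q κ)
      ((List.range (N - 1)).map fun l : ℕ => Disc.shiftPoly q κ (-(l : ℤ))).prod := by
    rw [← Disc.z_pow_mul_zs_pow_eq hq, ← mul_assoc, ← pow_succ', Nat.sub_add_cancel hN]
  rw [h2] at h1
  have h3 := add_mem
    (mul_ofDisc_mem hN hu hq hκ (Disc.aeval_mem_weight r)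
      (oneForm_z_mul_normalElt_mem hN hu hq hκ))
    (mul_ofDisc_mem hN hu hq hκ (Disc.aeval_mem_weight s) h1)
  rwa [oneForm_mul_ofDisc, oneForm_mul_ofDisc, zero_mul, zero_mul, oneForm_add, add_zero, mul_assoc,
    mul_assoc, ← mul_add, Disc.normalElt, ← map_mul, ← map_mul, ← map_add, mul_comm _ r, mul_comm _ s, h, map_one,
    mul_one] at h3

lemma mul_oneForm_mem (hN : 0 < N) (hu : IsPrimitiveRoot u N) (hq : 0 < q) (hκ : κ ≠ 0)
    {f g h : Disc q κ} (hh : h ∈ Disc.weight q κ u 0) (hω : oneForm f g ∈ forms N κ hq 1) :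
    oneForm (h * f) (h * g) ∈ forms N κ hq 1 := by
  have := ofDisc_mul_mem hN hu hq hκ (Disc.twist_symm_mem_weight hq hh) hω
  rwa [ofDisc_mul_oneForm hq, AlgEquiv.apply_symm_apply] at this

/-- Writing `f = f s z* + f s' z^(N-1)` by a partition of unity gives coefficients `f s`, `f s'` in
the cone and reduces the claim to `dz z*` and `dz z^(N-1)`. -/
lemma oneForm_left_mem (hN : 0 < N) (hu : IsPrimitiveRoot u N) (hq : 0 < q) (hκ : κ ≠ 0)
    {f : Disc q κ} (hf : f ∈ Disc.weight q κ u (-1)) : oneForm f 0 ∈ forms N κ hq 1 := by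
  obtain ⟨s, hs, s', hs', h⟩ := Disc.exists_right_partition_neg hq hκ hN hu.pow_eq_one
  have h1 := add_mem
    (mul_oneForm_mem hN hu hq hκ (Disc.mul_mem_weight hf hs (by norm_num))
      (oneForm_zs_mem hN hu hq hκ))
    (mul_oneForm_mem hN hu hq hκ (Disc.mul_mem_weight hf hs' (by norm_num))
      (oneForm_z_pow_mem hN hq hκ))
  rwa [oneForm_add, mul_assoc, mul_assoc, ← mul_add, h, mul_one, mul_zero, mul_zero,
    add_zero] at h1

lemma oneForm_right_mem (hN : 0 < N) (hu : IsPrimitiveRoot u N) (hq : 0 < q) (hκ : κ ≠ 0)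
    {f : Disc q κ} (hf : f ∈ Disc.weight q κ u 1) : oneForm 0 f ∈ forms N κ hq 1 := by
  obtain ⟨s, hs, s', hs', h⟩ := Disc.exists_right_partition_pos hq hκ hN hu.pow_eq_one
  have h1 := add_mem
    (mul_oneForm_mem hN hu hq hκ (Disc.mul_mem_weight hf hs (by norm_num))
      (oneForm_z_mem hN hu hq hκ))
    (mul_oneForm_mem hN hu hq hκ (Disc.mul_mem_weight hf hs' (by norm_num))
      (oneForm_zs_pow_mem hN hq hκ))
  rwa [mul_zero, mul_zero, oneForm_add, add_zero, mul_assoc, mul_assoc, ← mul_add, h,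
    mul_one] at h1

/-- The one-forms on the quantum cone are the `dz f + dz* g` with `f` of weight `-1` and `g` of
weight `1`. -/
lemma mem_forms_one_iff (hN : 0 < N) (hu : IsPrimitiveRoot u N) (hq : 0 < q) (hκ : κ ≠ 0)
    {ω : DiscForms q κ} : ω ∈ forms N κ hq 1 ↔
      ∃ f ∈ Disc.weight q κ u (-1), ∃ g ∈ Disc.weight q κ u 1, ω = oneForm f g := by
  constructor
  · intro hω
    induction hω using Submodule.span_induction with
    | mem ω hω =>
      obtain ⟨f, l, hl, rfl⟩ := hω
      obtain ⟨g, rfl⟩ := List.length_eq_one_iff.1 hl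
      have hf := Disc.twist_mem_weight hq (coneToDisc_mem_weight (κ := κ) hu.pow_eq_one hq f)
      have hg := coneToDisc_mem_weight (κ := κ) hu.pow_eq_one hq g
      refine ⟨_, Disc.mul_mem_weight hf (del_mem_weight hq hg) (by norm_num), _,
        Disc.mul_mem_weight hf (delBar_mem_weight hq hg) (by norm_num), ?_⟩
      rw [← ofDisc_mul_oneForm, ← d_ofDisc]
      simp
    | zero => exact ⟨0, zero_mem _, 0, zero_mem _, by simp [oneForm]⟩
    | add ω η _ _ hω hη =>
      obtain ⟨f, hf, g, hg, rfl⟩ := hω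
      obtain ⟨f', hf', g', hg', rfl⟩ := hη
      exact ⟨_, add_mem hf hf', _, add_mem hg hg', oneForm_add _ _ _ _⟩
    | smul c ω _ hω =>
      obtain ⟨f, hf, g, hg, rfl⟩ := hω
      exact ⟨_, Submodule.smul_mem _ c hf, _, Submodule.smul_mem _ c hg, smul_oneForm _ _ _⟩
  · rintro ⟨f, hf, g, hg, rfl⟩
    have := add_mem (oneForm_left_mem hN hu hq hκ hf) (oneForm_right_mem hN hu hq hκ hg)
    rwa [oneForm_add, add_zero, zero_add] at this

/-- The products of `dz z*` and `dz* z` in the two orders are the volume form times `q z* z` and `-z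
z*`. Weighting the second by `q²` lets the disc relation collapse the sum to `q κ`. -/
lemma vol_mem (hN : 0 < N) (hu : IsPrimitiveRoot u N) (hq : 0 < q) (hκ : κ ≠ 0) :
    vol q κ ∈ forms N κ hq 2 := by
  have hq' : (q : ℂ) ≠ 0 := by exact_mod_cast hq.ne'
  have hκ' : (κ : ℂ) ≠ 0 := by exact_mod_cast hκ
  have h1 := oneForm_zs_mem hN hu hq hκ
  have h2 := oneForm_z_mem hN hu hq hκ
  have h3 := add_mem (mul_mem_forms_two hN hq hκ h1 h2)
    (Submodule.smul_mem _ ((q : ℂ) ^ 2) (mul_mem_forms_two hN hq hκ h2 h1))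
  rw [oneForm_mul_oneForm hq, oneForm_mul_oneForm hq, ← mul_smul_comm ((q : ℂ) ^ 2),
    ← map_smul (ofDisc q κ) ((q : ℂ) ^ 2), ← mul_add, ← map_add] at h3
  have h4 : Disc.twist κ hq (Disc.zs q κ) * Disc.z q κ - (q : ℂ) • (Disc.twist κ hq 0 * 0) +
      (q : ℂ) ^ 2 • (Disc.twist κ hq 0 * 0 -
        (q : ℂ) • (Disc.twist κ hq (Disc.z q κ) * Disc.zs q κ)) =
      ((q : ℂ) * κ) • (1 : Disc q κ) := by
    rw [Disc.twist_zs, Disc.twist_z, smul_mul_assoc, smul_mul_assoc, Disc.zs_mul_z,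
      Algebra.algebraMap_eq_smul_one]
    simp only [mul_zero, smul_zero, sub_zero, zero_sub]
    match_scalars <;> field_simp
    ring
  rw [h4, map_smul, mul_smul_comm, map_one, mul_one] at h3
  have h5 := Submodule.smul_mem _ ((q : ℂ) * κ)⁻¹ h3
  rwa [smul_smul, inv_mul_cancel₀ (mul_ne_zero hq' hκ'), one_smul] at h5

lemma exists_isPrimitiveRoot_units (hN : 0 < N) : ∃ u : ℂˣ, IsPrimitiveRoot u N :=
  ⟨_, (Complex.isPrimitiveRoot_exp N hN.ne').isUnit_unit hN.ne'⟩

/-- The two-forms on the quantum cone are the multiples of the volume form. -/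
lemma mem_forms_two_iff (hN : 0 < N) (hq : 0 < q) (hκ : κ ≠ 0) {ω : DiscForms q κ} :
    ω ∈ forms N κ hq 2 ↔ ∃ f, ω = vol q κ * ofDisc q κ (coneToDisc N κ hq f) := by
  obtain ⟨u, hu⟩ := exists_isPrimitiveRoot_units hN
  constructor
  · intro hω
    suffices h : ∃ f ∈ Disc.weight q κ u 0, ω = vol q κ * ofDisc q κ f by
      obtain ⟨f, hf, rfl⟩ := h
      obtain ⟨g, rfl⟩ := exists_coneToDisc_eq hN hu hq hκ hf
      exact ⟨g, rfl⟩
    induction hω using Submodule.span_induction with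
    | mem ω hω =>
      obtain ⟨f, l, hl, rfl⟩ := hω
      obtain ⟨g, h, rfl⟩ := List.length_eq_two.1 hl
      have hf := Disc.twist_mem_weight hq (coneToDisc_mem_weight (κ := κ) hu.pow_eq_one hq f)
      have hg := coneToDisc_mem_weight (κ := κ) hu.pow_eq_one hq g
      have hh := coneToDisc_mem_weight (κ := κ) hu.pow_eq_one hq h
      have h1 := Disc.mul_mem_weight (m := 0) (Disc.twist_mem_weight hq (del_mem_weight hq hg))
        (delBar_mem_weight hq hh) (by norm_num)
      have h2 := Disc.mul_mem_weight (m := 0) (Disc.twist_mem_weight hq (delBar_mem_weight hq hg))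
        (del_mem_weight hq hh) (by norm_num)
      refine ⟨_, Disc.mul_mem_weight (Disc.twist_mem_weight hq hf)
        (sub_mem h1 (Submodule.smul_mem _ (q : ℂ) h2)) (by norm_num), ?_⟩
      rw [map_mul (ofDisc q κ), ← mul_assoc, ← ofDisc_mul_vol, mul_assoc, ← oneForm_mul_oneForm,
        ← d_ofDisc, ← d_ofDisc]
      simp
    | zero => exact ⟨0, zero_mem _, by simp⟩
    | add ω η _ _ hω hη =>
      obtain ⟨f, hf, rfl⟩ := hω
      obtain ⟨f', hf', rfl⟩ := hη
      exact ⟨_, add_mem hf hf', by rw [map_add, mul_add]⟩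
    | smul c ω _ hω =>
      obtain ⟨f, hf, rfl⟩ := hω
      exact ⟨_, Submodule.smul_mem _ c hf, by rw [map_smul, mul_smul_comm]⟩
  · rintro ⟨f, rfl⟩
    exact mul_ofDisc_mem hN hu hq hκ (coneToDisc_mem_weight hu.pow_eq_one hq f)
      (vol_mem hN hu hq hκ)

lemma vol_mul_injective (hq : 0 < q) :
    Function.Injective fun f : Disc q κ => vol q κ * ofDisc q κ f := by
  intro f g h
  simpa [coord_vol_mul] using congrArg (coord κ hq 3) h

lemma hasDimension (hN : 0 < N) (hq : 0 < q) (hκ : κ ≠ 0) :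
    (calculus hN hq hκ).HasDimension 2 := by
  constructor
  · intro h
    have h1 : vol q κ * ofDisc q κ (coneToDisc N κ hq 1) ∈ forms N κ hq 2 :=
      (mem_forms_two_iff hN hq hκ).2 ⟨1, rfl⟩
    have h2 : forms N κ hq 2 = ⊥ := h
    rw [h2, Submodule.mem_bot] at h1
    have h3 := congrArg (coord κ hq 3) h1
    rw [coord_vol_mul, map_one, map_zero, if_pos rfl] at h3
    -- The disc is nontrivial, since its unit acts as the identity on a nonzero function.
    have h4 := congrArg (fun f => Disc.rep κ hq f (fun _ => 1) 0) h3
    simp at h4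
  · intro m hm
    exact eq_bot_iff.2 ((forms_le_homogeneous hq m).trans (homogeneous_eq_bot hq hm).le)

end Cone

end

/-! ### The perfect pairing of one-forms and integrability -/

namespace Cone

variable {N : ℕ} {q κ : ℝ}

open DiscForms

/-- The automorphism of the quantum cone describing the commutation of functions with the volume
form. -/
lemma exists_modular_automorphism (hN : 0 < N) (hq : 0 < q) (hκ : κ ≠ 0) :
    ∃ ν : Cone N q κ ≃ₐ[ℂ] Cone N q κ, ∀ f, coneToDisc N κ hq (ν f) =
      Disc.twist κ hq (Disc.twist κ hq (coneToDisc N κ hq f)) := by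
  obtain ⟨u, hu⟩ := exists_isPrimitiveRoot_units hN
  have hinj := coneToDisc_injective hN hq hκ
  -- Passing a function through `dz` and through `dz*` costs one twist each.
  let τ : Disc q κ ≃ₐ[ℂ] Disc q κ := (Disc.twist κ hq).trans (Disc.twist κ hq)
  let g : Cone N q κ →ₐ[ℂ] Cone N q κ :=
    (AlgEquiv.ofInjective _ hinj).symm.toAlgHom.comp
      ((τ.toAlgHom.comp (coneToDisc N κ hq)).codRestrict (coneToDisc N κ hq).range fun f =>
        exists_coneToDisc_eq hN hu hq hκ (Disc.twist_mem_weight hq (Disc.twist_mem_weight hq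
          (coneToDisc_mem_weight hu.pow_eq_one hq f))))
  have hg (f : Cone N q κ) : coneToDisc N κ hq (g f) = τ (coneToDisc N κ hq f) :=
    congrArg Subtype.val ((AlgEquiv.ofInjective _ hinj).apply_symm_apply _)
  refine ⟨AlgEquiv.ofBijective g ⟨fun f f' h => ?_, fun f => ?_⟩, hg⟩
  · have := congrArg (coneToDisc N κ hq) h
    rw [hg, hg] at this
    exact hinj (τ.injective this)
  · obtain ⟨f', hf'⟩ := exists_coneToDisc_eq hN hu hq hκ
      (Disc.twist_symm_mem_weight hq (Disc.twist_symm_mem_weight hq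
        (coneToDisc_mem_weight (κ := κ) hu.pow_eq_one hq f)))
    refine ⟨f', hinj ?_⟩
    rw [hg, hf']
    simp [τ]

/-- A one-form on the quantum cone which is annihilated by all one-forms vanishes. -/
lemma eq_zero_of_mul_eq_zero (hN : 0 < N) (hq : 0 < q) (hκ : κ ≠ 0) {ω : DiscForms q κ}
    (hω : ω ∈ forms N κ hq 1) (h : ∀ η ∈ forms N κ hq 1, ω * η = 0) : ω = 0 := by
  obtain ⟨u, hu⟩ := exists_isPrimitiveRoot_units hN
  obtain ⟨f, hf, g, hg, rfl⟩ := (mem_forms_one_iff hN hu hq hκ).1 hω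
  have hvol {f' g' : Disc q κ} (h' : oneForm f' g' ∈ forms N κ hq 1) :
      Disc.twist κ hq f * g' - (q : ℂ) • (Disc.twist κ hq g * f') = 0 := by
    refine vol_mul_injective hq ?_
    have := h _ h'
    rw [oneForm_mul_oneForm hq] at this
    simpa using this
  have hq' : (q : ℂ) ≠ 0 := by exact_mod_cast hq.ne'
  -- Pairing with `dz* z` and `dz* z*^(N-1)` shows that the twist of `f` is annihilated by `z` and
  -- `z*^(N-1)`, which generate the unit by a partition with fixed left factors.
  have hf0 : Disc.twist κ hq f = 0 := by
    obtain ⟨t, -, t', -, ht⟩ := Disc.exists_left_partition_pos hq hκ hN hu.pow_eq_one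
    have h1 := hvol (oneForm_z_mem hN hu hq hκ)
    have h2 := hvol (oneForm_zs_pow_mem hN hq hκ)
    simp only [mul_zero, smul_zero, sub_zero] at h1 h2
    rw [← mul_one (Disc.twist κ hq f), ← ht, mul_add, ← mul_assoc, ← mul_assoc, h1, h2, zero_mul,
      zero_mul, add_zero]
  have hg0 : Disc.twist κ hq g = 0 := by
    obtain ⟨t, -, t', -, ht⟩ := Disc.exists_left_partition_neg hq hκ hN hu.pow_eq_one
    have h1 := hvol (oneForm_zs_mem hN hu hq hκ)
    have h2 := hvol (oneForm_z_pow_mem hN hq hκ)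
    simp only [mul_zero, zero_sub, neg_eq_zero, smul_eq_zero, hq', false_or] at h1 h2
    rw [← mul_one (Disc.twist κ hq g), ← ht, mul_add, ← mul_assoc, ← mul_assoc, h1, h2, zero_mul,
      zero_mul, add_zero]
  rw [(map_eq_zero_iff _ (Disc.twist κ hq).injective).1 hf0,
    (map_eq_zero_iff _ (Disc.twist κ hq).injective).1 hg0]
  simp [oneForm]

/-- Every right linear functional on the one-forms of the quantum cone is given by multiplication
with a one-form. -/
lemma exists_mul_eq_of_right_linear (hN : 0 < N) (hq : 0 < q) (hκ : κ ≠ 0)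
    (φ : forms N κ hq 1 →ₗ[ℂ] Cone N q κ)
    (hφ : ∀ (η η' : forms N κ hq 1) (f : Cone N q κ),
      (η' : DiscForms q κ) = η * ofDisc q κ (coneToDisc N κ hq f) → φ η' = φ η * f) :
    ∃ ω ∈ forms N κ hq 1, ∀ η : forms N κ hq 1,
      ω * (η : DiscForms q κ) = vol q κ * ofDisc q κ (coneToDisc N κ hq (φ η)) := by
  obtain ⟨u, hu⟩ := exists_isPrimitiveRoot_units hN
  have hq' : (q : ℂ) ≠ 0 := by exact_mod_cast hq.ne'
  have hw (f : Cone N q κ) := coneToDisc_mem_weight (κ := κ) hu.pow_eq_one hq f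
  -- Right linearity extends `φ` from two generators to any form whose coefficients over them lie in
  -- the cone; `h` is the function factored out on the right.
  have key {f f' : Disc q κ} {g g' h t t' : Disc q κ} (hω : oneForm f g ∈ forms N κ hq 1)
      (hω' : oneForm f' g' ∈ forms N κ hq 1) (ht : t * h ∈ Disc.weight q κ u 0)
      (ht' : t' * h ∈ Disc.weight q κ u 0) (η : forms N κ hq 1)
      (hη : (η : DiscForms q κ) =
        oneForm (f * (t * h) + f' * (t' * h)) (g * (t * h) + g' * (t' * h))) :
      coneToDisc N κ hq (φ η) = (coneToDisc N κ hq (φ ⟨_, hω⟩) * t +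
        coneToDisc N κ hq (φ ⟨_, hω'⟩) * t') * h := by
    obtain ⟨r, hr⟩ := exists_coneToDisc_eq hN hu hq hκ ht
    obtain ⟨r', hr'⟩ := exists_coneToDisc_eq hN hu hq hκ ht'
    have h1 : η = ⟨_, mul_ofDisc_mem hN hu hq hκ ht hω⟩ +
        ⟨_, mul_ofDisc_mem hN hu hq hκ ht' hω'⟩ := by
      refine Subtype.ext ?_
      rw [hη, ← oneForm_add, ← oneForm_mul_ofDisc, ← oneForm_mul_ofDisc]
      rfl
    have h2 := hφ ⟨_, hω⟩ ⟨_, mul_ofDisc_mem hN hu hq hκ ht hω⟩ r (by rw [hr])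
    have h3 := hφ ⟨_, hω'⟩ ⟨_, mul_ofDisc_mem hN hu hq hκ ht' hω'⟩ r' (by rw [hr'])
    rw [h1, map_add, h2, h3, map_add, map_mul, map_mul, hr, hr', add_mul, mul_assoc, mul_assoc]
  obtain ⟨t, htw, t', htw', ht⟩ := Disc.exists_left_partition_pos hq hκ hN hu.pow_eq_one
  obtain ⟨s, hsw, s', hsw', hs⟩ := Disc.exists_left_partition_neg hq hκ hN hu.pow_eq_one
  -- `F` and `G` are the values that `φ` would take on `dz*` and `dz`. These are not forms on the
  -- cone, so the values lie in the disc, with weights `-1` and `1`.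
  set F := coneToDisc N κ hq (φ ⟨_, oneForm_z_mem hN hu hq hκ⟩) * t +
    coneToDisc N κ hq (φ ⟨_, oneForm_zs_pow_mem hN hq hκ⟩) * t' with hF
  set G := coneToDisc N κ hq (φ ⟨_, oneForm_zs_mem hN hu hq hκ⟩) * s +
    coneToDisc N κ hq (φ ⟨_, oneForm_z_pow_mem hN hq hκ⟩) * s' with hG
  have hFw : F ∈ Disc.weight q κ u (-1) :=
    add_mem (Disc.mul_mem_weight (hw _) htw (by norm_num))
      (Disc.mul_mem_weight (hw _) htw' (by norm_num))
  have hGw : G ∈ Disc.weight q κ u 1 :=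
    add_mem (Disc.mul_mem_weight (hw _) hsw (by norm_num))
      (Disc.mul_mem_weight (hw _) hsw' (by norm_num))
  -- By `oneForm_mul_oneForm` the twisted coefficients of `ω` must be `F` and, after multiplication
  -- by `-q`, `G`.
  refine ⟨oneForm ((Disc.twist κ hq).symm F) ((Disc.twist κ hq).symm (-(q : ℂ)⁻¹ • G)),
    (mem_forms_one_iff hN hu hq hκ).2 ⟨_, Disc.twist_symm_mem_weight hq hFw, _,
      Disc.twist_symm_mem_weight hq (Submodule.smul_mem _ _ hGw), rfl⟩, fun η => ?_⟩
  obtain ⟨f, hf, g, hg, hη⟩ := (mem_forms_one_iff hN hu hq hκ).1 η.2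
  have hg1 : coneToDisc N κ hq (φ ⟨_, oneForm_right_mem hN hu hq hκ hg⟩) = F * g := by
    refine key _ _ (Disc.mul_mem_weight htw hg (by norm_num))
      (Disc.mul_mem_weight htw' hg (by norm_num)) _ ?_
    rw [← mul_assoc (Disc.z q κ), ← mul_assoc (Disc.zs q κ ^ _), ← add_mul, ht]
    simp
  have hf1 : coneToDisc N κ hq (φ ⟨_, oneForm_left_mem hN hu hq hκ hf⟩) = G * f := by
    refine key _ _ (Disc.mul_mem_weight hsw hf (by norm_num))
      (Disc.mul_mem_weight hsw' hf (by norm_num)) _ ?_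
    rw [← mul_assoc (Disc.zs q κ), ← mul_assoc (Disc.z q κ ^ _), ← add_mul, hs]
    simp
  have hη' : η = ⟨_, oneForm_left_mem hN hu hq hκ hf⟩ + ⟨_, oneForm_right_mem hN hu hq hκ hg⟩ := by
    refine Subtype.ext ?_
    rw [hη, Submodule.coe_add, oneForm_add, add_zero, zero_add]
  rw [hη, oneForm_mul_oneForm hq, AlgEquiv.apply_symm_apply, AlgEquiv.apply_symm_apply,
    smul_mul_assoc, smul_smul, mul_neg, mul_inv_cancel₀ hq', neg_one_smul, sub_neg_eq_add, hη',
    map_add φ, map_add (coneToDisc N κ hq), hg1, hf1, add_comm]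

theorem isIntegrable (hN : 0 < N) (hq : 0 < q) (hκ : κ ≠ 0) :
    (calculus hN hq hκ).IsIntegrable 2 := by
  obtain ⟨ν, hν⟩ := exists_modular_automorphism hN hq hκ
  have hinj := coneToDisc_injective hN hq hκ
  let e : Cone N q κ →ₗ[ℂ] forms N κ hq 2 :=
    { toFun := fun f => ⟨_, (mem_forms_two_iff hN hq hκ).2 ⟨f, rfl⟩⟩
      map_add' := fun f g => Subtype.ext (by simp [mul_add])
      map_smul' := fun c f => Subtype.ext (by simp) }
  have he : Function.Bijective e := by
    refine ⟨fun f g h => hinj (vol_mul_injective hq (congrArg Subtype.val h)), fun ω => ?_⟩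
    obtain ⟨f, hf⟩ := (mem_forms_two_iff hN hq hκ).1 ω.2
    exact ⟨f, Subtype.ext hf.symm⟩
  let π : forms N κ hq 2 ≃ₗ[ℂ] Cone N q κ := (LinearEquiv.ofBijective e he).symm
  have hπ (ω : forms N κ hq 2) (f : Cone N q κ) :
      π ω = f ↔ (ω : DiscForms q κ) = vol q κ * ofDisc q κ (coneToDisc N κ hq f) := by
    rw [LinearEquiv.symm_apply_eq, Subtype.ext_iff]
    rfl
  have hπ' (ω : forms N κ hq 2) := (hπ ω _).1 rfl
  have hr (ω η : forms N κ hq 2) (f : Cone N q κ)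
      (h : (η : DiscForms q κ) = ω * ofDisc q κ (coneToDisc N κ hq f)) : π η = π ω * f := by
    rw [hπ, map_mul, map_mul, ← mul_assoc, ← hπ', h]
  have hl (ω η : forms N κ hq 2) (f : Cone N q κ)
      (h : (η : DiscForms q κ) = ofDisc q κ (coneToDisc N κ hq f) * ω) : π η = ν f * π ω := by
    rw [hπ, map_mul, map_mul, ← mul_assoc, hν, ← ofDisc_mul_vol, mul_assoc, ← hπ', h]
  refine (calculus hN hq hκ).isIntegrable_two_of_perfect_pairing (hasDimension hN hq hκ) π ν
    (fun ω f => hr ω _ f rfl) (fun f ω => hl ω _ f rfl) (fun ω h => ?_) fun φ => ?_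
  · refine Subtype.ext (eq_zero_of_mul_eq_zero hN hq hκ ω.2 fun η hη => ?_)
    have := (hπ _ _).1 (h ⟨η, hη⟩)
    rw [map_zero, map_zero, mul_zero] at this
    exact this
  · obtain ⟨ω, hω, h⟩ := exists_mul_eq_of_right_linear hN hq hκ φ.1 fun η η' f h => by
      have h1 : η' = DifferentialCalculus.rsmul (Γ := calculus hN hq hκ) η f := Subtype.ext h
      rw [h1]
      exact φ.2 η f
    exact ⟨⟨ω, hω⟩, fun η => ((hπ _ _).2 (h η)).symm⟩

end Cone

end QuantumCone

end

theorem theorem4p1 (N : ℕ) (hN : 0 < N) (q κ : ℝ) (hq : 0 < q) (hκ : κ ≠ 0) :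
    (∃ Γ : QuantumCone.DifferentialCalculus (QuantumCone.Cone N q κ),
      Γ.toCalculusData = QuantumCone.coneCalculus N κ hq ∧
      Γ.HasDimension 2 ∧ Γ.IsConnected ∧ Γ.IsIntegrable 2) ∧
    QuantumCone.IsAffineOfGKDim (QuantumCone.Cone N q κ) 2 ∧
    QuantumCone.IsDifferentiallySmooth (QuantumCone.Cone N q κ) := by
  have hdim := QuantumCone.Cone.hasDimension hN hq hκ
  have hcon := QuantumCone.Cone.isConnected hN hq hκ
  have hint := QuantumCone.Cone.isIntegrable hN hq hκ
  have hGK := QuantumCone.Cone.isAffineOfGKDim hN hq hκ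
  exact ⟨⟨_, rfl, hdim, hcon, hint⟩, hGK, 2, by exact_mod_cast hGK, _, hdim, hcon, hint⟩
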